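/- **Setting.** Let $R,\omega,\epsilon_m,\mu_m>0$, let $D=\{x\in\mathbb R^3:|x|<R\}$ with exterior unit normal $\nu$, and let $\epsilon_c,\mu_c\in\mathbb C$. Put $k_m=\omega\sqrt{\epsilon_m\mu_m}$ and let $k_c\neq 0$ be a complex number with $k_c^2=\omega^2\epsilon_c\mu_c$. Let $L^2_T(\partial D)$ be the space of $\varphi\in L^2(\partial D)^3$ (complex valued) with $\nu\cdot\varphi=0$, and $TH(\mathrm{div},\partial D)$ the space of $\varphi\in L^2_T(\partial D)$ whose weak surface divergence $\nabla_{\partial D}\cdot\varphi$ lies in $L^2(\partial D)$. With $G(x,y,k)=-\frac{e^{ik|x-y|}}{4\pi|x-y|}$ define, for $x\in\partial D$, $$\mathcal M^k[\varphi](x)=\int_{\partial D}\nu_x\times\nabla_x\times\big(G(x,y,k)\varphi(y)\big)\,ds(y),\qquad \mathcal L^k[\varphi]=\nu\times\big(k^2\mathcal A^k[\varphi]+\nabla\mathcal S^k[\nabla_{\partial D}\cdot\varphi]\big),$$ where $\mathcal A^k[\varphi](x)=\int_{\partial D}G(x,y,k)\varphi(y)\,ds(y)$, $\mathcal S^k[g](x)=\int_{\partial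 D}G(x,y,k)g(y)\,ds(y)$ and, under $\nu\times$, $\nabla\mathcal S^k[g]$ is the weak surface gradient. On $TH(\mathrm{div},\partial D)^2$ let $$\mathbb I+\mathbb K=\begin{pmatrix}\frac{\mu_c+\mu_m}{2}I+\mu_c\mathcal M^{k_c}-\mu_m\mathcal M^{k_m} & \mathcal L^{k_c}-\mathcal L^{k_m}\\ \mathcal L^{k_c}-\mathcal L^{k_m} & \Big(\frac{k_c^2}{2\mu_c}+\frac{k_m^2}{2\mu_m}\Big)I+\frac{k_c^2}{\mu_c}\mathcal M^{k_c}-\frac{k_m^2}{\mu_m}\mathcal M^{k_m}\end{pmatrix}.$$ Let $j_n$, $h_n^{(1)}$ be the spherical Bessel and Hankel functions and, for $n\ge0$, $$\lambda_{n,k}=\tfrac12-\mathrm i k^2R^2j_n'(kR)h_n^{(1)}(kR),\qquad \chi_{n,k}=-\mathrm i kR^2h_n^{(1)}(kR)j_n(kR).$$ For $n\ge1$ put $$\pi_{1,n}=\tfrac{(n+1)\lambda_{n-1,k}+n\lambda_{n+1,k}}{2n+1},\quad \sigma_{1,n}=\tfrac{(n+1)\chi_{n-1,k}+n\chi_{n+1,k}}{2n+1},\quad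 \sigma_{3,n}=\tfrac{\chi_{n-1,k}-\chi_{n+1,k}}{2n+1},$$ $$m_{1,n}^k=\pi_{1,n}+\tfrac1R(\sigma_{1,n}-n(n+1)\sigma_{3,n}),\quad m_{2,n}^k=\lambda_{n,k}+\tfrac{\chi_{n,k}}R,\quad l_{1,n}^k=k^2\chi_{n,k},\quad l_{2,n}^k=\tfrac{n(n+1)}{R^2}\chi_{n,k}-k^2\sigma_{1,n},$$ $\delta_{j,n}=l_{j,n}^{k_c}-l_{j,n}^{k_m}$ $(j=1,2)$, and $$q_{1,n}=k_m^2(2m_{2,n}^{k_m}-1)\mu_c+\mu_m\big(\mu_c(\mu_c+2m_{1,n}^{k_c}\mu_c+\mu_m-2m_{1,n}^{k_m}\mu_m)-k_c^2(2m_{2,n}^{k_c}+1)\big),$$ $$q_{2,n}=k_m^2(2m_{1,n}^{k_m}-1)\mu_c+\mu_m\big(\mu_c(\mu_c+2m_{2,n}^{k_c}\mu_c+\mu_m-2m_{2,n}^{k_m}\mu_m)-k_c^2(2m_{1,n}^{k_c}+1)\big),$$ $\beta_{j,n}=16\,\delta_{1,n}\delta_{2,n}\mu_c^2\mu_m^2+q_{j,n}^2$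 $(j=1,2)$. Fix, for each $n$ and $j$, any square root $\sqrt{\beta_{j,n}}$, and let $$\alpha_{1,2}=\frac{q_{1,n}\pm\sqrt{\beta_{1,n}}}{4\delta_{1,n}\mu_c\mu_m},\qquad \alpha_{3,4}=\frac{q_{2,n}\pm\sqrt{\beta_{2,n}}}{4\delta_{2,n}\mu_c\mu_m},$$ $$\tau_{i,n}=\alpha_i\delta_{1,n}+\tfrac{k_c^2}{\mu_c}m_{2,n}^{k_c}-\tfrac{k_m^2}{\mu_m}m_{2,n}^{k_m}+\tfrac{k_c^2}{2\mu_c}+\tfrac{k_m^2}{2\mu_m}\quad(i=1,2),$$ $$\tau_{i,n}=\alpha_i\delta_{2,n}+\tfrac{k_c^2}{\mu_c}m_{1,n}^{k_c}-\tfrac{k_m^2}{\mu_m}m_{1,n}^{k_m}+\tfrac{k_c^2}{2\mu_c}+\tfrac{k_m^2}{2\mu_m}\quad(i=3,4).$$ For a spherical harmonic $Y$ of degree $n$, viewed on $\partial D$ through $x\mapsto x/|x|$, and the surface gradient $\nabla_{\mathbb S}$ of the unit sphere, let $$\Xi_{i,n}[Y]=\begin{pmatrix}\alpha_i\nabla_{\mathbb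 S}Y\times\nu\\ \nabla_{\mathbb S}Y\end{pmatrix}\ (i=1,2),\qquad \Xi_{i,n}[Y]=\begin{pmatrix}\alpha_i\nabla_{\mathbb S}Y\\ \nabla_{\mathbb S}Y\times\nu\end{pmatrix}\ (i=3,4).$$ **Theorem.** 1. Let $n\ge1$ and let $Y\ne0$ be a spherical harmonic of degree $n$. If $\delta_{1,n}\neq0$, then $\Xi_{i,n}[Y]\neq0$ and $(\mathbb I+\mathbb K)\,\Xi_{i,n}[Y]=\tau_{i,n}\,\Xi_{i,n}[Y]$ for $i=1,2$; if $\delta_{2,n}\ne0$, the same holds for $i=3,4$. 2. If $\delta_{1,n}\ne0$ and $\delta_{2,n}\neq0$ for all $n\ge1$, then every eigenvalue of $\mathbb I+\mathbb K$ on $TH(\mathrm{div},\partial D)^2$ is one of the numbers $\tau_{i,n}$, $1\le i\le4$, $n\ge1$. 3. Suppose that $\delta_{1,n},\delta_{2,n},\beta_{1,n},\beta_{2,n}$ are nonzero for all $n\ge1$, and let $(Y_n^m)_m$ be, for each $n\geq 1$, an orthonormal basis (in $L^2$ of the unit sphere) of the spherical harmonics of degree $n$. Then the functions $\Xi_{i,n}[Y_n^m]$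 form a complete basis of $L^2_T(\partial D)^2$: they are linearly independent, their linear span is dense, and every $F\in L^2_T(\partial D)^2$ has a unique expansion $F=\sum_{(n,m)}\big(\sum_{i=1}^4 f_{i,n,m}\,\Xi_{i,n}[Y_n^m]\big)$ with complex coefficients, where the sum over $(n,m)$ converges unconditionally in $L^2$. -/

import Mathlib

noncomputable section

namespace MaxwellBall

open MeasureTheory Complex

/-! ### Vector calculus in `ℝ³` and on the spheres `∂D = {|x| = R}` -/

/-- Euclidean space `ℝ³`. -/
abbrev E3 : Type := EuclideanSpace ℝ (Fin 3)

/-- The space `ℂ³` of values of complex vector fields. -/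
abbrev C3 : Type := EuclideanSpace ℂ (Fin 3)

/-- A real vector seen as a complex one. -/
def toC (x : E3) : C3 := WithLp.toLp 2 fun i => (x i : ℂ)

/-- The bilinear (not sesquilinear) product `a · b` on `ℂ³`. -/
def dot (a b : C3) : ℂ := ∑ i, a i * b i

/-- The cross product on `ℂ³`. -/
def cross (a b : C3) : C3 := WithLp.toLp 2 (crossProduct a.ofLp b.ofLp)

/-- The exterior unit normal `ν` at a point of a sphere centred at the origin. -/
def normal (x : E3) : C3 := toC (‖x‖⁻¹ • x)

/-- The partial derivative `∂ᵢ f`. -/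
def pd (i : Fin 3) (f : E3 → ℂ) (x : E3) : ℂ := fderiv ℝ f x (EuclideanSpace.single i 1)

/-- The gradient `∇ f`. -/
def grad (f : E3 → ℂ) (x : E3) : C3 := WithLp.toLp 2 fun i => pd i f x

/-- The curl `∇ × F`. -/
def curl (F : E3 → C3) (x : E3) : C3 :=
  WithLp.toLp 2 ![pd 1 (fun z => F z 2) x - pd 2 (fun z => F z 1) x,
    pd 2 (fun z => F z 0) x - pd 0 (fun z => F z 2) x,
    pd 0 (fun z => F z 1) x - pd 1 (fun z => F z 0) x]

/-- The surface gradient, on the sphere of radius `R`, of the restriction of `f` to this sphere: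
the gradient of the extension that is constant along rays. -/
def surfGrad (R : ℝ) (f : E3 → ℂ) (x : E3) : C3 := grad (fun y => f ((R / ‖y‖) • y)) x

/-- The surface divergence, on the sphere of radius `R`, of a differentiable vector field. -/
def surfDiv (R : ℝ) (w : E3 → C3) (x : E3) : ℂ := ∑ i, surfGrad R (fun y => w y i) x i

/-- The surface measure `ds` of the sphere of radius `R`, as a measure on `ℝ³`. Here
`volume.toSphere` is the surface measure of the unit sphere (of total mass `4π`). -/
def surfMeasure (R : ℝ) : Measure E3 :=
  ENNReal.ofReal (R ^ 2) •
    ((volume : Measure E3).toSphere.map fun s : Metric.sphere (0 : E3) 1 => R • (s : E3))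

/-- `L²(∂D)`. -/
abbrev L2S (R : ℝ) : Type := Lp ℂ 2 (surfMeasure R)

/-- `L²(∂D)³`. -/
abbrev L2V (R : ℝ) : Type := Lp C3 2 (surfMeasure R)

/-- `L²_T(∂D)`, the tangential square integrable fields. -/
def L2T (R : ℝ) : Submodule ℂ (L2V R) where
  carrier := {φ | ∀ᵐ x ∂surfMeasure R, dot (normal x) (φ x) = 0}
  add_mem' := by
    intro a b ha hb
    filter_upwards [ha, hb, Lp.coeFn_add a b] with x h1 h2 h3
    rw [h3]
    simp only [dot, Pi.add_apply, PiLp.add_apply, mul_add, Finset.sum_add_distrib] at *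
    rw [h1, h2, add_zero]
  zero_mem' := by
    filter_upwards [Lp.coeFn_zero C3 2 (surfMeasure R)] with x h
    rw [h]
    simp [dot]
  smul_mem' := by
    intro c a ha
    filter_upwards [ha, Lp.coeFn_smul c a] with x h1 h3
    rw [h3]
    simp only [dot, Pi.smul_apply, PiLp.smul_apply, smul_eq_mul] at *
    simp_rw [mul_left_comm _ c, ← Finset.mul_sum, h1, mul_zero]

/-- `g ∈ L²(∂D)` is the weak surface divergence of the tangential field `φ`. The fields
`φ ∈ L²_T(∂D)` for which such a `g` exists are those of `TH(div, ∂D)`. -/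
def IsWeakSurfDiv (R : ℝ) (φ : L2V R) (g : L2S R) : Prop :=
  ∀ η : E3 → ℂ, ContDiff ℝ (⊤ : ℕ∞) η →
    ∫ x, g x * η x ∂surfMeasure R = -∫ x, dot (φ x) (surfGrad R η x) ∂surfMeasure R

/-- `V ∈ L²_T(∂D)` is the weak surface gradient of `f ∈ L²(∂D)`; the functions `f` for which such
a `V` exists are those of `H¹(∂D)`. -/
def IsWeakSurfGrad (R : ℝ) (f : L2S R) (V : L2V R) : Prop :=
  V ∈ L2T R ∧
  ∀ w : E3 → C3, ContDiff ℝ (⊤ : ℕ∞) w → (∀ x, ‖x‖ = R → dot (normal x) (w x) = 0) →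
    ∫ x, dot (V x) (w x) ∂surfMeasure R = -∫ x, f x * surfDiv R w x ∂surfMeasure R

/-! ### The boundary integral operators

Each operator is given by its graph: `IsX R k φ ψ` says that `φ` is in the domain and that
`X φ = ψ`. The integrals are required to converge absolutely at almost every point. -/

/-- The outgoing fundamental solution `G(x, y, k)` of `Δ + k²`. -/
def G (k : ℂ) (x y : E3) : ℂ := -(exp (I * k * ‖x - y‖) / (4 * Real.pi * ‖x - y‖))

/-- The single layer operator `S̃_D^k` on `L²(∂D)`. -/
def IsS (R : ℝ) (k : ℂ) (φ ψ : L2S R) : Prop :=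
  ∀ᵐ x ∂surfMeasure R, Integrable (fun y => G k x y * φ y) (surfMeasure R) ∧
    ψ x = ∫ y, G k x y * φ y ∂surfMeasure R

/-- The vectorial single layer operator `Ã_D^k` on `L²(∂D)³`. -/
def IsA (R : ℝ) (k : ℂ) (φ ψ : L2V R) : Prop :=
  ∀ᵐ x ∂surfMeasure R, Integrable (fun y => G k x y • φ y) (surfMeasure R) ∧
    ψ x = ∫ y, G k x y • φ y ∂surfMeasure R

/-- The operator `M_D^k[φ](x) = ∫ ν_x × (∇_x × (G(x, y, k) φ(y))) ds(y)`. -/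
def IsM (R : ℝ) (k : ℂ) (φ ψ : L2V R) : Prop :=
  ∀ᵐ x ∂surfMeasure R,
    Integrable (fun y => cross (normal x) (curl (fun z => G k z y • φ y) x)) (surfMeasure R) ∧
    ψ x = ∫ y, cross (normal x) (curl (fun z => G k z y • φ y) x) ∂surfMeasure R

/-- The operator `L_D^k[φ] = ν × (k² Ã_D^k[φ] + ∇ S̃_D^k[∇_{∂D} · φ])`. Here `g = ∇_{∂D} · φ`,
`f = S̃_D^k[g] ∈ H¹(∂D)`, and `V = ∇_{∂D} f` is the tangential part of the gradient, the only
one that `ν ×` sees. In particular `φ` has to have a weak divergence in `L²(∂D)`. -/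
def IsL (R : ℝ) (k : ℂ) (φ ψ : L2V R) : Prop :=
  ∃ (a V : L2V R) (g f : L2S R), IsA R k φ a ∧ IsWeakSurfDiv R φ g ∧ IsS R k g f ∧
    IsWeakSurfGrad R f V ∧
    ∀ᵐ x ∂surfMeasure R, ψ x = cross (normal x) (k ^ 2 • a x + V x)

/-- The matrix operator `𝕀 + 𝕂` on `TH(div, ∂D)²`: `(𝕀 + 𝕂) Φ = Ψ`. That both components of `Φ`
lie in `TH(div, ∂D)` is part of `IsL`. -/
def IsIPlusK (R : ℝ) (km kc μm μc : ℂ) (Φ Ψ : L2T R × L2T R) : Prop :=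
  ∃ Mc₁ Mm₁ Mc₂ Mm₂ Lc₁ Lm₁ Lc₂ Lm₂ : L2V R,
    IsM R kc Φ.1 Mc₁ ∧ IsM R km Φ.1 Mm₁ ∧ IsM R kc Φ.2 Mc₂ ∧ IsM R km Φ.2 Mm₂ ∧
    IsL R kc Φ.1 Lc₁ ∧ IsL R km Φ.1 Lm₁ ∧ IsL R kc Φ.2 Lc₂ ∧ IsL R km Φ.2 Lm₂ ∧
    (Ψ.1 : L2V R) = ((μc + μm) / 2) • (Φ.1 : L2V R) + (μc • Mc₁ - μm • Mm₁) + (Lc₂ - Lm₂) ∧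
    (Ψ.2 : L2V R) = (kc ^ 2 / (2 * μc) + km ^ 2 / (2 * μm)) • (Φ.2 : L2V R) + (Lc₁ - Lm₁) +
      ((kc ^ 2 / μc) • Mc₂ - (km ^ 2 / μm) • Mm₂)

/-- `(τ, Φ)` is an eigenpair of `𝕀 + 𝕂`. -/
def IsEigenpair (R : ℝ) (km kc μm μc τ : ℂ) (Φ : L2T R × L2T R) : Prop :=
  Φ ≠ 0 ∧ IsIPlusK R km kc μm μc Φ (τ • Φ)

/-! ### Spherical harmonics -/

/-- The Laplacian on polynomials in three variables. -/
def polyLaplacian : MvPolynomial (Fin 3) ℂ →ₗ[ℂ] MvPolynomial (Fin 3) ℂ :=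
  ∑ i, (MvPolynomial.pderiv i).toLinearMap ∘ₗ (MvPolynomial.pderiv i).toLinearMap

/-- The spherical harmonics of degree `n`, each given by the homogeneous harmonic polynomial of
degree `n` whose restriction to the unit sphere it is. -/
def SphHarm (n : ℕ) : Submodule ℂ (MvPolynomial (Fin 3) ℂ) :=
  MvPolynomial.homogeneousSubmodule (Fin 3) ℂ n ⊓ LinearMap.ker polyLaplacian

/-- The function on `ℝ³` given by a polynomial. -/
def evalP (p : MvPolynomial (Fin 3) ℂ) (x : E3) : ℂ := MvPolynomial.eval (fun i => (x i : ℂ)) p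

/-- `Y` is an orthonormal basis, in `L²` of the unit sphere, of the spherical harmonics of
degree `n`. -/
def IsOrthonormalHarmonics {ι : Type} (n : ℕ) (Y : ι → SphHarm n) : Prop :=
  (∀ i, ∫ x, evalP (Y i) x * (starRingEnd ℂ) (evalP (Y i) x) ∂surfMeasure 1 = 1) ∧
  (∀ i j, i ≠ j → ∫ x, evalP (Y i) x * (starRingEnd ℂ) (evalP (Y j) x) ∂surfMeasure 1 = 0) ∧
  Submodule.span ℂ (Set.range Y) = ⊤

/-- The field `x ↦ (∇_𝕊 Y)(x / |x|)`, where `∇_𝕊` is the surface gradient on the unit sphere. -/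
def gradY (p : MvPolynomial (Fin 3) ℂ) (x : E3) : C3 := surfGrad 1 (evalP p) (‖x‖⁻¹ • x)

/-- The field `∇_𝕊 Y × ν`. -/
def curlY (p : MvPolynomial (Fin 3) ℂ) (x : E3) : C3 := cross (gradY p x) (normal x)

theorem contDiff_evalP (p : MvPolynomial (Fin 3) ℂ) : ContDiff ℝ (⊤ : ℕ∞) (evalP p) := by
  induction p using MvPolynomial.induction_on with
  | C a =>
    have : evalP (MvPolynomial.C a) = fun _ => a := by
      funext x
      simp [evalP]
    rw [this]
    exact contDiff_const
  | add p q hp hq =>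
    have : evalP (p + q) = fun x => evalP p x + evalP q x := by
      funext x
      simp [evalP]
    rw [this]
    exact hp.add hq
  | mul_X p i hp =>
    have : evalP (p * MvPolynomial.X i) = fun x => evalP p x * ((x i : ℝ) : ℂ) := by
      funext x
      simp [evalP]
    rw [this]
    refine hp.mul (Complex.ofRealCLM.contDiff.comp ?_)
    exact (EuclideanSpace.proj i : E3 →L[ℝ] ℝ).contDiff

theorem measurable_gradY (p : MvPolynomial (Fin 3) ℂ) : Measurable (gradY p) := by
  have h : Measurable fun x => (gradY p x).ofLp := by
    refine measurable_pi_lambda _ fun i => ?_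
    have h1 : Measurable fun x => pd i (fun y => evalP p ((1 / ‖y‖) • y)) x :=
      measurable_fderiv_apply_const ℝ _ _
    exact h1.comp (measurable_norm.inv.smul measurable_id)
  exact (WithLp.measurable_toLp 2 _).comp h

theorem bounded_gradY (p : MvPolynomial (Fin 3) ℂ) : ∃ C, ∀ x, ‖gradY p x‖ ≤ C := by
  have hcd : ContDiffOn ℝ 1 (fun y : E3 => evalP p ((1 / ‖y‖) • y)) {0}ᶜ := by
    refine ((contDiff_evalP p).of_le (by exact_mod_cast le_top)).comp_contDiffOn ?_
    refine ContDiffOn.smul (f := fun y : E3 => 1 / ‖y‖) (g := fun y : E3 => y) ?_ contDiffOn_id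
    have hn : ContDiffOn ℝ 1 (fun y : E3 => ‖y‖) {0}ᶜ := fun x hx =>
      (contDiffAt_norm ℝ hx).contDiffWithinAt
    simp only [one_div]
    exact hn.inv fun x hx => norm_ne_zero_iff.mpr hx
  have hc : ContinuousOn (fderiv ℝ (fun y : E3 => evalP p ((1 / ‖y‖) • y))) {0}ᶜ :=
    hcd.continuousOn_fderiv_of_isOpen isOpen_compl_singleton le_rfl
  have hg : ContinuousOn (surfGrad 1 (evalP p)) (Metric.sphere 0 1) := by
    have h2 : ContinuousOn (fun x => (surfGrad 1 (evalP p) x).ofLp) (Metric.sphere 0 1) := by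
      refine continuousOn_pi.mpr fun i => ?_
      refine (hc.mono ?_).clm_apply continuousOn_const
      intro x hx h0
      simp_all
    exact (PiLp.continuous_toLp 2 (fun _ : Fin 3 => ℂ)).comp_continuousOn h2
  obtain ⟨C, hC⟩ := (isCompact_sphere (0 : E3) 1).exists_bound_of_continuousOn hg
  refine ⟨max C ‖surfGrad 1 (evalP p) 0‖, fun x => ?_⟩
  by_cases hx : x = 0
  · subst hx
    simp [gradY]
  · refine le_max_of_le_left (hC _ ?_)
    simp [norm_smul, hx]

theorem dot_normal_gradY (p : MvPolynomial (Fin 3) ℂ) (x : E3) :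
    dot (normal x) (gradY p x) = 0 := by
  set f : E3 → ℂ := fun y => evalP p ((1 / ‖y‖) • y) with hf
  set u : E3 := ‖x‖⁻¹ • x with hu
  have h1 : dot (normal x) (gradY p x) = fderiv ℝ f u u := by
    have h2 : u = ∑ i, u i • EuclideanSpace.single i (1 : ℝ) := by
      ext j
      simp [Pi.single_apply]
    conv_rhs => rw [h2]
    rw [map_sum, ← h2]
    simp [dot, normal, toC, gradY, surfGrad, grad, pd, hf, ← hu]
  rw [h1]
  by_cases hd : DifferentiableAt ℝ f u
  · have h3 : HasDerivAt (fun t : ℝ => f (u + t • u)) (fderiv ℝ f u u) 0 := by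
      have h5 : HasDerivAt (fun t : ℝ => u + t • u) u 0 := by
        simpa using ((hasDerivAt_id (0 : ℝ)).smul_const u).const_add u
      have h6 : HasFDerivAt f (fderiv ℝ f u) (u + (0 : ℝ) • u) := by
        simpa using hd.hasFDerivAt
      exact h6.comp_hasDerivAt 0 h5
    have h4 : (fun t : ℝ => f (u + t • u)) =ᶠ[nhds 0] fun _ => f u := by
      filter_upwards [lt_mem_nhds (show (-1 : ℝ) < 0 by norm_num)] with t ht
      have h7 : u + t • u = (1 + t) • u := by rw [add_smul, one_smul]
      have h8 : 0 < 1 + t := by linarith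
      simp only [hf, h7, norm_smul, Real.norm_eq_abs, abs_of_pos h8, smul_smul]
      congr 2
      field_simp
    exact h3.unique ((hasDerivAt_const (0 : ℝ) (f u)).congr_of_eventuallyEq h4)
  · rw [fderiv_zero_of_not_differentiableAt hd]
    rfl

instance (R : ℝ) : IsFiniteMeasure (surfMeasure R) := by
  unfold surfMeasure
  exact Measure.smul_finite _ ENNReal.ofReal_ne_top

theorem memLp_gradY (R : ℝ) (p : MvPolynomial (Fin 3) ℂ) :
    MemLp (gradY p) 2 (surfMeasure R) := by
  obtain ⟨C, hC⟩ := bounded_gradY p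
  exact MemLp.of_bound (measurable_gradY p).aestronglyMeasurable C (Filter.Eventually.of_forall hC)

theorem norm_normal_le (x : E3) (i : Fin 3) : ‖normal x i‖ ≤ 1 := by
  have h : ‖(‖x‖⁻¹ • x : E3) i‖ ≤ 1 := by
    refine (PiLp.norm_apply_le _ i).trans ?_
    rw [norm_smul, norm_inv, norm_norm]
    exact inv_mul_le_one
  simpa [normal, toC] using h

theorem memLp_curlY (R : ℝ) (p : MvPolynomial (Fin 3) ℂ) :
    MemLp (curlY p) 2 (surfMeasure R) := by
  obtain ⟨C, hC⟩ := bounded_gradY p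
  have hn : Measurable normal := by
    refine (WithLp.measurable_toLp 2 _).comp (measurable_pi_lambda _ fun i => ?_)
    refine Complex.measurable_ofReal.comp ?_
    exact (EuclideanSpace.proj i : E3 →L[ℝ] ℝ).measurable.comp (measurable_norm.inv.smul measurable_id)
  have hni : ∀ i, Measurable fun x => normal x i := fun i =>
    (EuclideanSpace.proj i : C3 →L[ℂ] ℂ).measurable.comp hn
  have hgi : ∀ i, Measurable fun x => gradY p x i := fun i =>
    (EuclideanSpace.proj i : C3 →L[ℂ] ℂ).measurable.comp (measurable_gradY p)
  have hb : ∀ i j x, ‖gradY p x i * normal x j‖ ≤ C := fun i j x => by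
    rw [norm_mul]
    calc ‖gradY p x i‖ * ‖normal x j‖ ≤ ‖gradY p x i‖ * 1 := by
          gcongr
          exact norm_normal_le x j
      _ ≤ C := by
          rw [mul_one]
          exact (PiLp.norm_apply_le _ i).trans (hC x)
  have hm : ∀ i j, MemLp (fun x => gradY p x i * normal x j) 2 (surfMeasure R) := fun i j =>
    MemLp.of_bound ((hgi i).mul (hni j)).aestronglyMeasurable C
      (Filter.Eventually.of_forall (hb i j))
  refine memLp_piLp_iff.mpr fun i => ?_
  fin_cases i
  · have h := (hm 1 2).sub (hm 2 1)
    refine h.ae_eq (Filter.Eventually.of_forall fun x => ?_)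
    simp [curlY, cross, crossProduct]
  · have h := (hm 2 0).sub (hm 0 2)
    refine h.ae_eq (Filter.Eventually.of_forall fun x => ?_)
    simp [curlY, cross, crossProduct]
  · have h := (hm 0 1).sub (hm 1 0)
    refine h.ae_eq (Filter.Eventually.of_forall fun x => ?_)
    simp [curlY, cross, crossProduct]

/-- `∇_𝕊 Y` as an element of `L²_T(∂D)`. -/
def gradYT (R : ℝ) (p : MvPolynomial (Fin 3) ℂ) : L2T R :=
  ⟨(memLp_gradY R p).toLp, by
    filter_upwards [(memLp_gradY R p).coeFn_toLp] with x h
    rw [h]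
    exact dot_normal_gradY p x⟩

/-- `∇_𝕊 Y × ν` as an element of `L²_T(∂D)`. -/
def curlYT (R : ℝ) (p : MvPolynomial (Fin 3) ℂ) : L2T R :=
  ⟨(memLp_curlY R p).toLp, by
    filter_upwards [(memLp_curlY R p).coeFn_toLp] with x h
    rw [h]
    simp [dot, curlY, cross, crossProduct, Fin.sum_univ_three]
    ring⟩

/-! ### Spherical Bessel and Hankel functions, and the explicit coefficients -/

/-- The operator `(1 / t) d/dt`. -/
def rayleighOp (f : ℂ → ℂ) (t : ℂ) : ℂ := deriv f t / t

/-- The spherical Bessel function `j_n` (Rayleigh's formula, `t ≠ 0`). -/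
def sphJ (n : ℕ) (t : ℂ) : ℂ := (-t) ^ n * (rayleighOp^[n] fun u => sin u / u) t

/-- The spherical Hankel function `h_n^{(1)}` (Rayleigh's formula, `t ≠ 0`). -/
def sphH (n : ℕ) (t : ℂ) : ℂ := -I * ((-t) ^ n * (rayleighOp^[n] fun u => exp (I * u) / u) t)

/-- `λ_{n,k,R}`. -/
def lam (R : ℝ) (k : ℂ) (n : ℕ) : ℂ :=
  1 / 2 - I * k ^ 2 * R ^ 2 * deriv (sphJ n) (k * R) * sphH n (k * R)

/-- `χ_{n,k,R}`. -/
def chi (R : ℝ) (k : ℂ) (n : ℕ) : ℂ := -I * k * R ^ 2 * sphH n (k * R) * sphJ n (k * R)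

/-- `π_{1,n}` (for `n ≥ 1`). -/
def pi1 (R : ℝ) (k : ℂ) (n : ℕ) : ℂ :=
  ((n + 1) * lam R k (n - 1) + n * lam R k (n + 1)) / (2 * n + 1)

/-- `σ_{1,n}` (for `n ≥ 1`). -/
def sig1 (R : ℝ) (k : ℂ) (n : ℕ) : ℂ :=
  ((n + 1) * chi R k (n - 1) + n * chi R k (n + 1)) / (2 * n + 1)

/-- `σ_{3,n}` (for `n ≥ 1`). -/
def sig3 (R : ℝ) (k : ℂ) (n : ℕ) : ℂ := (chi R k (n - 1) - chi R k (n + 1)) / (2 * n + 1)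

/-- `m_{1,n}^k`. -/
def m1 (R : ℝ) (k : ℂ) (n : ℕ) : ℂ :=
  pi1 R k n + 1 / R * (sig1 R k n - n * (n + 1) * sig3 R k n)

/-- `m_{2,n}^k`. -/
def m2 (R : ℝ) (k : ℂ) (n : ℕ) : ℂ := lam R k n + chi R k n / R

/-- `l_{1,n}^k`. -/
def l1 (R : ℝ) (k : ℂ) (n : ℕ) : ℂ := k ^ 2 * chi R k n

/-- `l_{2,n}^k`. -/
def l2 (R : ℝ) (k : ℂ) (n : ℕ) : ℂ := n * (n + 1) / R ^ 2 * chi R k n - k ^ 2 * sig1 R k n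

/-- The part of the numerator of `α₁`, `α₂` that precedes the square root. -/
def q1 (R : ℝ) (km kc μm μc : ℂ) (n : ℕ) : ℂ :=
  km ^ 2 * (2 * m2 R km n - 1) * μc +
    μm * (μc * (μc + 2 * m1 R kc n * μc + μm - 2 * m1 R km n * μm) - kc ^ 2 * (2 * m2 R kc n + 1))

/-- The part of the numerator of `α₃`, `α₄` that precedes the square root. -/
def q2 (R : ℝ) (km kc μm μc : ℂ) (n : ℕ) : ℂ :=
  km ^ 2 * (2 * m1 R km n - 1) * μc +
    μm * (μc * (μc + 2 * m2 R kc n * μc + μm - 2 * m2 R km n * μm) - kc ^ 2 * (2 * m1 R kc n + 1))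

/-- `l_{1,n}^{k_c} - l_{1,n}^{k_m}`. -/
def dl1 (R : ℝ) (km kc : ℂ) (n : ℕ) : ℂ := l1 R kc n - l1 R km n

/-- `l_{2,n}^{k_c} - l_{2,n}^{k_m}`. -/
def dl2 (R : ℝ) (km kc : ℂ) (n : ℕ) : ℂ := l2 R kc n - l2 R km n

/-- `β₁`. -/
def beta1 (R : ℝ) (km kc μm μc : ℂ) (n : ℕ) : ℂ :=
  16 * dl1 R km kc n * dl2 R km kc n * μc ^ 2 * μm ^ 2 + q1 R km kc μm μc n ^ 2

/-- `β₂`. -/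
def beta2 (R : ℝ) (km kc μm μc : ℂ) (n : ℕ) : ℂ :=
  16 * dl1 R km kc n * dl2 R km kc n * μc ^ 2 * μm ^ 2 + q2 R km kc μm μc n ^ 2

/-- `α₁, …, α₄` (indexed by `0, …, 3`), where `s₁`, `s₂` are the chosen square roots of
`β₁`, `β₂`. -/
def alpha (R : ℝ) (km kc μm μc s₁ s₂ : ℂ) (n : ℕ) : Fin 4 → ℂ :=
  ![(q1 R km kc μm μc n + s₁) / (4 * dl1 R km kc n * μc * μm),
    (q1 R km kc μm μc n - s₁) / (4 * dl1 R km kc n * μc * μm),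
    (q2 R km kc μm μc n + s₂) / (4 * dl2 R km kc n * μc * μm),
    (q2 R km kc μm μc n - s₂) / (4 * dl2 R km kc n * μc * μm)]

/-- The eigenvalues `τ_{1,n}, …, τ_{4,n}` (indexed by `0, …, 3`). -/
def tau (R : ℝ) (km kc μm μc s₁ s₂ : ℂ) (n : ℕ) : Fin 4 → ℂ :=
  let α := alpha R km kc μm μc s₁ s₂ n
  let t₁ := kc ^ 2 / μc * m2 R kc n - km ^ 2 / μm * m2 R km n +
    kc ^ 2 / (2 * μc) + km ^ 2 / (2 * μm)
  let t₂ := kc ^ 2 / μc * m1 R kc n - km ^ 2 / μm * m1 R km n +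
    kc ^ 2 / (2 * μc) + km ^ 2 / (2 * μm)
  ![α 0 * dl1 R km kc n + t₁, α 1 * dl1 R km kc n + t₁,
    α 2 * dl2 R km kc n + t₂, α 3 * dl2 R km kc n + t₂]

/-- The eigenfunctions `Ξ_{1,n}, …, Ξ_{4,n}` (indexed by `0, …, 3`) built from the spherical
harmonic `Y` of degree `n`. -/
def Xi (R : ℝ) (km kc μm μc s₁ s₂ : ℂ) (n : ℕ) (Y : SphHarm n) : Fin 4 → L2T R × L2T R :=
  let α := alpha R km kc μm μc s₁ s₂ n
  ![(α 0 • curlYT R Y, gradYT R Y), (α 1 • curlYT R Y, gradYT R Y),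
    (α 2 • gradYT R Y, curlYT R Y), (α 3 • gradYT R Y, curlYT R Y)]

end MaxwellBall

end

/-!
The integral operators on the sphere commute with rotations, so they act by scalars on spherical
harmonics and by small matrices on vector spherical harmonics. All fields are represented by
restrictions of polynomials: for a homogeneous harmonic polynomial `p` of degree `n`, the fields
`curlP p = ∇p × x` and `gradP n p = |x|² ∇p - n p x` are tangential, and on `|x| = R` they are
multiples of `∇_𝕊 Y × ν` and `∇_𝕊 Y`.

*Scalar kernels.* The Funk–Hecke formula (`funkHecke_dist`) reduces a kernel that depends on
`s = |x - y|` to one integral against the Legendre polynomial `P_n(1 - s²/2)`. The one needed for the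
fundamental solution is `∫₀² exp(iκs) P_n(1 - s²/2) ds = 2iκ j_n(κ) h_n(κ)` (`besselInt_eq`): both
sides satisfy the same relation between `n` and `n + 1`, which determines the next function from the
previous one up to a multiple of `κ^{-(2n+3)}`, and this is excluded at `κ = 0`. Hence the single
layer operator has the eigenvalues `χ_n` (`integral_G`), and the kernel `ν_x · ∇_x G` has the
eigenvalues `λ_n` (`integral_gNormal`).

*The operators `M` and `L`.* For tangential polynomial fields the kernel of `M` is a combination of
`ν · ∇G`, applied to the components, and of derivatives of `G` along rotations, which integration by
parts turns into single layer potentials (`integral_rot_G`, `integral_mKer_polyField`). The fields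
`curlP p` and `gradP n p` are found to be eigenfields with eigenvalues `m₁` and `m₂`; for `curlP p`
the computation gives `-m₂`, which equals `m₁` by the Wronskian of `j_n` and `h_n`
(`m1_eq_neg_m2`). The divergence theorem on the sphere identifies surface gradients and divergences
of polynomial fields, and `L` exchanges the two kinds of fields with coefficients `l₁`, `l₂`
(`isL_curlP`, `isL_gradP`). So `𝕀 + 𝕂` is a direct sum of `2 × 2` blocks, which the numbers `α`
diagonalize (`alpha_tau_eq`, `alpha_tau_eq'`).

*No other eigenvalues.* Let `Φ` be any eigenfunction. By Fubini's theorem the pairings of `M φ` and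
`L φ` with the fields `curlP p` and `gradP n p` are given by the same coefficients (`pair_M_curlP`,
`pair_L_curlP` and their companions), so that the two pairings of `Φ` that belong to a block solve
the eigenvalue equation of that block. If the eigenvalue were none of the `τ`, all pairings would
vanish (`eq_tau_of_block`), and so would `Φ`, because the vector spherical harmonics are complete in
the tangential fields (`eq_zero_of_forall_pair`). Completeness follows from the density of harmonic
polynomials on the sphere: modulo radial fields, a field `W e_l` with one harmonic component is a
combination of `curlP` and `gradP` fields, by the identity `curlP_curlP` and the decomposition of
`x_l W` into harmonic polynomials (`pair_single_eq_zero`).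

*Expansions.* The vector spherical harmonics of orthonormal `Y` form a complete orthogonal family,
so every pair of tangential fields has unique coefficients along it (`hasSum_vecHarm`,
`coeff_eq_of_hasSum`). As `β ≠ 0` makes `α₁ ≠ α₂` and `α₃ ≠ α₄`, these coefficients and those along
the `Ξ` determine each other (`existsUnique_coeffs`); independence and density are consequences of
existence and uniqueness of the expansion.
-/

noncomputable section

namespace MaxwellBall

open MeasureTheory Complex

/-! ### Homogeneous harmonic polynomials -/

theorem mem_SphHarm {n : ℕ} {p : MvPolynomial (Fin 3) ℂ} :
    p ∈ SphHarm n ↔ p.IsHomogeneous n ∧ polyLaplacian p = 0 := Iff.rfl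

theorem polyLaplacian_apply (p : MvPolynomial (Fin 3) ℂ) :
    polyLaplacian p = ∑ i, MvPolynomial.pderiv i (MvPolynomial.pderiv i p) := by
  simp [polyLaplacian]

theorem pderiv_comm (i j : Fin 3) (p : MvPolynomial (Fin 3) ℂ) :
    MvPolynomial.pderiv i (MvPolynomial.pderiv j p) =
      MvPolynomial.pderiv j (MvPolynomial.pderiv i p) := by
  have h : ⁅MvPolynomial.pderiv (R := ℂ) i, MvPolynomial.pderiv j⁆ =
      (0 : Derivation ℂ (MvPolynomial (Fin 3) ℂ) (MvPolynomial (Fin 3) ℂ)) := by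
    refine MvPolynomial.derivation_ext fun k => ?_
    rw [Derivation.commutator_apply]
    simp only [MvPolynomial.pderiv_X, Pi.single_apply]
    split_ifs <;> simp
  have := congrArg (fun D => D p) h
  simpa [Derivation.commutator_apply, sub_eq_zero] using this

/-- The polynomial `|x|²`. -/
def r2 : MvPolynomial (Fin 3) ℂ := ∑ i, MvPolynomial.X i ^ 2

theorem isHomogeneous_r2 : r2.IsHomogeneous 2 := by
  refine MvPolynomial.IsHomogeneous.sum _ _ _ fun i _ => ?_
  simpa using (MvPolynomial.isHomogeneous_X ℂ i).pow 2

theorem pderiv_r2 (i : Fin 3) : MvPolynomial.pderiv i r2 = 2 * MvPolynomial.X i := by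
  fin_cases i <;> simp [r2, Fin.sum_univ_three, MvPolynomial.pderiv_X]

theorem euler {n : ℕ} {p : MvPolynomial (Fin 3) ℂ} (h : p.IsHomogeneous n) :
    ∑ i, MvPolynomial.X i * MvPolynomial.pderiv i p = (n : MvPolynomial (Fin 3) ℂ) * p := by
  rw [h.sum_X_mul_pderiv, nsmul_eq_mul]

theorem polyLaplacian_r2_mul {n : ℕ} {p : MvPolynomial (Fin 3) ℂ} (h : p.IsHomogeneous n) :
    polyLaplacian (r2 * p) = (4 * n + 6 : MvPolynomial (Fin 3) ℂ) * p + r2 * polyLaplacian p := by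
  have he := euler h
  have h2 : ∀ i : Fin 3, MvPolynomial.pderiv i (2 : MvPolynomial (Fin 3) ℂ) = 0 := fun i => by
    rw [← map_ofNat (MvPolynomial.C (R := ℂ) (σ := Fin 3)), MvPolynomial.pderiv_C]
  simp only [polyLaplacian_apply, Fin.sum_univ_three, Derivation.leibniz, smul_eq_mul, pderiv_r2,
    map_add, MvPolynomial.pderiv_X_self, h2] at he ⊢
  linear_combination 4 * he

theorem polyLaplacian_X_mul (i : Fin 3) (p : MvPolynomial (Fin 3) ℂ) :
    polyLaplacian (MvPolynomial.X i * p) =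
      2 * MvPolynomial.pderiv i p + MvPolynomial.X i * polyLaplacian p := by
  simp only [polyLaplacian_apply, Fin.sum_univ_three, Derivation.leibniz, smul_eq_mul,
    map_add, MvPolynomial.pderiv_X]
  fin_cases i <;> simp <;> ring

theorem polyLaplacian_pderiv (i : Fin 3) (p : MvPolynomial (Fin 3) ℂ) :
    polyLaplacian (MvPolynomial.pderiv i p) = MvPolynomial.pderiv i (polyLaplacian p) := by
  simp only [polyLaplacian_apply, map_sum]
  refine Finset.sum_congr rfl fun j _ => ?_
  rw [pderiv_comm j i, pderiv_comm j i]

theorem pderiv_mem {n : ℕ} {p : MvPolynomial (Fin 3) ℂ} (hp : p ∈ SphHarm n) (i : Fin 3) :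
    MvPolynomial.pderiv i p ∈ SphHarm (n - 1) :=
  mem_SphHarm.2 ⟨(mem_SphHarm.1 hp).1.pderiv, by
    rw [polyLaplacian_pderiv, (mem_SphHarm.1 hp).2, map_zero]⟩

/-- The infinitesimal rotation `x_i ∂_j - x_j ∂_i`. -/
def rot (i j : Fin 3) (p : MvPolynomial (Fin 3) ℂ) : MvPolynomial (Fin 3) ℂ :=
  MvPolynomial.X i * MvPolynomial.pderiv j p - MvPolynomial.X j * MvPolynomial.pderiv i p

theorem rot_mem {n : ℕ} {p : MvPolynomial (Fin 3) ℂ} (hp : p ∈ SphHarm n) (i j : Fin 3) :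
    rot i j p ∈ SphHarm n := by
  have hhom : ∀ a b, (MvPolynomial.X a * MvPolynomial.pderiv b p).IsHomogeneous n := by
    intro a b
    rcases n with _ | n
    · have h0 := (mem_SphHarm.1 hp).1
      rw [← MvPolynomial.totalDegree_zero_iff_isHomogeneous,
        MvPolynomial.totalDegree_eq_zero_iff_eq_C] at h0
      rw [h0, MvPolynomial.pderiv_C, mul_zero]
      exact MvPolynomial.isHomogeneous_zero _ _ _
    · have h := (MvPolynomial.isHomogeneous_X ℂ a).mul ((mem_SphHarm.1 hp).1.pderiv (i := b))
      rwa [Nat.add_sub_cancel, add_comm] at h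
  refine mem_SphHarm.2 ⟨(hhom i j).sub (hhom j i), ?_⟩
  rw [rot, map_sub, polyLaplacian_X_mul, polyLaplacian_X_mul, polyLaplacian_pderiv,
    polyLaplacian_pderiv, (mem_SphHarm.1 hp).2, pderiv_comm i j]
  simp

/-- The harmonic part of degree `n + 1` of `x_l p`, for a harmonic polynomial `p` of degree `n`. -/
def raise (n : ℕ) (l : Fin 3) (p : MvPolynomial (Fin 3) ℂ) : MvPolynomial (Fin 3) ℂ :=
  MvPolynomial.X l * p - ((2 * n + 1 : ℂ)⁻¹) • (r2 * MvPolynomial.pderiv l p)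

theorem two_mul_add_one_ne_zero (n : ℕ) : (2 * n + 1 : ℂ) ≠ 0 := by
  exact_mod_cast (Nat.succ_ne_zero (2 * n))

theorem raise_mem {n : ℕ} {p : MvPolynomial (Fin 3) ℂ} (hp : p ∈ SphHarm n) (l : Fin 3) :
    raise n l p ∈ SphHarm (n + 1) := by
  have h1 := (MvPolynomial.isHomogeneous_X ℂ l).mul hp.1
  rw [add_comm] at h1
  have hlap := (mem_SphHarm.1 hp).2
  rcases n with _ | n
  · have h0 := (mem_SphHarm.1 hp).1
    rw [← MvPolynomial.totalDegree_zero_iff_isHomogeneous,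
      MvPolynomial.totalDegree_eq_zero_iff_eq_C] at h0
    have hd : MvPolynomial.pderiv l p = 0 := by rw [h0, MvPolynomial.pderiv_C]
    refine mem_SphHarm.2 ⟨?_, ?_⟩
    · rw [raise, hd]
      simpa using h1
    · rw [raise, hd]
      simp [polyLaplacian_X_mul, hd, hlap]
  · have h2 := isHomogeneous_r2.mul ((mem_SphHarm.1 hp).1.pderiv (i := l))
    have h3 : 2 + (n + 1 - 1) = n + 1 + 1 := by omega
    rw [h3] at h2
    refine mem_SphHarm.2 ⟨h1.sub ((MvPolynomial.homogeneousSubmodule (Fin 3) ℂ _).smul_mem _ h2), ?_⟩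
    rw [raise, map_sub, map_smul, polyLaplacian_X_mul, polyLaplacian_r2_mul ((pderiv_mem hp l).1),
      polyLaplacian_pderiv, hlap]
    have hc : ((4 * ((n + 1 - 1 : ℕ) : MvPolynomial (Fin 3) ℂ)) + 6) =
        (2 * (2 * ((n + 1 : ℕ) : ℂ) + 1)) • (1 : MvPolynomial (Fin 3) ℂ) := by
      rw [← MvPolynomial.C_mul', mul_one, Nat.add_sub_cancel]
      simp only [map_mul, map_add, map_ofNat, map_natCast, map_one]
      push_cast
      ring
    have hs := two_mul_add_one_ne_zero (n + 1)
    rw [hc]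
    simp only [map_zero, mul_zero, add_zero, smul_mul_assoc, one_mul, smul_smul]
    rw [show (2 * ((n + 1 : ℕ) : ℂ) + 1)⁻¹ * (2 * (2 * ((n + 1 : ℕ) : ℂ) + 1)) = 2 by field_simp,
      sub_eq_zero, ofNat_smul_eq_nsmul, nsmul_eq_mul]
    simp

/-! ### Evaluation of polynomials -/

@[simp] theorem evalP_add (p q : MvPolynomial (Fin 3) ℂ) (x : E3) :
    evalP (p + q) x = evalP p x + evalP q x := by simp [evalP]
@[simp] theorem evalP_sub (p q : MvPolynomial (Fin 3) ℂ) (x : E3) :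
    evalP (p - q) x = evalP p x - evalP q x := by simp [evalP]
@[simp] theorem evalP_mul (p q : MvPolynomial (Fin 3) ℂ) (x : E3) :
    evalP (p * q) x = evalP p x * evalP q x := by simp [evalP]
@[simp] theorem evalP_smul (c : ℂ) (p : MvPolynomial (Fin 3) ℂ) (x : E3) :
    evalP (c • p) x = c * evalP p x := by simp [evalP]
@[simp] theorem evalP_X (i : Fin 3) (x : E3) : evalP (MvPolynomial.X i) x = x i := by simp [evalP]
@[simp] theorem evalP_C (c : ℂ) (x : E3) : evalP (MvPolynomial.C c) x = c := by simp [evalP]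
@[simp] theorem evalP_zero (x : E3) : evalP 0 x = 0 := by simp [evalP]
@[simp] theorem evalP_one (x : E3) : evalP 1 x = 1 := by simp [evalP]
@[simp] theorem evalP_natCast (n : ℕ) (x : E3) : evalP n x = n := by simp [evalP]
@[simp] theorem evalP_ofNat (n : ℕ) [n.AtLeastTwo] (x : E3) : evalP ofNat(n) x = OfNat.ofNat n := by
  simp [evalP]
@[simp] theorem evalP_pow (p : MvPolynomial (Fin 3) ℂ) (n : ℕ) (x : E3) :
    evalP (p ^ n) x = evalP p x ^ n := by simp [evalP]
@[simp] theorem evalP_sum {ι : Type*} (s : Finset ι) (f : ι → MvPolynomial (Fin 3) ℂ) (x : E3) :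
    evalP (∑ i ∈ s, f i) x = ∑ i ∈ s, evalP (f i) x := by simp [evalP]

theorem sum_sq_eq (x : E3) : ∑ i, ((x i : ℝ) : ℂ) ^ 2 = ((‖x‖ ^ 2 : ℝ) : ℂ) := by
  rw [EuclideanSpace.norm_sq_eq]
  simp

@[simp] theorem evalP_r2 (x : E3) : evalP r2 x = (‖x‖ : ℂ) ^ 2 := by
  rw [r2, evalP_sum]
  simp only [evalP_pow, evalP_X]
  rw [sum_sq_eq]
  push_cast
  rfl

theorem evalP_real_smul {n : ℕ} {p : MvPolynomial (Fin 3) ℂ} (hp : p.IsHomogeneous n) (c : ℝ)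
    (x : E3) : evalP p (c • x) = (c : ℂ) ^ n * evalP p x := by
  rw [evalP, evalP, MvPolynomial.eval_eq', MvPolynomial.eval_eq', Finset.mul_sum]
  refine Finset.sum_congr rfl fun d hd => ?_
  have h1 : ∑ i, d i = n := by
    have := hp (MvPolynomial.mem_support_iff.1 hd)
    simpa [Finsupp.weight_apply, Finsupp.sum_fintype] using this
  simp only [PiLp.smul_apply, smul_eq_mul, Complex.ofReal_mul, mul_pow, Finset.prod_mul_distrib,
    Finset.prod_pow_eq_pow_sum, h1]
  ring

theorem hasFDerivAt_coord (i : Fin 3) (x : E3) :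
    HasFDerivAt (fun y : E3 => ((y i : ℝ) : ℂ))
      (Complex.ofRealCLM.comp (EuclideanSpace.proj i : E3 →L[ℝ] ℝ)) x :=
  (Complex.ofRealCLM.comp (EuclideanSpace.proj i : E3 →L[ℝ] ℝ)).hasFDerivAt

theorem differentiable_evalP (p : MvPolynomial (Fin 3) ℂ) : Differentiable ℝ (evalP p) :=
  (contDiff_evalP p).differentiable (by simp)

theorem continuous_evalP (p : MvPolynomial (Fin 3) ℂ) : Continuous (evalP p) :=
  (contDiff_evalP p).continuous

theorem pd_evalP (i : Fin 3) (p : MvPolynomial (Fin 3) ℂ) (x : E3) :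
    pd i (evalP p) x = evalP (MvPolynomial.pderiv i p) x := by
  induction p using MvPolynomial.induction_on with
  | C a =>
    have : evalP (MvPolynomial.C a) = fun _ => a := by funext x; simp
    rw [this]
    simp [pd]
  | add p q hp hq =>
    have : evalP (p + q) = evalP p + evalP q := by funext x; simp
    rw [this, pd, fderiv_add (differentiable_evalP p x) (differentiable_evalP q x)]
    simp only [pd] at hp hq
    simp [hp, hq]
  | mul_X p j hp =>
    have : evalP (p * MvPolynomial.X j) = fun x => evalP p x * ((x j : ℝ) : ℂ) := by
      funext x; simp
    rw [this, pd, fderiv_fun_mul (differentiable_evalP p x) (hasFDerivAt_coord j x).differentiableAt,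
      (hasFDerivAt_coord j x).fderiv]
    simp only [pd] at hp
    simp [hp, MvPolynomial.pderiv_X, Pi.single_apply, Derivation.leibniz]
    split_ifs <;> simp_all

theorem euler_evalP {n : ℕ} {p : MvPolynomial (Fin 3) ℂ} (h : p.IsHomogeneous n) (x : E3) :
    ∑ i, (x i : ℂ) * evalP (MvPolynomial.pderiv i p) x = n * evalP p x := by
  have := congrArg (fun q => evalP q x) (euler h)
  simpa using this

/-! ### Decomposition of polynomials into spherical harmonics -/

/-- The span of the polynomials `|x|^{2j} h` of degree `d`, with `h` homogeneous and harmonic. -/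
def radialHarm (d : ℕ) : Submodule ℂ (MvPolynomial (Fin 3) ℂ) :=
  Submodule.span ℂ {q | ∃ (j m : ℕ) (h : MvPolynomial (Fin 3) ℂ), h ∈ SphHarm m ∧ 2 * j + m = d ∧
    q = r2 ^ j * h}

theorem isHomogeneous_r2_pow_mul {m : ℕ} {h : MvPolynomial (Fin 3) ℂ} (hh : h ∈ SphHarm m) (j : ℕ) :
    (r2 ^ j * h).IsHomogeneous (2 * j + m) :=
  (isHomogeneous_r2.pow j).mul hh.1

theorem polyLaplacian_r2_pow_mul {m : ℕ} {h : MvPolynomial (Fin 3) ℂ} (hh : h ∈ SphHarm m) (j : ℕ) :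
    polyLaplacian (r2 ^ (j + 1) * h) =
      ((2 * (j + 1) * (2 * j + 2 * m + 3) : ℕ) : MvPolynomial (Fin 3) ℂ) * (r2 ^ j * h) := by
  induction j with
  | zero =>
    rw [zero_add, pow_one, polyLaplacian_r2_mul hh.1, (mem_SphHarm.1 hh).2]
    push_cast
    ring
  | succ j ih =>
    rw [pow_succ', mul_assoc, polyLaplacian_r2_mul (isHomogeneous_r2_pow_mul hh (j + 1)), ih]
    push_cast
    ring

theorem exists_polyLaplacian_eq {d : ℕ} {q : MvPolynomial (Fin 3) ℂ} (hq : q ∈ radialHarm d) :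
    ∃ u ∈ radialHarm (d + 2), polyLaplacian u = q := by
  have key : radialHarm d ≤ (radialHarm (d + 2)).map polyLaplacian := by
    refine Submodule.span_le.2 ?_
    rintro _ ⟨j, m, h, hh, hd, rfl⟩
    have h0 : ((2 * (j + 1) * (2 * j + 2 * m + 3) : ℕ) : ℂ) ≠ 0 := by
      exact_mod_cast (by positivity : 2 * (j + 1) * (2 * j + 2 * m + 3) ≠ 0)
    refine ⟨(((2 * (j + 1) * (2 * j + 2 * m + 3) : ℕ) : ℂ)⁻¹) • (r2 ^ (j + 1) * h),
      Submodule.smul_mem _ _ (Submodule.subset_span ⟨j + 1, m, h, hh, by omega, rfl⟩), ?_⟩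
    rw [map_smul, polyLaplacian_r2_pow_mul hh, ← map_natCast (MvPolynomial.C (R := ℂ) (σ := Fin 3)),
      MvPolynomial.C_mul', smul_smul, inv_mul_cancel₀ h0, one_smul]
  exact key hq

theorem radialHarm_le (d : ℕ) : radialHarm d ≤ MvPolynomial.homogeneousSubmodule (Fin 3) ℂ d := by
  refine Submodule.span_le.2 ?_
  rintro _ ⟨j, m, h, hh, hd, rfl⟩
  exact hd ▸ isHomogeneous_r2_pow_mul hh j

theorem SphHarm_le_radialHarm (d : ℕ) : SphHarm d ≤ radialHarm d := fun p hp =>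
  Submodule.subset_span ⟨0, d, p, hp, by omega, by simp⟩

theorem mem_radialHarm (d : ℕ) : ∀ {p : MvPolynomial (Fin 3) ℂ}, p.IsHomogeneous d →
    p ∈ radialHarm d := by
  induction d using Nat.strong_induction_on with
  | _ d ih =>
    intro p hp
    rcases Nat.lt_or_ge d 2 with h | h
    · refine SphHarm_le_radialHarm d (mem_SphHarm.2 ⟨hp, ?_⟩)
      rw [polyLaplacian_apply]
      refine Finset.sum_eq_zero fun i _ => ?_
      have h1 := hp.pderiv (i := i)
      rw [show d - 1 = 0 by omega, ← MvPolynomial.totalDegree_zero_iff_isHomogeneous,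
        MvPolynomial.totalDegree_eq_zero_iff_eq_C] at h1
      rw [h1, MvPolynomial.pderiv_C]
    · obtain ⟨e, rfl⟩ : ∃ e, d = e + 2 := ⟨d - 2, by omega⟩
      have h1 : (polyLaplacian p).IsHomogeneous e := by
        rw [polyLaplacian_apply]
        refine MvPolynomial.IsHomogeneous.sum _ _ _ fun i _ => ?_
        exact (hp.pderiv (i := i)).pderiv (i := i)
      obtain ⟨u, hu, hpu⟩ := exists_polyLaplacian_eq (ih e (by omega) h1)
      have h2 : p - u ∈ SphHarm (e + 2) :=
        mem_SphHarm.2 ⟨hp.sub (radialHarm_le _ hu), by rw [map_sub, hpu, sub_self]⟩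
      simpa using (radialHarm (e + 2)).add_mem (SphHarm_le_radialHarm _ h2) hu

/-- On the unit sphere every polynomial is a sum of spherical harmonics. -/
theorem exists_harmonic_eqOn (p : MvPolynomial (Fin 3) ℂ) :
    ∃ q ∈ (⨆ n, SphHarm n), ∀ x : E3, ‖x‖ = 1 → evalP p x = evalP q x := by
  have hadd : ∀ p₁ p₂ : MvPolynomial (Fin 3) ℂ,
      (∃ q ∈ (⨆ n, SphHarm n), ∀ x : E3, ‖x‖ = 1 → evalP p₁ x = evalP q x) →
      (∃ q ∈ (⨆ n, SphHarm n), ∀ x : E3, ‖x‖ = 1 → evalP p₂ x = evalP q x) →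
      ∃ q ∈ (⨆ n, SphHarm n), ∀ x : E3, ‖x‖ = 1 → evalP (p₁ + p₂) x = evalP q x := by
    rintro p₁ p₂ ⟨q₁, h₁, e₁⟩ ⟨q₂, h₂, e₂⟩
    exact ⟨q₁ + q₂, Submodule.add_mem _ h₁ h₂, fun x hx => by simp [e₁ x hx, e₂ x hx]⟩
  have hrad : ∀ d, ∀ p ∈ radialHarm d,
      ∃ q ∈ (⨆ n, SphHarm n), ∀ x : E3, ‖x‖ = 1 → evalP p x = evalP q x := by
    intro d p hp
    refine Submodule.span_induction ?_ ?_ (fun a b _ _ => hadd a b) ?_ hp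
    · rintro _ ⟨j, m, h, hh, hd, rfl⟩
      exact ⟨h, Submodule.mem_iSup_of_mem m hh, fun x hx => by simp [hx]⟩
    · exact ⟨0, Submodule.zero_mem _, fun x _ => rfl⟩
    · rintro c a _ ⟨q, hq, e⟩
      exact ⟨c • q, Submodule.smul_mem _ _ hq, fun x hx => by simp [e x hx]⟩
  rw [← MvPolynomial.sum_homogeneousComponent p]
  refine Finset.sum_induction _ (fun p => ∃ q ∈ (⨆ n, SphHarm n), ∀ x : E3, ‖x‖ = 1 →
    evalP p x = evalP q x) hadd ⟨0, Submodule.zero_mem _, fun x _ => rfl⟩ fun d _ => ?_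
  exact hrad d _ (mem_radialHarm d (MvPolynomial.homogeneousComponent_isHomogeneous d p))

/-- A homogeneous polynomial that vanishes on the unit sphere of `ℝ³` is zero. -/
theorem eq_zero_of_evalP_eq_zero {n : ℕ} {p : MvPolynomial (Fin 3) ℂ} (hp : p.IsHomogeneous n)
    (h : ∀ x : E3, ‖x‖ = 1 → evalP p x = 0) : p = 0 := by
  refine MvPolynomial.funext_set (fun _ => Set.range ((↑) : ℝ → ℂ) \ {0}) (fun _ => ?_) ?_
  · exact (Set.infinite_range_of_injective Complex.ofReal_injective).sdiff (Set.finite_singleton 0)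
  · intro z hz
    have hz' : ∀ i, ∃ t : ℝ, (t : ℂ) = z i ∧ t ≠ 0 := fun i => by
      obtain ⟨⟨t, ht⟩, h0⟩ := hz i (Set.mem_univ i)
      exact ⟨t, ht, fun h => h0 (by simp [← ht, h])⟩
    choose t ht ht0 using hz'
    set x : E3 := WithLp.toLp 2 t
    have hx : x ≠ 0 := fun h0 => ht0 0 (by simpa [x] using congrArg (fun y : E3 => y 0) h0)
    have h1 : evalP p x = 0 := by
      have h2 : x = ‖x‖ • (‖x‖⁻¹ • x) := by
        rw [smul_smul, mul_inv_cancel₀ (norm_ne_zero_iff.2 hx), one_smul]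
      rw [h2, evalP_real_smul hp, h _ (by rw [norm_smul, norm_inv, norm_norm,
        inv_mul_cancel₀ (norm_ne_zero_iff.2 hx)]), mul_zero]
    have h3 : z = fun i => ((x i : ℝ) : ℂ) := by
      funext i
      simp [x, ht]
    rw [map_zero, h3]
    exact h1

/-! ### The surface measure -/

theorem ae_norm_eq {R : ℝ} (hR : 0 ≤ R) : ∀ᵐ x ∂surfMeasure R, ‖x‖ = R := by
  have hm : Measurable fun s : Metric.sphere (0 : E3) 1 => R • (s : E3) :=
    measurable_subtype_coe.const_smul R
  refine Measure.ae_smul_measure ?_ _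
  rw [ae_map_iff hm.aemeasurable (measurableSet_eq_fun measurable_norm measurable_const)]
  refine Filter.Eventually.of_forall fun s => ?_
  have hs : ‖(s : E3)‖ = 1 := by simp
  rw [norm_smul, hs, mul_one, Real.norm_of_nonneg hR]

theorem surfMeasure_eq_map (R : ℝ) :
    surfMeasure R = ENNReal.ofReal (R ^ 2) • (surfMeasure 1).map fun x : E3 => R • x := by
  have h1 : surfMeasure 1 = (volume : Measure E3).toSphere.map Subtype.val := by
    rw [surfMeasure]
    simp
  rw [h1, Measure.map_map (measurable_const_smul R) measurable_subtype_coe]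
  rfl

theorem measurableEmbedding_smul {R : ℝ} (hR : 0 < R) : MeasurableEmbedding fun x : E3 => R • x :=
  (Homeomorph.smulOfNeZero R hR.ne').measurableEmbedding

theorem integral_surf {F : Type*} [NormedAddCommGroup F] [NormedSpace ℝ F] {R : ℝ} (hR : 0 < R)
    (f : E3 → F) : ∫ x, f x ∂surfMeasure R = R ^ 2 • ∫ x, f (R • x) ∂surfMeasure 1 := by
  rw [surfMeasure_eq_map, integral_smul_measure, (measurableEmbedding_smul hR).integral_map]
  simp [ENNReal.toReal_ofReal (sq_nonneg R)]

theorem integrable_surf {F : Type*} [NormedAddCommGroup F] {R : ℝ} (hR : 0 < R)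
    (f : E3 → F) : Integrable f (surfMeasure R) ↔
      Integrable (fun x => f (R • x)) (surfMeasure 1) := by
  rw [surfMeasure_eq_map, integrable_smul_measure (by simpa using hR.ne') (by simp),
    (measurableEmbedding_smul hR).integrable_map_iff]
  rfl

theorem integrable_of_continuousOn {F : Type*} [NormedAddCommGroup F] {R : ℝ} (hR : 0 ≤ R)
    {f : E3 → F} (hm : AEStronglyMeasurable f (surfMeasure R))
    (hf : ContinuousOn f (Metric.sphere 0 R)) : Integrable f (surfMeasure R) := by
  obtain ⟨C, hC⟩ := (isCompact_sphere (0 : E3) R).exists_bound_of_continuousOn hf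
  refine Integrable.of_bound hm C ?_
  filter_upwards [ae_norm_eq hR] with x hx
  exact hC x (by simp [hx])

theorem integrable_of_continuous {F : Type*} [NormedAddCommGroup F] {R : ℝ}
    (hR : 0 ≤ R) {f : E3 → F} (hf : Continuous f) : Integrable f (surfMeasure R) :=
  integrable_of_continuousOn hR (hf.aestronglyMeasurable) hf.continuousOn

theorem integral_one_surfMeasure : ∫ _x, (1 : ℂ) ∂surfMeasure 1 = 4 * Real.pi := by
  have h1 : (surfMeasure 1).real Set.univ = 4 * Real.pi := by
    have h2 : surfMeasure 1 = (volume : Measure E3).toSphere.map Subtype.val := by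
      rw [surfMeasure]
      simp
    rw [h2, Measure.real, Measure.map_apply measurable_subtype_coe MeasurableSet.univ,
      Set.preimage_univ, Measure.toSphere_apply_univ, EuclideanSpace.volume_ball_fin_three]
    simp
    rw [ENNReal.toReal_ofReal (by positivity)]
    ring
  rw [integral_const, h1]
  simp

theorem map_surfMeasure_one (U : E3 ≃ₗᵢ[ℝ] E3) : (surfMeasure 1).map U = surfMeasure 1 := by
  have h1 : surfMeasure 1 = (volume : Measure E3).toSphere.map Subtype.val := by
    rw [surfMeasure]
    simp
  have hmU : Measurable U := U.continuous.measurable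
  refine Measure.ext fun s hs => ?_
  rw [Measure.map_apply hmU hs, h1, Measure.map_apply measurable_subtype_coe (hmU hs),
    Measure.map_apply measurable_subtype_coe hs,
    Measure.toSphere_apply' _ (measurable_subtype_coe (hmU hs)),
    Measure.toSphere_apply' _ (measurable_subtype_coe hs)]
  congr 1
  conv_rhs =>
    rw [← MeasurePreserving.measure_preimage_equiv (f := U.toMeasurableEquiv) U.measurePreserving]
  congr 1
  ext x
  rw [Set.mem_preimage, show (U.toMeasurableEquiv x : E3) = U x from rfl]
  simp only [Set.mem_smul, Set.mem_image, Set.mem_preimage, Subtype.exists, exists_and_right,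
    exists_eq_right, mem_sphere_iff_norm, sub_zero]
  constructor
  · rintro ⟨r, hr, y, ⟨hy, hys⟩, rfl⟩
    exact ⟨r, hr, U y, ⟨by simpa using hy, hys⟩, (map_smul U r y).symm⟩
  · rintro ⟨r, hr, y, ⟨hy, hys⟩, hxy⟩
    refine ⟨r, hr, U.symm y, ⟨by simpa using hy, by simpa using hys⟩, ?_⟩
    apply U.injective
    rw [map_smul, U.apply_symm_apply]
    exact hxy

theorem integral_comp_isometry {F : Type*} [NormedAddCommGroup F] [NormedSpace ℝ F] {R : ℝ}
    (hR : 0 < R) (U : E3 ≃ₗᵢ[ℝ] E3) (f : E3 → F) :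
    ∫ x, f (U x) ∂surfMeasure R = ∫ x, f x ∂surfMeasure R := by
  rw [integral_surf hR, integral_surf hR]
  congr 1
  have hU : MeasurableEmbedding U := U.toHomeomorph.measurableEmbedding
  conv_rhs => rw [← map_surfMeasure_one U, hU.integral_map]
  refine integral_congr_ae (Filter.Eventually.of_forall fun x => ?_)
  simp

/-! ### Integration by parts along rotations -/

/-- The rotation by the angle `t` in the plane of the coordinates `i` and `j`. -/
def rotMap (i j : Fin 3) (t : ℝ) (x : E3) : E3 :=
  x + (Real.cos t - 1) • (x i • EuclideanSpace.single i (1 : ℝ) + x j • EuclideanSpace.single j 1)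
    + Real.sin t • (x i • EuclideanSpace.single j (1 : ℝ) - x j • EuclideanSpace.single i 1)

theorem norm_rotMap {i j : Fin 3} (hij : i ≠ j) (t : ℝ) (x : E3) : ‖rotMap i j t x‖ = ‖x‖ := by
  rw [EuclideanSpace.norm_eq, EuclideanSpace.norm_eq]
  congr 1
  simp only [Fin.sum_univ_three, Real.norm_eq_abs, sq_abs]
  have := Real.sin_sq_add_cos_sq t
  fin_cases i <;> fin_cases j <;> simp [rotMap] at hij ⊢ <;> grind

/-- `rotMap` as a linear isometry. -/
def rotEquiv {i j : Fin 3} (hij : i ≠ j) (t : ℝ) : E3 ≃ₗᵢ[ℝ] E3 :=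
  LinearIsometry.toLinearIsometryEquiv (R₁ := ℝ)
    { toFun := rotMap i j t
      map_add' := fun x y => by
        simp only [rotMap, PiLp.add_apply]
        module
      map_smul' := fun c x => by
        simp only [rotMap, PiLp.smul_apply, smul_eq_mul, RingHom.id_apply]
        module
      norm_map' := norm_rotMap hij t } rfl

/-- The velocity of `rotMap`. -/
def rotVel (i j : Fin 3) (t : ℝ) (x : E3) : E3 :=
  (-Real.sin t) • (x i • EuclideanSpace.single i (1 : ℝ) + x j • EuclideanSpace.single j 1)
    + Real.cos t • (x i • EuclideanSpace.single j (1 : ℝ) - x j • EuclideanSpace.single i 1)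

theorem hasDerivAt_rotMap (i j : Fin 3) (t : ℝ) (x : E3) :
    HasDerivAt (fun s => rotMap i j s x) (rotVel i j t x) t := by
  unfold rotMap rotVel
  exact ((((Real.hasDerivAt_cos t).sub_const 1).smul_const _).const_add x).add
    ((Real.hasDerivAt_sin t).smul_const _)

theorem continuous_rotMap (i j : Fin 3) : Continuous fun q : ℝ × E3 => rotMap i j q.1 q.2 := by
  unfold rotMap
  fun_prop

theorem continuous_rotVel (i j : Fin 3) : Continuous fun q : ℝ × E3 => rotVel i j q.1 q.2 := by
  unfold rotVel
  fun_prop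

/-- The infinitesimal form of the rotation invariance of the surface measure. -/
theorem integral_rot_eq_zero {R : ℝ} (hR : 0 < R) (i j : Fin 3) {h : E3 → ℂ} (hh : ContDiff ℝ 1 h) :
    ∫ x, ((x i : ℂ) * pd j h x - (x j : ℂ) * pd i h x) ∂surfMeasure R = 0 := by
  rcases eq_or_ne i j with rfl | hij
  · simp
  have hF' : Continuous fun q : ℝ × E3 => fderiv ℝ h (rotMap i j q.1 q.2) (rotVel i j q.1 q.2) :=
    ((hh.continuous_fderiv one_ne_zero).comp (continuous_rotMap i j)).clm_apply
      (continuous_rotVel i j)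
  obtain ⟨C, hC⟩ := ((isCompact_Icc (a := (-1 : ℝ)) (b := 1)).prod
    (isCompact_sphere (0 : E3) R)).exists_bound_of_continuousOn hF'.continuousOn
  have hslice : ∀ t, Continuous fun x => h (rotMap i j t x) := fun t =>
    hh.continuous.comp ((continuous_rotMap i j).comp (by fun_prop : Continuous fun x => (t, x)))
  have hslice' : Continuous fun x => fderiv ℝ h (rotMap i j 0 x) (rotVel i j 0 x) :=
    hF'.comp (by fun_prop : Continuous fun x : E3 => ((0 : ℝ), x))
  have key := (hasDerivAt_integral_of_dominated_loc_of_deriv_le (μ := surfMeasure R)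
    (F := fun t x => h (rotMap i j t x))
    (F' := fun t x => fderiv ℝ h (rotMap i j t x) (rotVel i j t x)) (x₀ := 0)
    (s := Set.Icc (-1) 1) (bound := fun _ => C) (Icc_mem_nhds (by norm_num) (by norm_num))
    (Filter.Eventually.of_forall fun t => (hslice t).aestronglyMeasurable)
    (integrable_of_continuous hR.le (hslice 0)) hslice'.aestronglyMeasurable
    (by
      filter_upwards [ae_norm_eq hR.le] with x hx t ht
      exact hC (t, x) ⟨ht, by simp [hx]⟩)
    (integrable_const C)
    (Filter.Eventually.of_forall fun x t _ =>
      (hh.differentiable one_ne_zero _).hasFDerivAt.comp_hasDerivAt t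
        (hasDerivAt_rotMap i j t x))).2
  have hconst : (fun t => ∫ x, h (rotMap i j t x) ∂surfMeasure R) =
      fun _ => ∫ x, h x ∂surfMeasure R := by
    funext t
    exact integral_comp_isometry hR (rotEquiv hij t) h
  rw [hconst] at key
  have h0 := key.unique (hasDerivAt_const _ _)
  rw [← h0]
  refine integral_congr_ae (Filter.Eventually.of_forall fun x => ?_)
  simp [rotMap, rotVel, pd]

theorem pd_eq_sum (h : E3 → ℂ) (x v : E3) : fderiv ℝ h x v = ∑ i, (v i : ℂ) * pd i h x := by
  have h2 : v = ∑ i, v i • EuclideanSpace.single i (1 : ℝ) := by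
    ext j
    simp [Pi.single_apply]
  conv_lhs => rw [h2]
  simp [map_sum, pd]

theorem surfGrad_apply {R : ℝ} (hR : 0 < R) {h : E3 → ℂ} {x : E3} (hx : ‖x‖ = R)
    (hd : DifferentiableAt ℝ h x) (i : Fin 3) :
    surfGrad R h x i = pd i h x - (x i : ℂ) / R ^ 2 * ∑ j, (x j : ℂ) * pd j h x := by
  have hx0 : x ≠ 0 := by
    rintro rfl
    simp at hx
    exact hR.ne hx
  have hn : DifferentiableAt ℝ (fun y : E3 => ‖y‖) x := (differentiableAt_id).norm ℝ hx0
  have hline : HasDerivAt (fun t : ℝ => ‖x + t • EuclideanSpace.single i (1 : ℝ)‖) (x i / R) 0 := by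
    have h1 : HasDerivAt (fun t : ℝ => x + t • EuclideanSpace.single i (1 : ℝ))
        (EuclideanSpace.single i (1 : ℝ)) 0 := by
      simpa using ((hasDerivAt_id (0 : ℝ)).smul_const (EuclideanSpace.single i (1 : ℝ))).const_add x
    have h2 := h1.norm_sq.sqrt (by simpa using hx0)
    simp only [Real.sqrt_sq (norm_nonneg _)] at h2
    convert h2 using 1
    simp [hx, EuclideanSpace.inner_single_right]
    field_simp
  have hg : HasDerivAt (fun t : ℝ => (R / ‖x + t • EuclideanSpace.single i (1 : ℝ)‖) •
      (x + t • EuclideanSpace.single i (1 : ℝ)))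
      (EuclideanSpace.single i (1 : ℝ) - (x i / R ^ 2) • x) 0 := by
    have h1 : HasDerivAt (fun t : ℝ => x + t • EuclideanSpace.single i (1 : ℝ))
        (EuclideanSpace.single i (1 : ℝ)) 0 := by
      simpa using ((hasDerivAt_id (0 : ℝ)).smul_const (EuclideanSpace.single i (1 : ℝ))).const_add x
    have h2 := ((hasDerivAt_const (0 : ℝ) R).div hline (by simpa using hx0)).smul h1
    refine h2.congr_deriv ?_
    simp [hx]
    rw [div_self hR.ne', one_smul, sub_eq_add_neg, ← neg_smul]
    congr 2
    field_simp
  have hinner : DifferentiableAt ℝ (fun y : E3 => (R / ‖y‖) • y) x :=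
    ((hn.inv (norm_ne_zero_iff.2 hx0)).const_mul R).smul differentiableAt_id
  have hbase : (R / ‖x‖) • x = x := by rw [hx, div_self hR.ne', one_smul]
  have hcomp : DifferentiableAt ℝ (fun y : E3 => h ((R / ‖y‖) • y)) x := by
    refine DifferentiableAt.comp x (g := h) ?_ hinner
    rw [hbase]
    exact hd
  have e1 : HasDerivAt (fun t : ℝ => h ((R / ‖x + t • EuclideanSpace.single i (1 : ℝ)‖) •
      (x + t • EuclideanSpace.single i (1 : ℝ)))) (surfGrad R h x i) 0 := by
    have h1 : HasDerivAt (fun t : ℝ => x + t • EuclideanSpace.single i (1 : ℝ))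
        (EuclideanSpace.single i (1 : ℝ)) 0 := by
      simpa using ((hasDerivAt_id (0 : ℝ)).smul_const (EuclideanSpace.single i (1 : ℝ))).const_add x
    have h2 : HasFDerivAt (fun y : E3 => h ((R / ‖y‖) • y))
        (fderiv ℝ (fun y : E3 => h ((R / ‖y‖) • y)) x)
        (x + (0 : ℝ) • EuclideanSpace.single i (1 : ℝ)) := by
      simpa using hcomp.hasFDerivAt
    exact HasFDerivAt.comp_hasDerivAt (f := fun t : ℝ => x + t • EuclideanSpace.single i (1 : ℝ)) 0
      h2 h1
  have e2 : HasDerivAt (fun t : ℝ => h ((R / ‖x + t • EuclideanSpace.single i (1 : ℝ)‖) •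
      (x + t • EuclideanSpace.single i (1 : ℝ))))
      (fderiv ℝ h x (EuclideanSpace.single i (1 : ℝ) - (x i / R ^ 2) • x)) 0 := by
    have h2 : HasFDerivAt h (fderiv ℝ h x) ((R / ‖x + (0 : ℝ) • EuclideanSpace.single i (1 : ℝ)‖) •
      (x + (0 : ℝ) • EuclideanSpace.single i (1 : ℝ))) := by
      simpa [hbase] using hd.hasFDerivAt
    exact h2.comp_hasDerivAt 0 hg
  rw [e1.unique e2, map_sub, map_smul, pd_eq_sum h x x, pd]
  simp

/-- On a sphere, `∇_S = ∑ x_j (x_j ∂_i - x_i ∂_j) / R²`: the divergence theorem for the surface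
gradient, with the mean curvature term. -/
theorem integral_surfGrad {R : ℝ} (hR : 0 < R) {h : E3 → ℂ} (hh : ContDiff ℝ 1 h) (i : Fin 3) :
    ∫ x, surfGrad R h x i ∂surfMeasure R = 2 / R ^ 2 * ∫ x, (x i : ℂ) * h x ∂surfMeasure R := by
  have hcx : ∀ j : Fin 3, ContDiff ℝ 1 fun x : E3 => ((x j : ℝ) : ℂ) := fun j =>
    (Complex.ofRealCLM.comp (EuclideanSpace.proj j : E3 →L[ℝ] ℝ)).contDiff
  have hrot : ∀ j, ∫ x, ((x j : ℂ) * pd i (fun y => (y j : ℂ) * h y) x -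
      (x i : ℂ) * pd j (fun y => (y j : ℂ) * h y) x) ∂surfMeasure R = 0 := fun j =>
    integral_rot_eq_zero hR j i ((hcx j).mul hh)
  have hprod : ∀ (j l : Fin 3) (x : E3), pd l (fun y => (y j : ℂ) * h y) x =
      (x j : ℂ) * pd l h x + (if j = l then 1 else 0) * h x := by
    intro j l x
    rw [pd, fderiv_fun_mul (hasFDerivAt_coord j x).differentiableAt
      (hh.differentiable one_ne_zero x), (hasFDerivAt_coord j x).fderiv]
    simp only [pd, _root_.add_apply, _root_.smul_apply,
      ContinuousLinearMap.comp_apply, smul_eq_mul, PiLp.proj_apply, ofRealCLM_apply,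
      PiLp.single_apply]
    rw [mul_comm (h x)]
    split_ifs <;> simp
  have hpdc : ∀ l, Continuous fun x => pd l h x := fun l =>
    (hh.continuous_fderiv one_ne_zero).clm_apply continuous_const
  have hint : ∀ j, Integrable (fun x : E3 => (x j : ℂ) * pd i (fun y => (y j : ℂ) * h y) x -
      (x i : ℂ) * pd j (fun y => (y j : ℂ) * h y) x) (surfMeasure R) := by
    intro j
    refine integrable_of_continuous hR.le ?_
    simp only [hprod]
    have := (hcx j).continuous
    have := (hcx i).continuous
    have := hh.continuous
    have := hpdc i
    have := hpdc j
    fun_prop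
  have hsum : ∫ x, ∑ j, ((x j : ℂ) * pd i (fun y => (y j : ℂ) * h y) x -
      (x i : ℂ) * pd j (fun y => (y j : ℂ) * h y) x) ∂surfMeasure R = 0 := by
    rw [integral_finsetSum _ fun j _ => hint j]
    exact Finset.sum_eq_zero fun j _ => hrot j
  have hRc : (R : ℂ) ≠ 0 := by exact_mod_cast hR.ne'
  have hpt : (fun x => ∑ j, ((x j : ℂ) * pd i (fun y => (y j : ℂ) * h y) x -
      (x i : ℂ) * pd j (fun y => (y j : ℂ) * h y) x)) =ᵐ[surfMeasure R]
      fun x => R ^ 2 * surfGrad R h x i - 2 * ((x i : ℂ) * h x) := by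
    filter_upwards [ae_norm_eq hR.le] with x hx
    rw [surfGrad_apply hR hx (hh.differentiable one_ne_zero x)]
    have hs := sum_sq_eq x
    rw [hx] at hs
    simp only [hprod, Fin.sum_univ_three] at hs ⊢
    push_cast at hs
    field_simp
    fin_cases i <;> simp <;> linear_combination (pd _ h x) * hs
  rw [integral_congr_ae hpt] at hsum
  have hI2 : Integrable (fun x : E3 => (x i : ℂ) * h x) (surfMeasure R) :=
    integrable_of_continuous hR.le ((hcx i).continuous.mul hh.continuous)
  have hI1 : Integrable (fun x => (R : ℂ) ^ 2 * surfGrad R h x i) (surfMeasure R) := by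
    have h1 : Integrable (fun x => ∑ j, ((x j : ℂ) * pd i (fun y => (y j : ℂ) * h y) x -
      (x i : ℂ) * pd j (fun y => (y j : ℂ) * h y) x)) (surfMeasure R) :=
      integrable_finsetSum _ fun j _ => hint j
    refine ((h1.congr hpt).add (hI2.const_mul 2)).congr (Filter.Eventually.of_forall fun x => ?_)
    simp
  rw [integral_sub hI1 (hI2.const_mul 2), integral_const_mul, integral_const_mul,
    sub_eq_zero] at hsum
  field_simp
  linear_combination hsum

/-! ### Legendre polynomials -/

/-- The Legendre polynomials, generated by
`(n + 1) P_{n+1} = (n + 1) t P_n + (t² - 1) P_n'`. -/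
def legP : ℕ → Polynomial ℂ
  | 0 => 1
  | n + 1 => Polynomial.X * legP n + Polynomial.C ((n + 1 : ℂ)⁻¹) *
      ((Polynomial.X ^ 2 - 1) * Polynomial.derivative (legP n))

theorem C_inv_mul (n : ℕ) :
    ((n : Polynomial ℂ) + 1) * Polynomial.C ((n + 1 : ℂ)⁻¹) = 1 := by
  have h : ((n : Polynomial ℂ) + 1) = Polynomial.C (n + 1 : ℂ) := by simp
  rw [h, ← Polynomial.C_mul, mul_inv_cancel₀ (by exact_mod_cast Nat.succ_ne_zero n),
    Polynomial.C_1]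

theorem legP_succ (n : ℕ) : ((n : Polynomial ℂ) + 1) * legP (n + 1) =
    (n + 1 : Polynomial ℂ) * Polynomial.X * legP n + (Polynomial.X ^ 2 - 1) * Polynomial.derivative (legP n) := by
  rw [legP]
  linear_combination ((Polynomial.X ^ 2 - 1) * Polynomial.derivative (legP n)) * C_inv_mul n

theorem derivative_legP_succ_of_ode {n : ℕ}
    (h : Polynomial.derivative ((Polynomial.X ^ 2 - 1) * Polynomial.derivative (legP n)) =
      (n * (n + 1) : Polynomial ℂ) * legP n) :
    Polynomial.derivative (legP (n + 1)) =
      Polynomial.X * Polynomial.derivative (legP n) + (n + 1 : Polynomial ℂ) * legP n := by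
  rw [legP, Polynomial.derivative_add, Polynomial.derivative_C_mul, h]
  simp only [Polynomial.derivative_mul, Polynomial.derivative_X]
  linear_combination ((n : Polynomial ℂ) * legP n) * C_inv_mul n

/-- The Legendre differential equation. -/
theorem legP_ode (n : ℕ) :
    Polynomial.derivative ((Polynomial.X ^ 2 - 1) * Polynomial.derivative (legP n)) =
      (n * (n + 1) : Polynomial ℂ) * legP n := by
  induction n with
  | zero => simp [legP]
  | succ n ih =>
    have h1 := derivative_legP_succ_of_ode ih
    have h2 := legP_succ n
    have h3 : (Polynomial.X ^ 2 - 1) * Polynomial.derivative (legP (n + 1)) =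
        (n + 1 : Polynomial ℂ) * (Polynomial.X * legP (n + 1) - legP n) := by
      linear_combination (Polynomial.X ^ 2 - 1) * h1 - Polynomial.X * h2
    have h4 : ((n : Polynomial ℂ) + 1) = Polynomial.C (n + 1 : ℂ) := by simp
    rw [h3, h4, Polynomial.derivative_C_mul, ← h4]
    simp only [Polynomial.derivative_sub, Polynomial.derivative_mul, Polynomial.derivative_X]
    push_cast
    linear_combination ((n + 1 : Polynomial ℂ) * Polynomial.X) * h1 - (n + 1 : Polynomial ℂ) * h2

theorem derivative_legP_succ (n : ℕ) :
    Polynomial.derivative (legP (n + 1)) =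
      Polynomial.X * Polynomial.derivative (legP n) + (n + 1 : Polynomial ℂ) * legP n :=
  derivative_legP_succ_of_ode (legP_ode n)

theorem X_mul_derivative_legP_sub (n : ℕ) :
    Polynomial.X * Polynomial.derivative (legP (n + 1)) - Polynomial.derivative (legP n) =
      (n + 1 : Polynomial ℂ) * legP (n + 1) := by
  linear_combination Polynomial.X * derivative_legP_succ n - legP_succ n

theorem one_sub_X_mul_derivative_legP (n : ℕ) :
    (1 - Polynomial.X) * (Polynomial.derivative (legP n) + Polynomial.derivative (legP (n + 1))) =
      (n + 1 : Polynomial ℂ) * (legP n - legP (n + 1)) := by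
  linear_combination (1 - Polynomial.X) * derivative_legP_succ n + legP_succ n

theorem legP_succ_eval_one (n : ℕ) : (legP (n + 1)).eval 1 = (legP n).eval 1 := by
  simp [legP]

theorem legP_succ_eval_neg_one (n : ℕ) : (legP (n + 1)).eval (-1) = -(legP n).eval (-1) := by
  simp [legP]

theorem hasDerivAt_eval_ofReal (p : Polynomial ℂ) (t : ℝ) :
    HasDerivAt (fun s : ℝ => p.eval (s : ℂ)) (p.derivative.eval (t : ℂ)) t :=
  (p.hasDerivAt (t : ℂ)).comp_ofReal

theorem continuous_eval_ofReal (p : Polynomial ℂ) : Continuous fun s : ℝ => p.eval (s : ℂ) :=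
  p.continuous.comp Complex.continuous_ofReal

theorem integral_legP_succ (n : ℕ) (f : Polynomial ℂ) :
    ∫ t in (-1 : ℝ)..1, ((n + 2 : Polynomial ℂ) * f + Polynomial.X * f.derivative).eval (t : ℂ) *
        (legP (n + 1)).eval (t : ℂ) =
      ∫ t in (-1 : ℝ)..1, f.derivative.eval (t : ℂ) * (legP n).eval (t : ℂ) := by
  have hc : ∀ p q : Polynomial ℂ, IntervalIntegrable
      (fun t : ℝ => p.eval (t : ℂ) * q.eval (t : ℂ)) volume (-1) 1 := fun p q =>
    ((continuous_eval_ofReal p).mul (continuous_eval_ofReal q)).intervalIntegrable _ _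
  rw [← sub_eq_zero, ← intervalIntegral.integral_sub (hc _ _) (hc _ _)]
  have h := intervalIntegral.integral_eq_sub_of_hasDerivAt (a := -1) (b := 1)
    (fun t _ => hasDerivAt_eval_ofReal (f * (Polynomial.X * legP (n + 1) - legP n)) t)
    ((continuous_eval_ofReal _).intervalIntegrable _ _)
  have hb : (f * (Polynomial.X * legP (n + 1) - legP n)).eval (((1 : ℝ) : ℂ)) -
      (f * (Polynomial.X * legP (n + 1) - legP n)).eval (((-1 : ℝ) : ℂ)) = 0 := by
    simp [legP_succ_eval_one, legP_succ_eval_neg_one]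
  rw [hb] at h
  rw [← h]
  refine intervalIntegral.integral_congr fun t _ => ?_
  have h2 := congrArg (Polynomial.eval (t : ℂ)) (X_mul_derivative_legP_sub n)
  simp only [Polynomial.derivative_mul, Polynomial.derivative_sub, Polynomial.derivative_X,
    Polynomial.eval_add, Polynomial.eval_sub, Polynomial.eval_mul, Polynomial.eval_X,
    Polynomial.eval_natCast, Polynomial.eval_ofNat, Polynomial.eval_one] at h2 ⊢
  linear_combination (-f.eval (t : ℂ)) * h2

/-! ### The Funk–Hecke formula -/

/-- The linear polynomial `y ↦ x · y`. -/
def linP (x : E3) : MvPolynomial (Fin 3) ℂ := ∑ i, MvPolynomial.C (x i : ℂ) * MvPolynomial.X i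

/-- The polynomial `y ↦ f(x · y)`. -/
def zonal (x : E3) (f : Polynomial ℂ) : MvPolynomial (Fin 3) ℂ := Polynomial.aeval (linP x) f

theorem evalP_linP (x y : E3) : evalP (linP x) y = ((inner ℝ x y : ℝ) : ℂ) := by
  simp [linP, PiLp.inner_apply, mul_comm]

theorem evalP_zonal (x : E3) (f : Polynomial ℂ) (y : E3) :
    evalP (zonal x f) y = f.eval ((inner ℝ x y : ℝ) : ℂ) := by
  rw [← evalP_linP]
  have h := Polynomial.hom_eval₂ f (algebraMap ℂ (MvPolynomial (Fin 3) ℂ))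
    (MvPolynomial.eval fun i => (y i : ℂ)) (linP x)
  have hid : (MvPolynomial.eval fun i => (y i : ℂ)).comp (algebraMap ℂ (MvPolynomial (Fin 3) ℂ)) =
      RingHom.id ℂ := by
    ext c
    simp [MvPolynomial.algebraMap_eq]
  rw [hid] at h
  exact h

theorem pderiv_zonal (x : E3) (f : Polynomial ℂ) (i : Fin 3) :
    MvPolynomial.pderiv i (zonal x f) = zonal x f.derivative * MvPolynomial.C (x i : ℂ) := by
  have h : MvPolynomial.pderiv i (linP x) = MvPolynomial.C (x i : ℂ) := by
    rw [linP, map_sum, Finset.sum_eq_single i]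
    · rw [MvPolynomial.pderiv_C_mul, MvPolynomial.pderiv_X_self, mul_one]
    · intro j _ hj
      rw [MvPolynomial.pderiv_C_mul, MvPolynomial.pderiv_X_of_ne hj, mul_zero]
    · simp
  rw [zonal, Derivation.map_aeval, h, smul_eq_mul, zonal]

theorem integral_pderiv (q : MvPolynomial (Fin 3) ℂ) (i : Fin 3) :
    ∫ x, evalP (MvPolynomial.pderiv i q) x ∂surfMeasure 1 =
      ∫ x, (x i : ℂ) * (2 * evalP q x +
        ∑ j, (x j : ℂ) * evalP (MvPolynomial.pderiv j q) x) ∂surfMeasure 1 := by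
  have h := integral_surfGrad one_pos ((contDiff_evalP q).of_le (by exact_mod_cast le_top)) i
  have h1 : (fun x => surfGrad 1 (evalP q) x i) =ᵐ[surfMeasure 1]
      fun x => evalP (MvPolynomial.pderiv i q -
        MvPolynomial.X i * ∑ j, MvPolynomial.X j * MvPolynomial.pderiv j q) x := by
    filter_upwards [ae_norm_eq zero_le_one] with x hx
    rw [surfGrad_apply one_pos hx (differentiable_evalP q x)]
    simp [pd_evalP]
  have h2 : ∀ p, Integrable (evalP p) (surfMeasure 1) := fun p =>
    integrable_of_continuous zero_le_one (continuous_evalP p)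
  rw [integral_congr_ae h1] at h
  have h3 : ∀ x, evalP (MvPolynomial.pderiv i q -
        MvPolynomial.X i * ∑ j, MvPolynomial.X j * MvPolynomial.pderiv j q) x =
      evalP (MvPolynomial.pderiv i q) x -
        evalP (MvPolynomial.X i * ∑ j, MvPolynomial.X j * MvPolynomial.pderiv j q) x := by simp
  simp only [h3] at h
  rw [integral_sub (h2 _) (h2 _), sub_eq_iff_eq_add] at h
  rw [h, ← integral_const_mul, ← integral_add]
  · refine integral_congr_ae (Filter.Eventually.of_forall fun x => ?_)
    simp
    ring
  · refine Integrable.const_mul ?_ _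
    exact (h2 (MvPolynomial.X i * q)).congr (Filter.Eventually.of_forall fun y => by simp)
  · exact h2 _

theorem integral_zonal_zero (x : E3) (hx : ‖x‖ = 1) (F : Polynomial ℂ) :
    ∫ y, evalP (zonal x F) y ∂surfMeasure 1 =
      2 * Real.pi * ∫ t in (-1 : ℝ)..1, F.eval (t : ℂ) := by
  have hint : ∀ p, Integrable (evalP p) (surfMeasure 1) := fun p =>
    integrable_of_continuous zero_le_one (continuous_evalP p)
  have hint1 : ∀ p : Polynomial ℂ, IntervalIntegrable (fun t : ℝ => p.eval (t : ℂ)) volume (-1) 1 :=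
    fun p => (continuous_eval_ofReal p).intervalIntegrable _ _
  have hxx := sum_sq_eq x
  rw [hx] at hxx
  -- the moments satisfy `(m + 3) M_{m+2} = (m + 1) M_m`, on both sides
  have hL : ∀ m : ℕ, (m + 3 : ℂ) * ∫ y, evalP (zonal x (Polynomial.X ^ (m + 2))) y ∂surfMeasure 1 =
      (m + 1) * ∫ y, evalP (zonal x (Polynomial.X ^ m)) y ∂surfMeasure 1 := by
    intro m
    have h1 : ∑ i, (x i : ℂ) * ∫ y, evalP (MvPolynomial.pderiv i
        (zonal x (Polynomial.X ^ (m + 1)))) y ∂surfMeasure 1 = ∑ i, (x i : ℂ) * ∫ y, (y i : ℂ) *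
        (2 * evalP (zonal x (Polynomial.X ^ (m + 1))) y + ∑ j, (y j : ℂ) * evalP
          (MvPolynomial.pderiv j (zonal x (Polynomial.X ^ (m + 1)))) y) ∂surfMeasure 1 :=
      Finset.sum_congr rfl fun i _ => by rw [integral_pderiv]
    have h2 : ∀ (i : Fin 3) (y : E3), evalP (MvPolynomial.pderiv i
        (zonal x (Polynomial.X ^ (m + 1)))) y =
          (m + 1) * x i * evalP (zonal x (Polynomial.X ^ m)) y := by
      intro i y
      rw [pderiv_zonal, evalP_mul, evalP_zonal, evalP_zonal]
      simp
      ring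
    have h3 : ∀ (i : Fin 3) (y : E3), (y i : ℂ) *
        (2 * evalP (zonal x (Polynomial.X ^ (m + 1))) y + ∑ j, (y j : ℂ) * evalP
          (MvPolynomial.pderiv j (zonal x (Polynomial.X ^ (m + 1)))) y) =
        (m + 3) * ((y i : ℂ) * evalP (zonal x (Polynomial.X ^ (m + 1))) y) := by
      intro i y
      simp only [h2]
      have h4 : ((inner ℝ x y : ℝ) : ℂ) = ∑ j, (x j : ℂ) * (y j : ℂ) := by
        rw [← evalP_linP]
        simp [linP]
      have h5 : ∑ j, (y j : ℂ) * ((m + 1) * (x j : ℂ) * evalP (zonal x (Polynomial.X ^ m)) y) =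
          (m + 1) * ((inner ℝ x y : ℝ) : ℂ) * evalP (zonal x (Polynomial.X ^ m)) y := by
        rw [h4, Finset.mul_sum, Finset.sum_mul]
        exact Finset.sum_congr rfl fun j _ => by ring
      rw [h5, evalP_zonal, evalP_zonal]
      simp
      ring
    simp only [h3] at h1
    simp only [h2, integral_const_mul] at h1
    have h6 : ∑ i, (x i : ℂ) * ((m + 3 : ℂ) * ∫ y, (y i : ℂ) *
        evalP (zonal x (Polynomial.X ^ (m + 1))) y ∂surfMeasure 1) =
        (m + 3) * ∫ y, evalP (zonal x (Polynomial.X ^ (m + 2))) y ∂surfMeasure 1 := by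
      have h7 : ∀ y, evalP (zonal x (Polynomial.X ^ (m + 2))) y =
          ∑ i, (x i : ℂ) * ((y i : ℂ) * evalP (zonal x (Polynomial.X ^ (m + 1))) y) := by
        intro y
        have h4 : ((inner ℝ x y : ℝ) : ℂ) = ∑ j, (x j : ℂ) * (y j : ℂ) := by
          rw [← evalP_linP]
          simp [linP]
        rw [evalP_zonal, evalP_zonal, Polynomial.eval_pow, Polynomial.eval_pow, Polynomial.eval_X,
          pow_succ]
        conv_lhs => rw [mul_comm]; lhs; rw [h4]
        rw [Finset.sum_mul]
        exact Finset.sum_congr rfl fun j _ => by ring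
      simp only [h7]
      rw [integral_finsetSum, Finset.mul_sum]
      · simp only [integral_const_mul]
        exact Finset.sum_congr rfl fun j _ => by ring
      · intro i _
        refine Integrable.const_mul ?_ _
        exact (hint (MvPolynomial.X i * zonal x (Polynomial.X ^ (m + 1)))).congr
          (Filter.Eventually.of_forall fun y => by simp)
    rw [h6] at h1
    rw [← h1]
    rw [show ∑ i, (x i : ℂ) * ((m + 1) * (x i : ℂ) * ∫ y, evalP (zonal x (Polynomial.X ^ m)) y
      ∂surfMeasure 1) = (∑ i, (x i : ℂ) ^ 2) * ((m + 1) * ∫ y, evalP (zonal x (Polynomial.X ^ m)) y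
      ∂surfMeasure 1) by rw [Finset.sum_mul]; exact Finset.sum_congr rfl fun i _ => by ring, hxx]
    simp
  have h0 : ∫ y, evalP (zonal x (Polynomial.X ^ 0)) y ∂surfMeasure 1 = 4 * Real.pi := by
    simp only [evalP_zonal, pow_zero, Polynomial.eval_one]
    exact integral_one_surfMeasure
  have h1 : ∫ y, evalP (zonal x (Polynomial.X ^ 1)) y ∂surfMeasure 1 = 0 := by
    have h2 : ∀ i : Fin 3, ∫ y, (y i : ℂ) ∂surfMeasure 1 = 0 := by
      intro i
      have h := integral_pderiv 1 i
      simp [integral_mul_const] at h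
      exact h
    have h3 : ∀ y, evalP (zonal x (Polynomial.X ^ 1)) y = ∑ i, (x i : ℂ) * (y i : ℂ) := by
      intro y
      rw [evalP_zonal, pow_one, Polynomial.eval_X, ← evalP_linP]
      simp [linP]
    simp only [h3]
    rw [integral_finsetSum]
    · simp [integral_const_mul, h2]
    · intro i _
      refine Integrable.const_mul ?_ _
      exact (hint (MvPolynomial.X i)).congr (Filter.Eventually.of_forall fun y => by simp)
  have hR : ∀ m : ℕ, ∫ t in (-1 : ℝ)..1, ((t : ℂ)) ^ m = (1 - (-1) ^ (m + 1)) / (m + 1) := by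
    intro m
    have h := integral_pow (a := -1) (b := 1) m
    have h2 : ∫ t in (-1 : ℝ)..1, ((t : ℂ)) ^ m = ((∫ t in (-1 : ℝ)..1, t ^ m : ℝ) : ℂ) := by
      rw [← intervalIntegral.integral_ofReal]
      simp
    rw [h2, h]
    push_cast
    simp
  have hmon : ∀ m : ℕ, ∫ y, evalP (zonal x (Polynomial.X ^ m)) y ∂surfMeasure 1 =
      2 * Real.pi * ∫ t in (-1 : ℝ)..1, ((t : ℂ)) ^ m := by
    intro m
    induction m using Nat.twoStepInduction with
    | zero =>
      rw [h0, hR]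
      norm_num
      ring
    | one =>
      rw [h1, hR]
      norm_num
    | more m ih _ =>
      have h3 : (m + 3 : ℂ) ≠ 0 := by exact_mod_cast Nat.succ_ne_zero (m + 2)
      have h4 : (m + 1 : ℂ) ≠ 0 := by exact_mod_cast Nat.succ_ne_zero m
      have h5 := hL m
      rw [ih, hR] at h5
      have h6 := hR (m + 2)
      push_cast at h6
      rw [show (m + 2 + 1 : ℂ) = m + 3 by ring] at h6
      rw [h6]
      apply mul_left_cancel₀ h3
      rw [h5]
      field_simp
      ring
  induction F using Polynomial.induction_on' with
  | add p q hp hq =>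
    have e : ∀ y, evalP (zonal x (p + q)) y = evalP (zonal x p) y + evalP (zonal x q) y := by
      intro y
      simp [evalP_zonal]
    simp only [e, Polynomial.eval_add]
    rw [integral_add (hint _) (hint _), intervalIntegral.integral_add (hint1 _) (hint1 _), hp, hq,
      mul_add]
  | monomial m a =>
    have e : ∀ y, evalP (zonal x (Polynomial.monomial m a)) y =
        a * evalP (zonal x (Polynomial.X ^ m)) y := by
      intro y
      simp [evalP_zonal]
    simp only [e, Polynomial.eval_monomial]
    rw [integral_const_mul, intervalIntegral.integral_const_mul, hmon]
    ring

/-- The Funk–Hecke formula for polynomial kernels. -/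
theorem funkHecke_polynomial (n : ℕ) : ∀ W ∈ SphHarm n, ∀ (x : E3), ‖x‖ = 1 → ∀ F : Polynomial ℂ,
    ∫ y, F.eval ((inner ℝ x y : ℝ) : ℂ) * evalP W y ∂surfMeasure 1 =
      2 * Real.pi * evalP W x * ∫ t in (-1 : ℝ)..1, F.eval (t : ℂ) * (legP n).eval (t : ℂ) := by
  have hint : ∀ p, Integrable (evalP p) (surfMeasure 1) := fun p =>
    integrable_of_continuous zero_le_one (continuous_evalP p)
  induction n with
  | zero =>
    intro W hW x hx F
    have h0 := (mem_SphHarm.1 hW).1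
    rw [← MvPolynomial.totalDegree_zero_iff_isHomogeneous,
      MvPolynomial.totalDegree_eq_zero_iff_eq_C] at h0
    rw [h0]
    have h1 := integral_zonal_zero x hx F
    simp only [evalP_zonal] at h1
    simp only [evalP_C, integral_mul_const, h1, legP, Polynomial.eval_one, mul_one]
    ring
  | succ n ih =>
    intro W hW x hx F
    -- the kernels `(n + 2) f + t f'` exhaust all polynomials
    have key : ∀ f : Polynomial ℂ, ∫ y, ((n + 2 : Polynomial ℂ) * f + Polynomial.X * f.derivative).eval
        ((inner ℝ x y : ℝ) : ℂ) * evalP W y ∂surfMeasure 1 =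
        2 * Real.pi * evalP W x * ∫ t in (-1 : ℝ)..1,
          ((n + 2 : Polynomial ℂ) * f + Polynomial.X * f.derivative).eval (t : ℂ) *
            (legP (n + 1)).eval (t : ℂ) := by
      intro f
      rw [integral_legP_succ]
      have hdW : ∀ i, MvPolynomial.pderiv i W ∈ SphHarm n := fun i => pderiv_mem hW i
      have h1 : ∑ i, ∫ y, evalP (MvPolynomial.pderiv i (zonal x f * MvPolynomial.pderiv i W)) y
          ∂surfMeasure 1 = ∑ i, ∫ y, (y i : ℂ) * (2 * evalP (zonal x f * MvPolynomial.pderiv i W) y +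
          ∑ j, (y j : ℂ) * evalP (MvPolynomial.pderiv j (zonal x f * MvPolynomial.pderiv i W)) y)
          ∂surfMeasure 1 := Finset.sum_congr rfl fun i _ => integral_pderiv _ i
      have hlap : ∀ y, ∑ i, evalP (MvPolynomial.pderiv i (MvPolynomial.pderiv i W)) y = 0 := by
        intro y
        have := congrArg (fun q => evalP q y) (mem_SphHarm.1 hW).2
        simpa [polyLaplacian_apply] using this
      have hE := fun y => euler_evalP (mem_SphHarm.1 hW).1 y
      have hEi := fun i y => euler_evalP (mem_SphHarm.1 (hdW i)).1 y
      have h4 : ∀ y : E3, ((inner ℝ x y : ℝ) : ℂ) = ∑ j, (x j : ℂ) * (y j : ℂ) := fun y => by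
        rw [← evalP_linP]
        simp [linP]
      rw [← integral_finsetSum _ fun i _ => hint _, ← integral_finsetSum] at h1
      · have hl : ∀ y, ∑ i, evalP (MvPolynomial.pderiv i (zonal x f * MvPolynomial.pderiv i W)) y =
            ∑ i, (x i : ℂ) * (f.derivative.eval ((inner ℝ x y : ℝ) : ℂ) *
              evalP (MvPolynomial.pderiv i W) y) := by
          intro y
          have e : ∀ i, evalP (MvPolynomial.pderiv i (zonal x f * MvPolynomial.pderiv i W)) y =
              (x i : ℂ) * (f.derivative.eval ((inner ℝ x y : ℝ) : ℂ) *
              evalP (MvPolynomial.pderiv i W) y) + f.eval ((inner ℝ x y : ℝ) : ℂ) *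
                evalP (MvPolynomial.pderiv i (MvPolynomial.pderiv i W)) y := by
            intro i
            rw [Derivation.leibniz, pderiv_zonal]
            simp [evalP_zonal]
            ring
          simp only [e]
          rw [Finset.sum_add_distrib, ← Finset.mul_sum, hlap y, mul_zero, add_zero]
        have hr : ∀ y, ∑ i, (y i : ℂ) * (2 * evalP (zonal x f * MvPolynomial.pderiv i W) y +
            ∑ j, (y j : ℂ) * evalP (MvPolynomial.pderiv j (zonal x f * MvPolynomial.pderiv i W)) y) =
            (n + 1) * (((n + 2 : Polynomial ℂ) * f + Polynomial.X * f.derivative).eval ((inner ℝ x y : ℝ) : ℂ) *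
              evalP W y) := by
          intro y
          have e : ∀ i j, evalP (MvPolynomial.pderiv j (zonal x f * MvPolynomial.pderiv i W)) y =
              (x j : ℂ) * (f.derivative.eval ((inner ℝ x y : ℝ) : ℂ) *
              evalP (MvPolynomial.pderiv i W) y) + f.eval ((inner ℝ x y : ℝ) : ℂ) *
                evalP (MvPolynomial.pderiv j (MvPolynomial.pderiv i W)) y := by
            intro i j
            rw [Derivation.leibniz, pderiv_zonal]
            simp [evalP_zonal]
            ring
          have e2 : ∀ i, ∑ j, (y j : ℂ) *
              evalP (MvPolynomial.pderiv j (zonal x f * MvPolynomial.pderiv i W)) y =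
              (((inner ℝ x y : ℝ) : ℂ) * f.derivative.eval ((inner ℝ x y : ℝ) : ℂ) +
                n * f.eval ((inner ℝ x y : ℝ) : ℂ)) * evalP (MvPolynomial.pderiv i W) y := by
            intro i
            simp only [e, mul_add, Finset.sum_add_distrib]
            have e3 : ∑ j, (y j : ℂ) * ((x j : ℂ) * (f.derivative.eval ((inner ℝ x y : ℝ) : ℂ) *
                evalP (MvPolynomial.pderiv i W) y)) = (∑ j, (x j : ℂ) * (y j : ℂ)) *
                (f.derivative.eval ((inner ℝ x y : ℝ) : ℂ) * evalP (MvPolynomial.pderiv i W) y) := by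
              rw [Finset.sum_mul]
              exact Finset.sum_congr rfl fun j _ => by ring
            have e4 : ∑ j, (y j : ℂ) * (f.eval ((inner ℝ x y : ℝ) : ℂ) *
                evalP (MvPolynomial.pderiv j (MvPolynomial.pderiv i W)) y) =
                f.eval ((inner ℝ x y : ℝ) : ℂ) * ∑ j, (y j : ℂ) *
                  evalP (MvPolynomial.pderiv j (MvPolynomial.pderiv i W)) y := by
              rw [Finset.mul_sum]
              exact Finset.sum_congr rfl fun j _ => by ring
            rw [e3, e4, hEi, ← h4]
            ring
          simp only [e2, evalP_mul, evalP_zonal]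
          have e5 := hE y
          push_cast at e5
          simp only [Fin.sum_univ_three] at e5 ⊢
          simp only [Polynomial.eval_add, Polynomial.eval_mul, Polynomial.eval_X,
            Polynomial.eval_natCast, Polynomial.eval_ofNat]
          linear_combination ((n + 2) * f.eval ((inner ℝ x y : ℝ) : ℂ) + ((inner ℝ x y : ℝ) : ℂ) *
            f.derivative.eval ((inner ℝ x y : ℝ) : ℂ)) * e5
        simp only [hl, hr] at h1
        rw [integral_const_mul, integral_finsetSum] at h1
        · simp only [integral_const_mul] at h1
          have e6 : ∀ i, ∫ y, f.derivative.eval ((inner ℝ x y : ℝ) : ℂ) *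
              evalP (MvPolynomial.pderiv i W) y ∂surfMeasure 1 = 2 * Real.pi *
              evalP (MvPolynomial.pderiv i W) x * ∫ t in (-1 : ℝ)..1,
                f.derivative.eval (t : ℂ) * (legP n).eval (t : ℂ) := fun i =>
            ih _ (hdW i) x hx f.derivative
          simp only [e6] at h1
          have e5 := hE x
          push_cast at e5
          have h3 : (n + 1 : ℂ) ≠ 0 := by exact_mod_cast Nat.succ_ne_zero n
          apply mul_left_cancel₀ h3
          rw [← h1]
          simp only [Fin.sum_univ_three] at e5 ⊢
          linear_combination (2 * Real.pi * ∫ t in (-1 : ℝ)..1,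
                f.derivative.eval (t : ℂ) * (legP n).eval (t : ℂ)) * e5
        · intro i _
          refine Integrable.const_mul ?_ _
          exact (hint (zonal x f.derivative * MvPolynomial.pderiv i W)).congr
            (Filter.Eventually.of_forall fun y => by simp [evalP_zonal])
      · intro i _
        exact (hint (MvPolynomial.X i * (2 * (zonal x f * MvPolynomial.pderiv i W) +
          ∑ j, MvPolynomial.X j * MvPolynomial.pderiv j (zonal x f * MvPolynomial.pderiv i W)))).congr
          (Filter.Eventually.of_forall fun y => by simp)
    have hint2 : ∀ F : Polynomial ℂ, Integrable (fun y => F.eval ((inner ℝ x y : ℝ) : ℂ) *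
        evalP W y) (surfMeasure 1) := fun F => by
      exact (hint (zonal x F * W)).congr (Filter.Eventually.of_forall fun y => by simp [evalP_zonal])
    have hint1 : ∀ F : Polynomial ℂ, IntervalIntegrable
        (fun t : ℝ => F.eval (t : ℂ) * (legP (n + 1)).eval (t : ℂ)) volume (-1) 1 := fun F =>
      ((continuous_eval_ofReal F).mul (continuous_eval_ofReal _)).intervalIntegrable _ _
    induction F using Polynomial.induction_on' with
    | add p q hp hq =>
      simp only [Polynomial.eval_add, add_mul]
      rw [integral_add (hint2 _) (hint2 _), intervalIntegral.integral_add (hint1 _) (hint1 _), hp,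
        hq, mul_add]
    | monomial m a =>
      have h3 : (n + 2 + m : ℂ) ≠ 0 := by exact_mod_cast (by omega : n + 2 + m ≠ 0)
      have h5 : (n + 2 : Polynomial ℂ) * Polynomial.monomial m (a / (n + 2 + m)) +
          Polynomial.X * (Polynomial.monomial m (a / (n + 2 + m))).derivative =
          Polynomial.monomial m a := by
        have h6 : Polynomial.X * (Polynomial.monomial m (a / (n + 2 + m : ℂ))).derivative =
            (m : Polynomial ℂ) * Polynomial.monomial m (a / (n + 2 + m)) := by
          rcases m with _ | m
          · simp
          · rw [Polynomial.derivative_monomial, Nat.add_sub_cancel, Polynomial.X_mul_monomial,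
              ← Polynomial.C_eq_natCast, Polynomial.C_mul_monomial]
            congr 1
            push_cast
            ring
        rw [h6, ← add_mul, show (n + 2 + m : Polynomial ℂ) = Polynomial.C (n + 2 + m : ℂ) by
          simp only [map_add, map_natCast, map_ofNat],
          Polynomial.C_mul_monomial, mul_div_cancel₀ _ h3]
      have h7 := key (Polynomial.monomial m (a / (n + 2 + m)))
      rwa [h5] at h7

theorem inner_mem_Icc {x y : E3} (hx : ‖x‖ = 1) (hy : ‖y‖ = 1) :
    (inner ℝ x y : ℝ) ∈ Set.Icc (-1 : ℝ) 1 := by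
  have h := abs_real_inner_le_norm x y
  rw [hx, hy, mul_one] at h
  exact abs_le.1 h

theorem exists_bound_evalP (p : MvPolynomial (Fin 3) ℂ) (R : ℝ) :
    ∃ C, 0 ≤ C ∧ ∀ y : E3, ‖y‖ = R → ‖evalP p y‖ ≤ C := by
  obtain ⟨C, hC⟩ := (isCompact_sphere (0 : E3) R).exists_bound_of_continuousOn
    (continuous_evalP p).continuousOn
  exact ⟨max C 0, le_max_right _ _, fun y hy => (hC y (by simp [hy])).trans (le_max_left _ _)⟩

theorem exists_complex_polynomial_near {f : ℝ → ℂ} (hf : Continuous f) {ε : ℝ} (hε : 0 < ε) :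
    ∃ p : Polynomial ℂ, ∀ t ∈ Set.Icc (-1 : ℝ) 1, ‖f t - p.eval (t : ℂ)‖ ≤ ε := by
  obtain ⟨p, hp⟩ := exists_polynomial_near_of_continuousOn (-1) 1 (fun t => (f t).re)
    (Complex.continuous_re.comp hf).continuousOn (ε / 2) (by positivity)
  obtain ⟨q, hq⟩ := exists_polynomial_near_of_continuousOn (-1) 1 (fun t => (f t).im)
    (Complex.continuous_im.comp hf).continuousOn (ε / 2) (by positivity)
  refine ⟨p.map Complex.ofRealHom + Polynomial.C I * q.map Complex.ofRealHom, fun t ht => ?_⟩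
  have he : ∀ r : Polynomial ℝ, (r.map Complex.ofRealHom).eval (t : ℂ) = ((r.eval t : ℝ) : ℂ) := by
    intro r
    rw [← Complex.ofRealHom_eq_coe t, Polynomial.eval_map, Polynomial.eval₂_at_apply]
    rfl
  have h1 : f t - (p.map Complex.ofRealHom + Polynomial.C I * q.map Complex.ofRealHom).eval (t : ℂ) =
      -((p.eval t - (f t).re : ℝ) : ℂ) - I * ((q.eval t - (f t).im : ℝ) : ℂ) := by
    rw [Polynomial.eval_add, Polynomial.eval_mul, he, he, Polynomial.eval_C]
    conv_lhs => rw [← Complex.re_add_im (f t)]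
    push_cast
    ring
  rw [h1]
  refine (norm_sub_le _ _).trans ?_
  rw [norm_neg, norm_mul, Complex.norm_I, one_mul, Complex.norm_real, Complex.norm_real]
  have := hp t ht
  have := hq t ht
  simp only [Real.norm_eq_abs]
  linarith

/-- The Funk–Hecke formula for continuous kernels. -/
theorem funkHecke_continuous {n : ℕ} {W : MvPolynomial (Fin 3) ℂ} (hW : W ∈ SphHarm n) {x : E3}
    (hx : ‖x‖ = 1) {f : ℝ → ℂ} (hf : Continuous f) :
    ∫ y, f (inner ℝ x y) * evalP W y ∂surfMeasure 1 =
      2 * Real.pi * evalP W x * ∫ t in (-1 : ℝ)..1, f t * (legP n).eval (t : ℂ) := by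
  obtain ⟨C, hC0, hC⟩ := exists_bound_evalP W 1
  obtain ⟨D, hD⟩ := (isCompact_Icc (a := (-1 : ℝ)) (b := 1)).exists_bound_of_continuousOn
    (continuous_eval_ofReal (legP n)).continuousOn
  have hD0 : 0 ≤ D := (norm_nonneg _).trans (hD 0 (by norm_num))
  set V := (surfMeasure 1).real Set.univ
  set A := ‖(2 * Real.pi * evalP W x : ℂ)‖
  set K := C * V + A * (D * 2) with hK
  have hV : 0 ≤ V := measureReal_nonneg
  have hA : 0 ≤ A := norm_nonneg _
  have hK0 : 0 ≤ K := by positivity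
  have hinn : Continuous fun y : E3 => (inner ℝ x y : ℝ) := by fun_prop
  refine eq_of_forall_dist_le fun ε hε => ?_
  obtain ⟨p, hp⟩ := exists_complex_polynomial_near hf (show 0 < ε / (K + 1) by positivity)
  have hpoly := funkHecke_polynomial n W hW x hx p
  have hi1 : ∀ g : ℝ → ℂ, Continuous g →
      Integrable (fun y => g (inner ℝ x y) * evalP W y) (surfMeasure 1) := fun g hg =>
    integrable_of_continuous zero_le_one ((hg.comp hinn).mul (continuous_evalP W))
  have hi2 : ∀ g : ℝ → ℂ, Continuous g → IntervalIntegrable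
      (fun t : ℝ => g t * (legP n).eval (t : ℂ)) volume (-1) 1 := fun g hg =>
    (hg.mul (continuous_eval_ofReal _)).intervalIntegrable _ _
  have h1 : ‖∫ y, f (inner ℝ x y) * evalP W y ∂surfMeasure 1 -
      ∫ y, p.eval ((inner ℝ x y : ℝ) : ℂ) * evalP W y ∂surfMeasure 1‖ ≤ ε / (K + 1) * C * V := by
    rw [← integral_sub (hi1 f hf) (hi1 _ (continuous_eval_ofReal p))]
    refine norm_integral_le_of_norm_le_const ?_
    filter_upwards [ae_norm_eq zero_le_one] with y hy
    rw [← sub_mul, norm_mul]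
    exact mul_le_mul (hp _ (inner_mem_Icc hx hy)) (hC y hy) (norm_nonneg _) (by positivity)
  have h2 : ‖(∫ t in (-1 : ℝ)..1, f t * (legP n).eval (t : ℂ)) -
      ∫ t in (-1 : ℝ)..1, p.eval (t : ℂ) * (legP n).eval (t : ℂ)‖ ≤ ε / (K + 1) * D * 2 := by
    rw [← intervalIntegral.integral_sub (hi2 f hf) (hi2 _ (continuous_eval_ofReal p))]
    have h3 := intervalIntegral.norm_integral_le_of_norm_le_const (a := (-1 : ℝ)) (b := 1)
      (C := ε / (K + 1) * D) (f := fun t : ℝ => f t * (legP n).eval (t : ℂ) -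
        p.eval (t : ℂ) * (legP n).eval (t : ℂ)) (fun t ht => by
        rw [Set.uIoc_of_le (by norm_num)] at ht
        rw [← sub_mul, norm_mul]
        exact mul_le_mul (hp _ ⟨ht.1.le, ht.2⟩) (hD t ⟨ht.1.le, ht.2⟩) (norm_nonneg _)
          (by positivity))
    refine h3.trans (le_of_eq ?_)
    norm_num
  rw [dist_eq_norm]
  set a := ∫ y, f (inner ℝ x y) * evalP W y ∂surfMeasure 1
  set b := ∫ y, p.eval ((inner ℝ x y : ℝ) : ℂ) * evalP W y ∂surfMeasure 1
  set c := ∫ t in (-1 : ℝ)..1, f t * (legP n).eval (t : ℂ)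
  set d := ∫ t in (-1 : ℝ)..1, p.eval (t : ℂ) * (legP n).eval (t : ℂ)
  calc ‖a - 2 * Real.pi * evalP W x * c‖ = ‖(a - b) - 2 * Real.pi * evalP W x * (c - d)‖ := by
        rw [hpoly]; congr 1; ring
    _ ≤ ‖a - b‖ + A * ‖c - d‖ := (norm_sub_le _ _).trans (by rw [norm_mul])
    _ ≤ ε / (K + 1) * C * V + A * (ε / (K + 1) * D * 2) := by gcongr
    _ = ε * (K / (K + 1)) := by rw [hK]; ring
    _ ≤ ε := mul_le_of_le_one_right hε.le (by rw [div_le_one (by positivity)]; linarith)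

theorem one_mem_SphHarm : (1 : MvPolynomial (Fin 3) ℂ) ∈ SphHarm 0 :=
  mem_SphHarm.2 ⟨MvPolynomial.isHomogeneous_one _ _, by simp [polyLaplacian_apply]⟩

/-- Archimedes: the projection of the unit sphere to a diameter maps the surface measure to
`2π` times the length. -/
theorem map_inner_surfMeasure {x : E3} (hx : ‖x‖ = 1) :
    (surfMeasure 1).map (fun y => (inner ℝ x y : ℝ)) =
      ENNReal.ofReal (2 * Real.pi) • (volume : Measure ℝ).restrict (Set.Icc (-1) 1) := by
  have hinn : Continuous fun y : E3 => (inner ℝ x y : ℝ) := by fun_prop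
  have : IsFiniteMeasure ((surfMeasure 1).map (fun y => (inner ℝ x y : ℝ))) :=
    Measure.isFiniteMeasure_map _ _
  have : IsFiniteMeasure (ENNReal.ofReal (2 * Real.pi) •
      (volume : Measure ℝ).restrict (Set.Icc (-1) 1)) := Measure.smul_finite _ ENNReal.ofReal_ne_top
  refine ext_of_forall_integral_eq_of_IsFiniteMeasure fun f => ?_
  have h := funkHecke_continuous one_mem_SphHarm hx
    (Complex.continuous_ofReal.comp f.continuous)
  simp only [evalP_one, mul_one, legP, Polynomial.eval_one, Function.comp_apply] at h
  rw [integral_complex_ofReal, intervalIntegral.integral_ofReal] at h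
  have h' : ∫ y, f (inner ℝ x y) ∂surfMeasure 1 = 2 * Real.pi * ∫ t in (-1 : ℝ)..1, f t := by
    exact_mod_cast h
  rw [integral_map hinn.aemeasurable f.continuous.aestronglyMeasurable, h', integral_smul_measure,
    ENNReal.toReal_ofReal (by positivity), smul_eq_mul,
    intervalIntegral.integral_of_le (by norm_num), integral_Icc_eq_integral_Ioc]

theorem integrable_comp_inner {x : E3} (hx : ‖x‖ = 1) {f : ℝ → ℂ}
    (hf : IntegrableOn f (Set.Icc (-1) 1)) :
    Integrable (fun y => f (inner ℝ x y)) (surfMeasure 1) := by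
  have hinn : Continuous fun y : E3 => (inner ℝ x y : ℝ) := by fun_prop
  have h : Integrable f ((surfMeasure 1).map (fun y => (inner ℝ x y : ℝ))) := by
    rw [map_inner_surfMeasure hx]
    exact hf.smul_measure ENNReal.ofReal_ne_top
  exact h.comp_measurable hinn.measurable

theorem integral_norm_comp_inner {x : E3} (hx : ‖x‖ = 1) {f : ℝ → ℂ}
    (hf : IntegrableOn f (Set.Icc (-1) 1)) :
    ∫ y, ‖f (inner ℝ x y)‖ ∂surfMeasure 1 = 2 * Real.pi * ∫ t in Set.Icc (-1 : ℝ) 1, ‖f t‖ := by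
  have hinn : Continuous fun y : E3 => (inner ℝ x y : ℝ) := by fun_prop
  have h : Integrable f ((surfMeasure 1).map (fun y => (inner ℝ x y : ℝ))) := by
    rw [map_inner_surfMeasure hx]
    exact hf.smul_measure ENNReal.ofReal_ne_top
  have h1 := integral_map (f := fun t => ‖f t‖) hinn.aemeasurable h.norm.aestronglyMeasurable
  rw [← h1, map_inner_surfMeasure hx, integral_smul_measure,
    ENNReal.toReal_ofReal (by positivity), smul_eq_mul]

/-- The Funk–Hecke formula for integrable kernels. -/
theorem funkHecke {n : ℕ} {W : MvPolynomial (Fin 3) ℂ} (hW : W ∈ SphHarm n) {x : E3}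
    (hx : ‖x‖ = 1) {f : ℝ → ℂ} (hf : IntegrableOn f (Set.Icc (-1) 1)) :
    Integrable (fun y => f (inner ℝ x y) * evalP W y) (surfMeasure 1) ∧
    ∫ y, f (inner ℝ x y) * evalP W y ∂surfMeasure 1 =
      2 * Real.pi * evalP W x * ∫ t in Set.Icc (-1 : ℝ) 1, f t * (legP n).eval (t : ℂ) := by
  obtain ⟨C, hC0, hC⟩ := exists_bound_evalP W 1
  obtain ⟨D, hD⟩ := (isCompact_Icc (a := (-1 : ℝ)) (b := 1)).exists_bound_of_continuousOn
    (continuous_eval_ofReal (legP n)).continuousOn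
  have hD0 : 0 ≤ D := (norm_nonneg _).trans (hD 0 (by norm_num))
  have hCae : ∀ᵐ y ∂surfMeasure 1, ‖evalP W y‖ ≤ C := by
    filter_upwards [ae_norm_eq zero_le_one] with y hy using hC y hy
  have hDae : ∀ᵐ t : ℝ ∂volume.restrict (Set.Icc (-1) 1), ‖(legP n).eval (t : ℂ)‖ ≤ D :=
    (ae_restrict_iff' measurableSet_Icc).2 (Filter.Eventually.of_forall hD)
  have hi1 : ∀ g : ℝ → ℂ, IntegrableOn g (Set.Icc (-1) 1) →
      Integrable (fun y => g (inner ℝ x y) * evalP W y) (surfMeasure 1) := fun g hg =>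
    (integrable_comp_inner hx hg).mul_bdd (continuous_evalP W).aestronglyMeasurable hCae
  have hi2 : ∀ g : ℝ → ℂ, IntegrableOn g (Set.Icc (-1) 1) → IntegrableOn
      (fun t : ℝ => g t * (legP n).eval (t : ℂ)) (Set.Icc (-1) 1) := fun g hg =>
    Integrable.mul_bdd (μ := volume.restrict (Set.Icc (-1 : ℝ) 1)) hg
      (continuous_eval_ofReal _).aestronglyMeasurable hDae
  refine ⟨hi1 f hf, ?_⟩
  set A := ‖(2 * Real.pi * evalP W x : ℂ)‖
  set K := 2 * Real.pi * C + A * D with hK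
  have hA : 0 ≤ A := norm_nonneg _
  have hK0 : 0 ≤ K := by positivity
  refine eq_of_forall_dist_le fun ε hε => ?_
  obtain ⟨g, -, hgd, hgc, -⟩ := Integrable.exists_hasCompactSupport_integral_sub_le
    (μ := volume.restrict (Set.Icc (-1 : ℝ) 1)) hf (show 0 < ε / (K + 1) by positivity)
  have hg : IntegrableOn g (Set.Icc (-1) 1) := hgc.continuousOn.integrableOn_compact isCompact_Icc
  have hcont := funkHecke_continuous hW hx hgc
  rw [intervalIntegral.integral_of_le (by norm_num), ← integral_Icc_eq_integral_Ioc] at hcont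
  have h1 : ‖∫ y, f (inner ℝ x y) * evalP W y ∂surfMeasure 1 -
      ∫ y, g (inner ℝ x y) * evalP W y ∂surfMeasure 1‖ ≤ 2 * Real.pi * (ε / (K + 1)) * C := by
    rw [← integral_sub (hi1 f hf) (hi1 g hg)]
    calc ‖∫ y, f (inner ℝ x y) * evalP W y - g (inner ℝ x y) * evalP W y ∂surfMeasure 1‖
        ≤ ∫ y, ‖(f - g) (inner ℝ x y)‖ * C ∂surfMeasure 1 := by
          refine norm_integral_le_of_norm_le ((integrable_comp_inner hx (hf.sub hg)).norm.mul_const C) ?_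
          filter_upwards [hCae] with y hy
          rw [← sub_mul, norm_mul]
          exact mul_le_mul_of_nonneg_left hy (norm_nonneg _)
      _ = 2 * Real.pi * (∫ t in Set.Icc (-1 : ℝ) 1, ‖(f - g) t‖) * C := by
          rw [integral_mul_const, integral_norm_comp_inner hx (hf.sub hg)]
      _ ≤ 2 * Real.pi * (ε / (K + 1)) * C := by
          gcongr
          exact hgd
  have h2 : ‖(∫ t in Set.Icc (-1 : ℝ) 1, f t * (legP n).eval (t : ℂ)) -
      ∫ t in Set.Icc (-1 : ℝ) 1, g t * (legP n).eval (t : ℂ)‖ ≤ ε / (K + 1) * D := by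
    rw [← integral_sub (hi2 f hf) (hi2 g hg)]
    calc ‖∫ t in Set.Icc (-1 : ℝ) 1, f t * (legP n).eval (t : ℂ) - g t * (legP n).eval (t : ℂ)‖
        ≤ ∫ t in Set.Icc (-1 : ℝ) 1, ‖f t - g t‖ * D := by
          refine norm_integral_le_of_norm_le ((hf.sub hg).norm.mul_const D) ?_
          filter_upwards [hDae] with t ht
          rw [← sub_mul, norm_mul]
          exact mul_le_mul_of_nonneg_left ht (norm_nonneg _)
      _ ≤ ε / (K + 1) * D := by
          rw [integral_mul_const]
          gcongr
  rw [dist_eq_norm]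
  set a := ∫ y, f (inner ℝ x y) * evalP W y ∂surfMeasure 1
  set b := ∫ y, g (inner ℝ x y) * evalP W y ∂surfMeasure 1
  set c := ∫ t in Set.Icc (-1 : ℝ) 1, f t * (legP n).eval (t : ℂ)
  set d := ∫ t in Set.Icc (-1 : ℝ) 1, g t * (legP n).eval (t : ℂ)
  calc ‖a - 2 * Real.pi * evalP W x * c‖ = ‖(a - b) - 2 * Real.pi * evalP W x * (c - d)‖ := by
        rw [hcont]; congr 1; ring
    _ ≤ ‖a - b‖ + A * ‖c - d‖ := (norm_sub_le _ _).trans (by rw [norm_mul])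
    _ ≤ 2 * Real.pi * (ε / (K + 1)) * C + A * (ε / (K + 1) * D) := by gcongr
    _ = ε * (K / (K + 1)) := by rw [hK]; ring
    _ ≤ ε := mul_le_of_le_one_right hε.le (by rw [div_le_one (by positivity)]; linarith)

/-! ### Kernels depending on the distance -/

theorem image_one_sub_sq_div_two :
    (fun s : ℝ => 1 - s ^ 2 / 2) '' Set.Ioc 0 2 = Set.Ico (-1) 1 := by
  ext t
  constructor
  · rintro ⟨s, ⟨h0, h2⟩, rfl⟩
    constructor <;> simp only <;> nlinarith
  · rintro ⟨h1, h2⟩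
    refine ⟨√(2 - 2 * t), ⟨Real.sqrt_pos.2 (by linarith), ?_⟩, ?_⟩
    · rw [Real.sqrt_le_left (by norm_num)]
      linarith
    · simp only
      rw [Real.sq_sqrt (by linarith)]
      ring

theorem injOn_one_sub_sq_div_two : Set.InjOn (fun s : ℝ => 1 - s ^ 2 / 2) (Set.Ioc 0 2) := by
  rintro s ⟨hs, -⟩ t ⟨ht, -⟩ h
  have h1 : s ^ 2 = t ^ 2 := by simp only at h; linarith
  exact (pow_left_inj₀ hs.le ht.le two_ne_zero).1 h1

theorem hasDerivWithinAt_one_sub_sq_div_two (s : ℝ) (S : Set ℝ) :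
    HasDerivWithinAt (fun s : ℝ => 1 - s ^ 2 / 2) (-s) S s := by
  have h := (((hasDerivAt_id s).pow 2).div_const 2).const_sub 1
  refine (h.congr_deriv ?_).hasDerivWithinAt
  simp

theorem dist_eq_sqrt_inner {x y : E3} (hx : ‖x‖ = 1) (hy : ‖y‖ = 1) :
    ‖x - y‖ = √(2 - 2 * inner ℝ x y) := by
  rw [eq_comm, Real.sqrt_eq_iff_eq_sq _ (norm_nonneg _), norm_sub_sq_real, hx, hy]
  · ring
  · have := (inner_mem_Icc hx hy).2
    linarith

/-- The Funk–Hecke formula for kernels that depend on the distance `s = |x - y|`, obtained by the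
substitution `x · y = 1 - s² / 2`. -/
theorem funkHecke_dist {n : ℕ} {W : MvPolynomial (Fin 3) ℂ} (hW : W ∈ SphHarm n) {x : E3}
    (hx : ‖x‖ = 1) {f : ℝ → ℂ} (hf : IntegrableOn (fun s : ℝ => s * f s) (Set.Ioc 0 2)) :
    Integrable (fun y => f ‖x - y‖ * evalP W y) (surfMeasure 1) ∧
    ∫ y, f ‖x - y‖ * evalP W y ∂surfMeasure 1 =
      2 * Real.pi * evalP W x * ∫ s in (0 : ℝ)..2, s * f s * (legP n).eval ((1 - s ^ 2 / 2 : ℝ) : ℂ) := by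
  have hsq : ∀ s ∈ Set.Ioc (0 : ℝ) 2, √(2 - 2 * (1 - s ^ 2 / 2)) = s := fun s hs => by
    rw [show 2 - 2 * (1 - s ^ 2 / 2) = s ^ 2 by ring, Real.sqrt_sq hs.1.le]
  have h1 : IntegrableOn (fun t => f √(2 - 2 * t)) (Set.Icc (-1) 1) := by
    rw [integrableOn_Icc_iff_integrableOn_Ico, ← image_one_sub_sq_div_two,
      integrableOn_image_iff_integrableOn_abs_deriv_smul measurableSet_Ioc
        (fun s _ => hasDerivWithinAt_one_sub_sq_div_two s _) injOn_one_sub_sq_div_two]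
    refine hf.congr_fun (fun s hs => ?_) measurableSet_Ioc
    simp only [hsq s hs, abs_neg, abs_of_pos hs.1, Complex.real_smul]
  have h2 := funkHecke hW hx h1
  have hae : (fun y => f √(2 - 2 * inner ℝ x y) * evalP W y) =ᵐ[surfMeasure 1]
      fun y => f ‖x - y‖ * evalP W y := by
    filter_upwards [ae_norm_eq zero_le_one] with y hy
    rw [dist_eq_sqrt_inner hx hy]
  refine ⟨h2.1.congr hae, ?_⟩
  rw [← integral_congr_ae hae, h2.2, integral_Icc_eq_integral_Ico, ← image_one_sub_sq_div_two,
    integral_image_eq_integral_abs_deriv_smul measurableSet_Ioc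
      (fun s _ => hasDerivWithinAt_one_sub_sq_div_two s _) injOn_one_sub_sq_div_two,
    intervalIntegral.integral_of_le (by norm_num)]
  congr 1
  refine setIntegral_congr_fun measurableSet_Ioc fun s hs => ?_
  simp only [hsq s hs, abs_neg, abs_of_pos hs.1, Complex.real_smul, mul_assoc]

/-! ### Spherical Bessel functions -/

/-- The functions `f_n(t) = (-t)^n ((1/t) d/dt)^n f_0(t)` of Rayleigh's formula. -/
def rayleigh (f : ℂ → ℂ) (n : ℕ) (t : ℂ) : ℂ := (-t) ^ n * (rayleighOp^[n] f) t

theorem sphH_eq (n : ℕ) (t : ℂ) : sphH n t = -I * rayleigh (fun u => exp (I * u) / u) n t := rfl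

/-- The functions of Rayleigh's formula have at most a pole at the origin. -/
theorem exists_entire_rayleighOp {f V₀ : ℂ → ℂ} (hV₀ : Differentiable ℂ V₀)
    (hf : ∀ t ≠ 0, f t = V₀ t / t) (n : ℕ) :
    ∃ V : ℂ → ℂ, Differentiable ℂ V ∧ (V₀ 0 = 0 → V 0 = 0) ∧
      ∀ t ≠ 0, (rayleighOp^[n] f) t = V t / t ^ (2 * n + 1) := by
  induction n with
  | zero => exact ⟨V₀, hV₀, id, by simpa using hf⟩
  | succ n ih =>
    obtain ⟨V, hV, h0, h⟩ := ih
    have hV' : Differentiable ℂ (deriv V) :=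
      fun z => ((hV.contDiff (n := 2)).differentiable_deriv_two z)
    refine ⟨fun t => t * deriv V t - (2 * n + 1) * V t, by fun_prop, fun h1 => by simp [h0 h1], ?_⟩
    intro t ht
    have hev : (rayleighOp^[n] f) =ᶠ[nhds t] fun s => V s / s ^ (2 * n + 1) := by
      filter_upwards [isOpen_ne.mem_nhds ht] with s hs using h s hs
    have hd : HasDerivAt (fun s => V s / s ^ (2 * n + 1))
        ((deriv V t * t ^ (2 * n + 1) - V t * ((2 * n + 1 : ℕ) * t ^ (2 * n))) /
          (t ^ (2 * n + 1)) ^ 2) t :=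
      (hV t).hasDerivAt.div (hasDerivAt_pow (2 * n + 1) t) (pow_ne_zero _ ht)
    rw [Function.iterate_succ_apply', rayleighOp, hev.deriv_eq, hd.deriv]
    push_cast
    field_simp
    ring

theorem differentiableAt_rayleighOp {f V₀ : ℂ → ℂ} (hV₀ : Differentiable ℂ V₀)
    (hf : ∀ t ≠ 0, f t = V₀ t / t) (n : ℕ) {t : ℂ} (ht : t ≠ 0) :
    DifferentiableAt ℂ (rayleighOp^[n] f) t := by
  obtain ⟨V, hV, -, h⟩ := exists_entire_rayleighOp hV₀ hf n
  have hev : (rayleighOp^[n] f) =ᶠ[nhds t] fun s => V s / s ^ (2 * n + 1) := by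
    filter_upwards [isOpen_ne.mem_nhds ht] with s hs using h s hs
  exact ((hV t).div (differentiableAt_pow _) (pow_ne_zero _ ht)).congr_of_eventuallyEq hev

theorem hasDerivAt_rayleigh {f V₀ : ℂ → ℂ} (hV₀ : Differentiable ℂ V₀)
    (hf : ∀ t ≠ 0, f t = V₀ t / t) (n : ℕ) {t : ℂ} (ht : t ≠ 0) :
    HasDerivAt (rayleigh f n) (n / t * rayleigh f n t - rayleigh f (n + 1) t) t := by
  have h1 := ((hasDerivAt_neg t).pow n).mul (differentiableAt_rayleighOp hV₀ hf n ht).hasDerivAt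
  refine h1.congr_deriv ?_
  rw [rayleigh, rayleigh, Function.iterate_succ_apply', rayleighOp]
  rcases n with _ | n
  · simp
    field_simp
  · simp only [Nat.add_sub_cancel]
    push_cast
    field_simp
    simp only [Pi.pow_apply]
    ring

/-- The second recurrence: it follows from the spherical Bessel equation of order zero. -/
theorem hasDerivAt_rayleigh_succ {f V₀ : ℂ → ℂ} (hV₀ : Differentiable ℂ V₀)
    (hf : ∀ t ≠ 0, f t = V₀ t / t) (hode : ∀ t, deriv (deriv V₀) t = -V₀ t) (n : ℕ) :
    ∀ {t : ℂ}, t ≠ 0 → HasDerivAt (rayleigh f (n + 1))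
      (rayleigh f n t - (n + 2) / t * rayleigh f (n + 1) t) t := by
  have hr : ∀ m : ℕ, ∀ {t : ℂ}, t ≠ 0 →
      HasDerivAt (rayleigh f m) (m / t * rayleigh f m t - rayleigh f (m + 1) t) t :=
    fun m t ht => hasDerivAt_rayleigh hV₀ hf m ht
  induction n with
  | zero =>
    intro t ht
    have hV' : Differentiable ℂ (deriv V₀) :=
      fun z => ((hV₀.contDiff (n := 2)).differentiable_deriv_two z)
    have h1 : ∀ s ≠ 0, rayleigh f 1 s = V₀ s / s ^ 2 - deriv V₀ s / s := by
      intro s hs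
      have hev : f =ᶠ[nhds s] fun s => V₀ s / s := by
        filter_upwards [isOpen_ne.mem_nhds hs] with s hs using hf s hs
      have hd : HasDerivAt (fun s => V₀ s / s) ((deriv V₀ s * s - V₀ s * 1) / s ^ 2) s :=
        (hV₀ s).hasDerivAt.div (hasDerivAt_id s) hs
      rw [rayleigh, Function.iterate_one, rayleighOp, hev.deriv_eq, hd.deriv]
      field_simp
      ring
    have hev : rayleigh f 1 =ᶠ[nhds t] fun s => V₀ s / s ^ 2 - deriv V₀ s / s := by
      filter_upwards [isOpen_ne.mem_nhds ht] with s hs using h1 s hs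
    have hd := ((hV₀ t).hasDerivAt.div (hasDerivAt_pow 2 t) (pow_ne_zero 2 ht)).sub
      ((hV' t).hasDerivAt.div (hasDerivAt_id t) ht)
    refine (hd.congr_of_eventuallyEq hev).congr_deriv ?_
    rw [zero_add, h1 t ht, hode, rayleigh, Function.iterate_zero]
    simp only [id_eq]
    rw [hf t ht]
    simp
    field_simp
    ring
  | succ n ih =>
    intro t ht
    have h1 : ∀ s : ℂ, s ≠ 0 →
        rayleigh f (n + 2) s = (2 * n + 3) * (rayleigh f (n + 1) s / s) - rayleigh f n s := by
      intro s hs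
      have h2 := (hr (n + 1) hs).unique (ih hs)
      push_cast at h2
      rw [show n + 1 + 1 = n + 2 from rfl] at h2
      linear_combination (-1 : ℂ) * h2
    have hev : rayleigh f (n + 2) =ᶠ[nhds t]
        fun s => (2 * n + 3) * (rayleigh f (n + 1) s / s) - rayleigh f n s := by
      filter_upwards [isOpen_ne.mem_nhds ht] with s hs using h1 s hs
    have hd := ((((ih ht).div (hasDerivAt_id t) ht).const_mul (2 * n + 3 : ℂ)).sub (hr n ht))
    refine (hd.congr_of_eventuallyEq hev).congr_deriv ?_
    rw [h1 t ht]
    push_cast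
    simp only [id]
    field_simp
    ring

theorem hasDerivAt_sphJ (n : ℕ) {t : ℂ} (ht : t ≠ 0) :
    HasDerivAt (sphJ n) (n / t * sphJ n t - sphJ (n + 1) t) t :=
  hasDerivAt_rayleigh (V₀ := sin) differentiable_sin (fun _ _ => rfl) n ht

theorem hasDerivAt_sphJ_succ (n : ℕ) {t : ℂ} (ht : t ≠ 0) :
    HasDerivAt (sphJ (n + 1)) (sphJ n t - (n + 2) / t * sphJ (n + 1) t) t :=
  hasDerivAt_rayleigh_succ (V₀ := sin) differentiable_sin (fun _ _ => rfl)
    (fun t => by simp) n ht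

theorem differentiable_exp_I_mul : Differentiable ℂ fun u : ℂ => exp (I * u) := by fun_prop

theorem hasDerivAt_exp_I_mul (t : ℂ) :
    HasDerivAt (fun u : ℂ => exp (I * u)) (I * exp (I * t)) t := by
  have h := ((hasDerivAt_id t).const_mul I).cexp
  simpa [mul_comm] using h

theorem hasDerivAt_sphH (n : ℕ) {t : ℂ} (ht : t ≠ 0) :
    HasDerivAt (sphH n) (n / t * sphH n t - sphH (n + 1) t) t := by
  have h := (hasDerivAt_rayleigh (V₀ := fun u => exp (I * u)) differentiable_exp_I_mul
    (f := fun u => exp (I * u) / u) (fun _ _ => rfl) n ht).const_mul (-I)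
  refine h.congr_deriv ?_
  rw [sphH_eq, sphH_eq]
  ring

theorem hasDerivAt_sphH_succ (n : ℕ) {t : ℂ} (ht : t ≠ 0) :
    HasDerivAt (sphH (n + 1)) (sphH n t - (n + 2) / t * sphH (n + 1) t) t := by
  have hode : ∀ t : ℂ, deriv (deriv fun u : ℂ => exp (I * u)) t = -exp (I * t) := by
    intro t
    have h1 : (deriv fun u : ℂ => exp (I * u)) = fun u => I * exp (I * u) :=
      funext fun u => (hasDerivAt_exp_I_mul u).deriv
    rw [h1, ((hasDerivAt_exp_I_mul t).const_mul I).deriv, ← mul_assoc, I_mul_I]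
    ring
  have h := (hasDerivAt_rayleigh_succ (V₀ := fun u => exp (I * u)) differentiable_exp_I_mul
    (f := fun u => exp (I * u) / u) (fun _ _ => rfl) hode n ht).const_mul (-I)
  refine h.congr_deriv ?_
  rw [sphH_eq, sphH_eq]
  ring

/-- The Wronskian of `j_n` and `h_n`, in terms of consecutive orders. -/
theorem sphJ_succ_mul_sphH_sub (n : ℕ) {t : ℂ} (ht : t ≠ 0) :
    sphJ (n + 1) t * sphH n t - sphJ n t * sphH (n + 1) t = I / t ^ 2 := by
  induction n with
  | zero =>
    have h1 : HasDerivAt (fun u : ℂ => sin u / u) ((cos t * t - sin t * 1) / t ^ 2) t :=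
      (hasDerivAt_sin t).div (hasDerivAt_id t) ht
    have h2 : HasDerivAt (fun u : ℂ => exp (I * u) / u)
        ((I * exp (I * t) * t - exp (I * t) * 1) / t ^ 2) t :=
      (hasDerivAt_exp_I_mul t).div (hasDerivAt_id t) ht
    have hexp : exp (I * t) = cos t + sin t * I := by rw [mul_comm, exp_mul_I]
    simp only [sphJ, sphH, zero_add, Function.iterate_one, Function.iterate_zero, id, rayleighOp,
      pow_zero, pow_one, h1.deriv, h2.deriv, hexp]
    have hI := I_sq
    have hcs := sin_sq_add_cos_sq t
    field_simp
    linear_combination (-sin t ^ 2 * t) * hI + t * hcs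
  | succ n ih =>
    have h1 := (hasDerivAt_sphJ (n + 1) ht).unique (hasDerivAt_sphJ_succ n ht)
    have h2 := (hasDerivAt_sphH (n + 1) ht).unique (hasDerivAt_sphH_succ n ht)
    rw [← ih]
    push_cast at h1 h2
    linear_combination (-sphH (n + 1) t) * h1 + sphJ (n + 1) t * h2

/-! ### The integral `∫ exp(iκs) P_n(1 - s²/2) ds` -/

/-- The integral that governs the single layer potential with frequency parameter `κ = kR` on the
spherical harmonics of degree `n`. -/
def besselInt (n : ℕ) (κ : ℂ) : ℂ :=
  ∫ s in (0 : ℝ)..2, exp (I * κ * s) * (legP n).eval ((1 - s ^ 2 / 2 : ℝ) : ℂ)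

/-- The derivative of `besselInt`. -/
def besselInt' (n : ℕ) (κ : ℂ) : ℂ :=
  ∫ s in (0 : ℝ)..2, I * s * exp (I * κ * s) * (legP n).eval ((1 - s ^ 2 / 2 : ℝ) : ℂ)

theorem continuous_legP_comp (p : Polynomial ℂ) :
    Continuous fun s : ℝ => p.eval ((1 - s ^ 2 / 2 : ℝ) : ℂ) :=
  (continuous_eval_ofReal p).comp (by fun_prop)

theorem hasDerivAt_besselInt (n : ℕ) (κ : ℂ) : HasDerivAt (besselInt n) (besselInt' n κ) κ := by
  have hL := continuous_legP_comp (legP n)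
  have hc : Continuous fun q : ℂ × ℝ =>
      I * q.2 * exp (I * q.1 * q.2) * (legP n).eval ((1 - q.2 ^ 2 / 2 : ℝ) : ℂ) := by
    have := hL.comp (continuous_snd (X := ℂ) (Y := ℝ))
    simp only [Function.comp_def] at this
    fun_prop
  obtain ⟨C, hC⟩ := ((isCompact_closedBall κ 1).prod
    (isCompact_Icc (a := (0 : ℝ)) (b := 2))).exists_bound_of_continuousOn hc.continuousOn
  refine (intervalIntegral.hasDerivAt_integral_of_dominated_loc_of_deriv_le (μ := volume)
    (bound := fun _ => C) (s := Metric.closedBall κ 1)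
    (F := fun κ s => exp (I * κ * s) * (legP n).eval ((1 - s ^ 2 / 2 : ℝ) : ℂ))
    (F' := fun κ s => I * s * exp (I * κ * s) * (legP n).eval ((1 - s ^ 2 / 2 : ℝ) : ℂ))
    (Metric.closedBall_mem_nhds κ one_pos)
    (Filter.Eventually.of_forall fun z => ?_) ?_ ?_ ?_ (by simp) ?_).2
  · exact Continuous.aestronglyMeasurable (by fun_prop)
  · exact Continuous.intervalIntegrable (by fun_prop) _ _
  · exact Continuous.aestronglyMeasurable (by fun_prop)
  · refine Filter.Eventually.of_forall fun s hs z hz => ?_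
    rw [Set.uIoc_of_le (by norm_num)] at hs
    exact hC (z, s) ⟨hz, hs.1.le, hs.2⟩
  · refine Filter.Eventually.of_forall fun s hs z hz => ?_
    have h := (((hasDerivAt_id z).const_mul I).mul_const (s : ℂ)).cexp.mul_const
      ((legP n).eval ((1 - s ^ 2 / 2 : ℝ) : ℂ))
    refine h.congr_deriv ?_
    simp only [id]
    ring

theorem besselInt_recurrence (n : ℕ) (κ : ℂ) :
    κ * (besselInt' n κ + besselInt' (n + 1) κ) =
      (2 * n + 1) * besselInt n κ - (2 * n + 3) * besselInt (n + 1) κ := by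
  set Q := legP n + legP (n + 1) with hQ
  have hQ1 : Q.eval (-1) = 0 := by simp [hQ, legP_succ_eval_neg_one]
  have hd : ∀ s : ℝ, HasDerivAt (fun s : ℝ => (s : ℂ) * exp (I * κ * s) *
      Q.eval ((1 - s ^ 2 / 2 : ℝ) : ℂ))
      ((1 * exp (I * κ * s) + s * (exp (I * κ * s) * (I * κ))) * Q.eval ((1 - s ^ 2 / 2 : ℝ) : ℂ) +
        s * exp (I * κ * s) * (Q.derivative.eval ((1 - s ^ 2 / 2 : ℝ) : ℂ) * (-s : ℝ))) s := by
    intro s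
    have h0 : HasDerivAt (fun s : ℝ => (s : ℂ)) 1 s := Complex.ofRealCLM.hasDerivAt
    have h1 : HasDerivAt (fun s : ℝ => exp (I * κ * s)) (exp (I * κ * s) * (I * κ)) s := by
      simpa using (h0.const_mul (I * κ)).cexp
    have h2 : HasDerivAt (fun s : ℝ => Q.eval ((1 - s ^ 2 / 2 : ℝ) : ℂ))
        (Q.derivative.eval ((1 - s ^ 2 / 2 : ℝ) : ℂ) * (-s : ℝ)) s := by
      have h3 := HasDerivAt.scomp (h := fun s : ℝ => 1 - s ^ 2 / 2) s
        (hasDerivAt_eval_ofReal Q (1 - s ^ 2 / 2))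
        ((hasDerivWithinAt_one_sub_sq_div_two s Set.univ).hasDerivAt Filter.univ_mem)
      refine h3.congr_deriv ?_
      rw [Complex.real_smul, mul_comm]
    exact (h0.mul h1).mul h2
  have hcl := fun p => continuous_legP_comp p
  have h := intervalIntegral.integral_eq_sub_of_hasDerivAt (a := 0) (b := 2) (fun s _ => hd s)
    (Continuous.intervalIntegrable (by
      have := hcl Q
      have := hcl Q.derivative
      fun_prop) _ _)
  have hb : ((2 : ℝ) : ℂ) * exp (I * κ * (2 : ℝ)) * Q.eval ((1 - (2 : ℝ) ^ 2 / 2 : ℝ) : ℂ) -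
      ((0 : ℝ) : ℂ) * exp (I * κ * (0 : ℝ)) * Q.eval ((1 - (0 : ℝ) ^ 2 / 2 : ℝ) : ℂ) = 0 := by
    have e : ((1 - (2 : ℝ) ^ 2 / 2 : ℝ) : ℂ) = -1 := by norm_num
    rw [e, hQ1]
    simp
  rw [hb] at h
  have hi : ∀ m, IntervalIntegrable (fun s : ℝ => exp (I * κ * s) *
      (legP m).eval ((1 - s ^ 2 / 2 : ℝ) : ℂ)) volume 0 2 := fun m => by
    have := hcl (legP m)
    exact Continuous.intervalIntegrable (by fun_prop) _ _
  have hi' : ∀ m, IntervalIntegrable (fun s : ℝ => I * s * exp (I * κ * s) *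
      (legP m).eval ((1 - s ^ 2 / 2 : ℝ) : ℂ)) volume 0 2 := fun m => by
    have := hcl (legP m)
    exact Continuous.intervalIntegrable (by fun_prop) _ _
  rw [besselInt, besselInt, besselInt', besselInt', ← intervalIntegral.integral_add (hi' _) (hi' _),
    ← intervalIntegral.integral_const_mul, ← intervalIntegral.integral_const_mul,
    ← intervalIntegral.integral_const_mul,
    ← intervalIntegral.integral_sub ((hi _).const_mul _) ((hi _).const_mul _), ← sub_eq_zero,
    ← intervalIntegral.integral_sub (((hi' _).add (hi' _)).const_mul _)
      (((hi _).const_mul _).sub ((hi _).const_mul _)), ← h]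
  refine intervalIntegral.integral_congr fun s _ => ?_
  have h2 := congrArg (Polynomial.eval ((1 - s ^ 2 / 2 : ℝ) : ℂ)) (one_sub_X_mul_derivative_legP n)
  simp only [hQ, Polynomial.derivative_add, Polynomial.eval_add, Polynomial.eval_sub,
    Polynomial.eval_mul, Polynomial.eval_X, Polynomial.eval_natCast, Polynomial.eval_one] at h2 ⊢
  push_cast at h2 ⊢
  linear_combination (2 * exp (I * κ * s)) * h2

theorem besselInt_zero {κ : ℂ} (hκ : κ ≠ 0) : besselInt 0 κ = 2 * I * κ * sphH 0 κ * sphJ 0 κ := by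
  have hIκ : I * κ ≠ 0 := mul_ne_zero I_ne_zero hκ
  have h1 : besselInt 0 κ = (exp (2 * (I * κ)) - 1) / (I * κ) := by
    rw [besselInt]
    simp only [legP, Polynomial.eval_one, mul_one]
    rw [integral_exp_mul_complex hIκ]
    simp [mul_comm]
  have h2 : exp (2 * (I * κ)) = exp (I * κ) ^ 2 := by rw [← Complex.exp_nat_mul]; norm_num
  have h3 : sin κ = (exp (-κ * I) - exp (κ * I)) * I / 2 := rfl
  have h4 : exp (-κ * I) = (exp (I * κ))⁻¹ := by rw [← Complex.exp_neg]; ring_nf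
  rw [h1, h2]
  simp only [sphH, sphJ, pow_zero, one_mul, Function.iterate_zero, id]
  rw [h3, h4, mul_comm κ I]
  have he := Complex.exp_ne_zero (I * κ)
  have hI := I_sq
  field_simp
  linear_combination (1 - exp (I * κ) ^ 2) * (I ^ 2 - 1) * hI

/-- The integral in closed form. By induction, the difference `D` of the two sides for `n + 1` solves
`κ D' = -(2n + 3) D`, and `κ ^ (2n + 3) D` tends to zero at the origin. -/
theorem besselInt_eq (n : ℕ) : ∀ {κ : ℂ}, κ ≠ 0 →
    besselInt n κ = 2 * I * κ * sphH n κ * sphJ n κ := by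
  induction n with
  | zero => exact fun hκ => besselInt_zero hκ
  | succ n ih =>
    -- the difference of the two sides solves `κ D' = -(2n + 3) D`
    set A : ℕ → ℂ → ℂ := fun m κ => 2 * I * κ * sphH m κ * sphJ m κ with hA
    set E : ℂ → ℂ := fun κ => κ ^ (2 * n + 3) * (besselInt (n + 1) κ - A (n + 1) κ) with hE
    have hdJ : ∀ κ ≠ 0, HasDerivAt (A n) (besselInt' n κ) κ := fun κ hκ => by
      refine (hasDerivAt_besselInt n κ).congr_of_eventuallyEq ?_
      filter_upwards [isOpen_ne.mem_nhds hκ] with z hz using (ih hz).symm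
    have hdE : ∀ κ ≠ 0, HasDerivAt E 0 κ := by
      intro κ hκ
      have h1 := (((hasDerivAt_id κ).const_mul (2 * I)).mul (hasDerivAt_sphH n hκ)).mul
        (hasDerivAt_sphJ n hκ)
      have h2 := (((hasDerivAt_id κ).const_mul (2 * I)).mul (hasDerivAt_sphH_succ n hκ)).mul
        (hasDerivAt_sphJ_succ n hκ)
      have h3 := h1.unique (hdJ κ hκ)
      have h4 := besselInt_recurrence n κ
      have h5 := ((hasDerivAt_id κ).pow (2 * n + 3)).mul
        ((hasDerivAt_besselInt (n + 1) κ).sub h2)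
      refine h5.congr_deriv ?_
      rw [← h3, ih hκ] at h4
      simp only [id, Pi.mul_apply, Pi.sub_apply, Pi.pow_apply,
        show 2 * n + 3 - 1 = 2 * n + 2 by omega] at h4 ⊢
      push_cast
      field_simp at h4 ⊢
      linear_combination κ ^ (2 * n + 2) * h4
    have hconst : ∀ z ≠ (0 : ℂ), E z = E 1 := by
      intro z hz
      have hpre : IsPreconnected ({0}ᶜ : Set ℂ) :=
        (isConnected_compl_singleton_of_one_lt_rank (by simp) 0).isPreconnected
      exact isOpen_compl_singleton.is_const_of_deriv_eq_zero hpre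
        (fun κ hκ => (hdE κ hκ).differentiableAt.differentiableWithinAt)
        (fun κ hκ => (hdE κ hκ).deriv) hz (by simp)
    obtain ⟨V, hV, hV0, hVj⟩ := exists_entire_rayleighOp (f := fun u : ℂ => sin u / u) (V₀ := sin)
      differentiable_sin (fun _ _ => rfl) (n + 1)
    obtain ⟨W, hW, -, hWh⟩ := exists_entire_rayleighOp (f := fun u : ℂ => exp (I * u) / u)
      (V₀ := fun u => exp (I * u)) differentiable_exp_I_mul (fun _ _ => rfl) (n + 1)
    have hE2 : ∀ κ ≠ 0, E κ = κ ^ (2 * n + 3) * besselInt (n + 1) κ - 2 * W κ * V κ := by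
      intro κ hκ
      simp only [hE, hA, sphH, sphJ]
      rw [hVj κ hκ, hWh κ hκ]
      have hpow : (-κ) ^ (n + 1) * (-κ) ^ (n + 1) = κ ^ (2 * n + 2) := by
        rw [← mul_pow, neg_mul_neg, ← pow_two, ← pow_mul]
        congr 1
      have hI := I_sq
      have hsplit : κ ^ (2 * n + 3) * (besselInt (n + 1) κ - 2 * I * κ *
          (-I * ((-κ) ^ (n + 1) * (W κ / κ ^ (2 * (n + 1) + 1)))) *
          ((-κ) ^ (n + 1) * (V κ / κ ^ (2 * (n + 1) + 1)))) =
          κ ^ (2 * n + 3) * besselInt (n + 1) κ + 2 * I ^ 2 * ((-κ) ^ (n + 1) * (-κ) ^ (n + 1)) *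
          κ ^ (2 * n + 3) * κ * (W κ / κ ^ (2 * (n + 1) + 1)) * (V κ / κ ^ (2 * (n + 1) + 1)) := by
        ring
      rw [hsplit, hpow, hI, show 2 * (n + 1) + 1 = 2 * n + 3 by ring]
      field_simp
      ring
    have hlim : Filter.Tendsto E (nhdsWithin 0 {0}ᶜ) (nhds 0) := by
      have hcont : ContinuousAt (fun κ => κ ^ (2 * n + 3) * besselInt (n + 1) κ - 2 * W κ * V κ) 0 :=
        ((continuousAt_id.pow _).mul (hasDerivAt_besselInt (n + 1) 0).continuousAt).sub
          ((continuousAt_const.mul hW.continuous.continuousAt).mul hV.continuous.continuousAt)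
      have h := hcont.tendsto
      simp only [hV0 sin_zero, mul_zero, sub_zero, ne_eq, Nat.succ_ne_zero, not_false_eq_true,
        zero_pow, zero_mul] at h
      refine (h.mono_left nhdsWithin_le_nhds).congr' ?_
      filter_upwards [self_mem_nhdsWithin] with κ hκ using (hE2 κ hκ).symm
    have hE1 : E 1 = 0 := by
      have h2 : Filter.Tendsto E (nhdsWithin 0 {0}ᶜ) (nhds (E 1)) := by
        refine tendsto_const_nhds.congr' ?_
        filter_upwards [self_mem_nhdsWithin] with κ hκ using (hconst κ hκ).symm
      exact tendsto_nhds_unique h2 hlim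
    intro κ hκ
    have h := hconst κ hκ
    rw [hE1] at h
    have h2 := (mul_eq_zero.1 h).resolve_left (pow_ne_zero _ hκ)
    exact sub_eq_zero.1 h2

/-! ### Relations between the explicit coefficients -/

theorem chi_eq_besselInt {R : ℝ} (hR : 0 < R) {k : ℂ} (hk : k ≠ 0) (n : ℕ) :
    chi R k n = -(R / 2) * besselInt n (k * R) := by
  have hRc : (R : ℂ) ≠ 0 := by exact_mod_cast hR.ne'
  rw [besselInt_eq n (mul_ne_zero hk hRc), chi]
  ring

theorem lam_eq_besselInt {R : ℝ} (hR : 0 < R) {k : ℂ} (hk : k ≠ 0) (n : ℕ) :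
    lam R k n = (besselInt n (k * R) - k * R * besselInt' n (k * R)) / 4 := by
  have hRc : (R : ℂ) ≠ 0 := by exact_mod_cast hR.ne'
  set κ := k * R with hκ
  have h0 : κ ≠ 0 := mul_ne_zero hk hRc
  have h1 : HasDerivAt (fun z => 2 * I * z * sphH n z * sphJ n z) (besselInt' n κ) κ := by
    refine (hasDerivAt_besselInt n κ).congr_of_eventuallyEq ?_
    filter_upwards [isOpen_ne.mem_nhds h0] with z hz using (besselInt_eq n hz).symm
  have h2 := (((hasDerivAt_id κ).const_mul (2 * I)).mul (hasDerivAt_sphH n h0)).mul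
        (hasDerivAt_sphJ n h0)
  rw [← h2.unique h1, besselInt_eq n h0, lam, ← hκ, (hasDerivAt_sphJ n h0).deriv]
  have hw := sphJ_succ_mul_sphH_sub n h0
  have hI := I_sq
  have hkR : k ^ 2 * (R : ℂ) ^ 2 = κ ^ 2 := by rw [hκ]; ring
  simp only [id, Pi.mul_apply]
  field_simp at hw ⊢
  linear_combination κ * (4 * I * hw + 4 * hI + 2 * I * (sphJ (n + 1) κ * sphH n κ -
    sphJ n κ * sphH (n + 1) κ) * hkR)

/-- The two expressions for the eigenvalues of `M` are related by the Wronskian. -/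
theorem m1_eq_neg_m2 {R : ℝ} (hR : 0 < R) {k : ℂ} (hk : k ≠ 0) {n : ℕ} (hn : 1 ≤ n) :
    m1 R k n = -m2 R k n := by
  obtain ⟨m, rfl⟩ : ∃ m, n = m + 1 := ⟨n - 1, by omega⟩
  have hRc : (R : ℂ) ≠ 0 := by exact_mod_cast hR.ne'
  set t := k * R with ht
  have h0 : t ≠ 0 := mul_ne_zero hk hRc
  have h1 := (hasDerivAt_sphJ (m + 1) h0).unique (hasDerivAt_sphJ_succ m h0)
  have h2 := (hasDerivAt_sphH (m + 1) h0).unique (hasDerivAt_sphH_succ m h0)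
  have hJ : sphJ (m + 2) t = (2 * m + 3) / t * sphJ (m + 1) t - sphJ m t := by
    push_cast at h1
    linear_combination (-1 : ℂ) * h1
  have hH : sphH (m + 2) t = (2 * m + 3) / t * sphH (m + 1) t - sphH m t := by
    push_cast at h2
    linear_combination (-1 : ℂ) * h2
  have hw := sphJ_succ_mul_sphH_sub m h0
  have hI := I_sq
  have h3 : (2 * m + 3 : ℂ) ≠ 0 := by exact_mod_cast (by omega : 2 * m + 3 ≠ 0)
  have hkt : k = t / R := by rw [ht]; field_simp
  simp only [m1, m2, pi1, sig1, sig3, lam, chi, Nat.add_sub_cancel, ← ht,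
    (hasDerivAt_sphJ m h0).deriv, (hasDerivAt_sphJ_succ m h0).deriv,
    (hasDerivAt_sphJ_succ (m + 1) h0).deriv]
  rw [show m + 1 + 1 = m + 2 from rfl, hJ, hH, hkt]
  have e : (1 : ℂ) + I * t ^ 2 * (sphJ (m + 1) t * sphH m t - sphJ m t * sphH (m + 1) t) = 0 := by
    rw [hw]
    field_simp
    linear_combination hI
  rw [eq_neg_iff_add_eq_zero, ← e]
  push_cast
  obtain ⟨d, hd⟩ : ∃ d : ℂ, d = 2 * m + 3 := ⟨_, rfl⟩
  have hm : (m : ℂ) = (d - 3) / 2 := by rw [hd]; ring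
  rw [← hd] at h3
  simp only [hm]
  rw [show 2 * ((d - 3) / 2 + 1) + 1 = d by ring]
  field_simp
  ring

/-! ### Weakly singular kernels on a sphere -/

/-- The Funk–Hecke formula for distance kernels on the sphere of radius `R`. -/
theorem funkHecke_surf {R : ℝ} (hR : 0 < R) {n : ℕ} {W : MvPolynomial (Fin 3) ℂ}
    (hW : W ∈ SphHarm n) {x : E3} (hx : ‖x‖ = R) {f : ℝ → ℂ}
    (hf : IntegrableOn (fun s : ℝ => s * f (R * s)) (Set.Ioc 0 2)) :
    Integrable (fun y => f ‖x - y‖ * evalP W y) (surfMeasure R) ∧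
    ∫ y, f ‖x - y‖ * evalP W y ∂surfMeasure R = R ^ 2 * (2 * Real.pi * evalP W x *
      ∫ s in (0 : ℝ)..2, s * f (R * s) * (legP n).eval ((1 - s ^ 2 / 2 : ℝ) : ℂ)) := by
  have hRc : (R : ℂ) ≠ 0 := by exact_mod_cast hR.ne'
  obtain ⟨u, hxu, hu1⟩ : ∃ u : E3, x = R • u ∧ ‖u‖ = 1 :=
    ⟨R⁻¹ • x, by rw [smul_smul, mul_inv_cancel₀ hR.ne', one_smul], by
      rw [norm_smul, hx, norm_inv, Real.norm_of_nonneg hR.le, inv_mul_cancel₀ hR.ne']⟩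
  have h := funkHecke_dist hW hu1 (f := fun s => f (R * s)) hf
  have e : ∀ y : E3, f ‖x - R • y‖ * evalP W (R • y) =
      R ^ n * (f (R * ‖u - y‖) * evalP W y) := fun y => by
    rw [hxu, ← smul_sub, norm_smul, Real.norm_of_nonneg hR.le, evalP_real_smul hW.1]
    ring
  constructor
  · rw [integrable_surf hR]
    simp only [e]
    exact h.1.const_mul _
  · rw [integral_surf hR]
    simp only [e]
    rw [integral_const_mul, h.2, hxu, evalP_real_smul hW.1, Complex.real_smul]
    push_cast
    ring

theorem integral_inv_dist {R : ℝ} (hR : 0 < R) {x : E3} (hx : ‖x‖ = R) :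
    Integrable (fun y => ‖x - y‖⁻¹) (surfMeasure R) ∧
      ∫ y, ‖x - y‖⁻¹ ∂surfMeasure R = 4 * Real.pi * R := by
  have hRc : (R : ℂ) ≠ 0 := by exact_mod_cast hR.ne'
  have hs : ∀ s ∈ Set.Ioc (0 : ℝ) 2, (s : ℂ) * (((R * s)⁻¹ : ℝ) : ℂ) = (R : ℂ)⁻¹ := fun s hs => by
    have : (s : ℂ) ≠ 0 := by exact_mod_cast hs.1.ne'
    push_cast
    field_simp
  have h := funkHecke_surf hR one_mem_SphHarm hx (f := fun s => ((s⁻¹ : ℝ) : ℂ))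
    ((integrableOn_const (C := (R : ℂ)⁻¹) (by simp)).congr_fun (fun s h => (hs s h).symm)
      measurableSet_Ioc)
  simp only [evalP_one, mul_one, legP, Polynomial.eval_one] at h
  have hI : ∫ s in (0 : ℝ)..2, (s : ℂ) * (((R * s)⁻¹ : ℝ) : ℂ) = 2 * (R : ℂ)⁻¹ := by
    rw [intervalIntegral.integral_of_le (by norm_num), setIntegral_congr_fun measurableSet_Ioc hs]
    simp
  rw [hI] at h
  refine ⟨?_, ?_⟩
  · refine h.1.re.congr (Filter.Eventually.of_forall fun y => ?_)
    simp
  · have h2 := h.2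
    rw [integral_complex_ofReal] at h2
    have h3 : ((R : ℂ) ^ 2 * (2 * Real.pi * (2 * (R : ℂ)⁻¹))) = ((4 * Real.pi * R : ℝ) : ℂ) := by
      push_cast
      field_simp
      ring
    rw [h3] at h2
    exact_mod_cast h2

theorem ae_ne {R : ℝ} (hR : 0 < R) (x : E3) (hx : ‖x‖ = R) : ∀ᵐ y ∂surfMeasure R, y ≠ x := by
  have h1 : ∀ u : E3, ‖u‖ = 1 → surfMeasure 1 {u} = 0 := by
    intro u hu
    have hinn : Measurable fun y : E3 => (inner ℝ u y : ℝ) :=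
      Continuous.measurable (by fun_prop)
    have h2 : (surfMeasure 1).map (fun y => (inner ℝ u y : ℝ)) {1} = 0 := by
      rw [map_inner_surfMeasure hu, Measure.smul_apply, Measure.restrict_apply (by simp)]
      have h3 : volume ({(1 : ℝ)} ∩ Set.Icc (-1) 1) = 0 :=
        measure_mono_null Set.inter_subset_left Real.volume_singleton
      rw [h3, smul_zero]
    rw [Measure.map_apply hinn (by simp)] at h2
    refine measure_mono_null ?_ h2
    rintro y rfl
    simp [hu]
  have hxu : x = R • (R⁻¹ • x) := by rw [smul_smul, mul_inv_cancel₀ hR.ne', one_smul]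
  have hu1 : ‖R⁻¹ • x‖ = 1 := by
    rw [norm_smul, hx, norm_inv, Real.norm_of_nonneg hR.le, inv_mul_cancel₀ hR.ne']
  rw [ae_iff, surfMeasure_eq_map]
  have h4 : {a : E3 | ¬a ≠ x} = {x} := by ext; simp
  rw [h4, Measure.smul_apply, (measurableEmbedding_smul hR).map_apply]
  have h5 : (fun y : E3 => R • y) ⁻¹' {x} = {R⁻¹ • x} := by
    ext y
    simp only [Set.mem_preimage, Set.mem_singleton_iff]
    rw [eq_inv_smul_iff₀ hR.ne']
  rw [h5, h1 _ hu1, smul_zero]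

/-! ### The fundamental solution as a radial function -/

/-- The radial profile of the fundamental solution. -/
def gRad (k : ℂ) (r : ℝ) : ℂ := -(exp (I * k * r) / (4 * Real.pi * r))

/-- `g'(r) / r` for the radial profile `g` of the fundamental solution. -/
def gRad' (k : ℂ) (r : ℝ) : ℂ := -((I * k * r - 1) * exp (I * k * r) / (4 * Real.pi * r ^ 3))

/-- The kernel `ν_x · ∇_x G` on the sphere of radius `R`, as a function of the distance. -/
def gNormal (R : ℝ) (k : ℂ) (r : ℝ) : ℂ := gRad' k r * (r ^ 2 / (2 * R))

theorem G_eq_gRad (k : ℂ) (x y : E3) : G k x y = gRad k ‖x - y‖ := rfl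

theorem pi_ne_zero_complex : (Real.pi : ℂ) ≠ 0 := by exact_mod_cast Real.pi_ne_zero

/-- The spherical harmonics of degree `n` are eigenfunctions of the single layer operator. -/
theorem integral_G {R : ℝ} (hR : 0 < R) {k : ℂ} (hk : k ≠ 0) {n : ℕ} {W : MvPolynomial (Fin 3) ℂ}
    (hW : W ∈ SphHarm n) {x : E3} (hx : ‖x‖ = R) :
    Integrable (fun y => G k x y * evalP W y) (surfMeasure R) ∧
    ∫ y, G k x y * evalP W y ∂surfMeasure R = chi R k n * evalP W x := by
  have hRc : (R : ℂ) ≠ 0 := by exact_mod_cast hR.ne'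
  have hpi := pi_ne_zero_complex
  have hs : ∀ s ∈ Set.Ioc (0 : ℝ) 2, (s : ℂ) * gRad k (R * s) =
      -(4 * Real.pi * R : ℂ)⁻¹ * exp (I * (k * R) * s) := fun s hs => by
    have : (s : ℂ) ≠ 0 := by exact_mod_cast hs.1.ne'
    rw [gRad]
    push_cast
    rw [show I * k * (R * s) = I * (k * R) * s by ring]
    field_simp
  have h := funkHecke_surf hR hW hx (f := gRad k)
    ((Continuous.integrableOn_Ioc (f := fun s : ℝ => -(4 * Real.pi * R : ℂ)⁻¹ *
      exp (I * (k * R) * s)) (by fun_prop)).congr_fun (fun s h => (hs s h).symm) measurableSet_Ioc)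
  refine ⟨h.1, ?_⟩
  rw [show ∫ y, G k x y * evalP W y ∂surfMeasure R =
    ∫ y, gRad k ‖x - y‖ * evalP W y ∂surfMeasure R from rfl, h.2, chi_eq_besselInt hR hk]
  have hI : ∫ s in (0 : ℝ)..2, (s : ℂ) * gRad k (R * s) * (legP n).eval ((1 - s ^ 2 / 2 : ℝ) : ℂ) =
      -(4 * Real.pi * R : ℂ)⁻¹ * besselInt n (k * R) := by
    rw [besselInt, ← intervalIntegral.integral_const_mul,
      intervalIntegral.integral_of_le (by norm_num), intervalIntegral.integral_of_le (by norm_num)]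
    refine setIntegral_congr_fun measurableSet_Ioc fun s h => ?_
    simp only [hs s h]
    ring
  rw [hI]
  field_simp
  ring

/-- The spherical harmonics of degree `n` are eigenfunctions of the (adjoint) double layer
operator. -/
theorem integral_gNormal {R : ℝ} (hR : 0 < R) {k : ℂ} (hk : k ≠ 0) {n : ℕ}
    {W : MvPolynomial (Fin 3) ℂ} (hW : W ∈ SphHarm n) {x : E3} (hx : ‖x‖ = R) :
    Integrable (fun y => gNormal R k ‖x - y‖ * evalP W y) (surfMeasure R) ∧
    ∫ y, gNormal R k ‖x - y‖ * evalP W y ∂surfMeasure R = lam R k n * evalP W x := by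
  have hRc : (R : ℂ) ≠ 0 := by exact_mod_cast hR.ne'
  have hpi := pi_ne_zero_complex
  have hs : ∀ s ∈ Set.Ioc (0 : ℝ) 2, (s : ℂ) * gNormal R k (R * s) =
      (8 * Real.pi * R ^ 2 : ℂ)⁻¹ * (exp (I * (k * R) * s)) -
      (k * R) * (8 * Real.pi * R ^ 2 : ℂ)⁻¹ * (I * s * exp (I * (k * R) * s)) := fun s hs => by
    have : (s : ℂ) ≠ 0 := by exact_mod_cast hs.1.ne'
    rw [gNormal, gRad']
    push_cast
    rw [show I * k * (R * s) = I * (k * R) * s by ring]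
    field_simp
    ring
  have h := funkHecke_surf hR hW hx (f := gNormal R k)
    ((Continuous.integrableOn_Ioc (f := fun s : ℝ =>
      (8 * Real.pi * R ^ 2 : ℂ)⁻¹ * (exp (I * (k * R) * s)) -
      (k * R) * (8 * Real.pi * R ^ 2 : ℂ)⁻¹ * (I * s * exp (I * (k * R) * s)))
      (by fun_prop)).congr_fun (fun s h => (hs s h).symm) measurableSet_Ioc)
  refine ⟨h.1, ?_⟩
  rw [h.2, lam_eq_besselInt hR hk]
  have hc := continuous_legP_comp (legP n)
  have hI : ∫ s in (0 : ℝ)..2, (s : ℂ) * gNormal R k (R * s) *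
      (legP n).eval ((1 - s ^ 2 / 2 : ℝ) : ℂ) =
      (8 * Real.pi * R ^ 2 : ℂ)⁻¹ * besselInt n (k * R) -
      (k * R) * (8 * Real.pi * R ^ 2 : ℂ)⁻¹ * besselInt' n (k * R) := by
    rw [besselInt, besselInt', ← intervalIntegral.integral_const_mul,
      ← intervalIntegral.integral_const_mul, ← intervalIntegral.integral_sub
        (Continuous.intervalIntegrable (by fun_prop) _ _)
        (Continuous.intervalIntegrable (by fun_prop) _ _),
      intervalIntegral.integral_of_le (by norm_num), intervalIntegral.integral_of_le (by norm_num)]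
    refine setIntegral_congr_fun measurableSet_Ioc fun s h => ?_
    simp only [hs s h]
    ring
  rw [hI]
  field_simp
  ring

theorem hasDerivAt_gRad (k : ℂ) {r : ℝ} (hr : r ≠ 0) : HasDerivAt (gRad k) (gRad' k r * r) r := by
  have hrc : (r : ℂ) ≠ 0 := by exact_mod_cast hr
  have hpi := pi_ne_zero_complex
  have h0 : HasDerivAt (fun s : ℝ => (s : ℂ)) 1 r := Complex.ofRealCLM.hasDerivAt
  have h1 : HasDerivAt (fun s : ℝ => exp (I * k * s)) (exp (I * k * r) * (I * k)) r := by
    simpa using (h0.const_mul (I * k)).cexp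
  have h2 := (h1.div (h0.const_mul (4 * Real.pi : ℂ)) (by simp [hpi, hrc])).neg
  refine h2.congr_deriv ?_
  rw [gRad']
  field_simp

theorem contDiffOn_gRad (k : ℂ) : ContDiffOn ℝ 1 (gRad k) (Set.Ioi 0) := by
  unfold gRad
  have hof : ContDiff ℝ 1 fun s : ℝ => (s : ℂ) := Complex.ofRealCLM.contDiff
  have h1 : ContDiff ℝ 1 fun s : ℝ => exp (I * k * s) := (contDiff_const.mul hof).cexp
  have h2 : ContDiff ℝ 1 fun s : ℝ => 4 * (Real.pi : ℂ) * s := contDiff_const.mul hof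
  simp only [div_eq_mul_inv]
  refine (h1.contDiffOn.mul (h2.contDiffOn.inv fun r hr => ?_)).neg
  have hrc : (r : ℂ) ≠ 0 := by exact_mod_cast (ne_of_gt hr)
  simp [hrc]

theorem continuousOn_gRad' (k : ℂ) : ContinuousOn (gRad' k) (Set.Ioi 0) := by
  unfold gRad'
  refine (ContinuousOn.div (by fun_prop) (by fun_prop) ?_).neg
  intro r hr
  have hrc : (r : ℂ) ≠ 0 := by exact_mod_cast (ne_of_gt hr)
  simp [hrc]

theorem norm_exp_le (k : ℂ) {r B : ℝ} (hr : 0 ≤ r) (hB : r ≤ B) :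
    ‖exp (I * k * r)‖ ≤ Real.exp (‖k‖ * B) := by
  refine (Complex.norm_exp_le_exp_norm _).trans (Real.exp_le_exp.2 ?_)
  rw [norm_mul, norm_mul, Complex.norm_I, one_mul, Complex.norm_real, Real.norm_of_nonneg hr]
  gcongr

theorem norm_gRad_le (k : ℂ) {r B : ℝ} (hr : 0 < r) (hB : r ≤ B) :
    ‖gRad k r‖ ≤ Real.exp (‖k‖ * B) * r⁻¹ := by
  have h := norm_exp_le k hr.le hB
  rw [gRad, norm_neg, norm_div, norm_mul, norm_mul, Complex.norm_real, Complex.norm_real,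
    Real.norm_of_nonneg Real.pi_pos.le, Real.norm_of_nonneg hr.le, Complex.norm_ofNat,
    ← div_eq_mul_inv]
  have h4 : 1 ≤ 4 * Real.pi := by linarith [Real.pi_gt_three]
  gcongr
  nlinarith

theorem norm_gRad'_le (k : ℂ) {r B : ℝ} (hr : 0 < r) (hB : r ≤ B) :
    ‖gRad' k r‖ ≤ (‖k‖ * B + 1) * Real.exp (‖k‖ * B) * (r⁻¹) ^ 3 := by
  have h := norm_exp_le k hr.le hB
  have h1 : ‖I * k * r - 1‖ ≤ ‖k‖ * B + 1 := by
    refine (norm_sub_le _ _).trans ?_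
    rw [norm_mul, norm_mul, Complex.norm_I, one_mul, Complex.norm_real, Real.norm_of_nonneg hr.le,
      norm_one]
    gcongr
  have hB0 : 0 ≤ B := hr.le.trans hB
  rw [gRad', norm_neg, norm_div, norm_mul, norm_mul, norm_mul, norm_pow, Complex.norm_real,
    Complex.norm_real, Real.norm_of_nonneg Real.pi_pos.le, Real.norm_of_nonneg hr.le,
    Complex.norm_ofNat, inv_pow, ← div_eq_mul_inv]
  have h4 : 1 ≤ 4 * Real.pi := by linarith [Real.pi_gt_three]
  have h5 : 0 < r ^ 3 := by positivity
  gcongr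
  nlinarith

/-! ### Integration by parts against the fundamental solution -/

/-- The distance, regularised by `ε`. -/
def regDist (ε : ℝ) (x y : E3) : ℝ := √(‖x - y‖ ^ 2 + ε ^ 2)

theorem regDist_pos {ε : ℝ} (hε : 0 < ε) (x y : E3) : 0 < regDist ε x y :=
  Real.sqrt_pos.2 (by positivity)

theorem le_regDist (ε : ℝ) (x y : E3) : ‖x - y‖ ≤ regDist ε x y :=
  Real.le_sqrt_of_sq_le (by nlinarith [sq_nonneg ε])

theorem regDist_le {ε : ℝ} (hε : 0 ≤ ε) (x y : E3) : regDist ε x y ≤ ‖x - y‖ + ε :=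
  Real.sqrt_le_iff.2 ⟨by positivity, by nlinarith [norm_nonneg (x - y)]⟩

theorem contDiff_regDist {ε : ℝ} (hε : 0 < ε) (x : E3) : ContDiff ℝ 1 fun y => regDist ε x y := by
  unfold regDist
  refine ContDiff.sqrt ?_ fun y => by positivity
  exact ((contDiff_const.sub contDiff_id).norm_sq ℝ).add contDiff_const

theorem pd_eq_of_hasDerivAt {f : E3 → ℂ} {x : E3} (hf : DifferentiableAt ℝ f x) {i : Fin 3} {d : ℂ}
    (h : HasDerivAt (fun t : ℝ => f (x + t • EuclideanSpace.single i (1 : ℝ))) d 0) :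
    pd i f x = d := by
  have h1 : HasDerivAt (fun t : ℝ => x + t • EuclideanSpace.single i (1 : ℝ))
      (EuclideanSpace.single i (1 : ℝ)) 0 := by
    simpa using ((hasDerivAt_id (0 : ℝ)).smul_const (EuclideanSpace.single i (1 : ℝ))).const_add x
  have h2 : HasFDerivAt f (fderiv ℝ f x) (x + (0 : ℝ) • EuclideanSpace.single i (1 : ℝ)) := by
    simpa using hf.hasFDerivAt
  exact (HasFDerivAt.comp_hasDerivAt (f := fun t : ℝ => x + t • EuclideanSpace.single i (1 : ℝ)) 0
    h2 h1).unique h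

theorem hasDerivAt_regDist {ε : ℝ} (x y : E3) (h : regDist ε x y ≠ 0) (i : Fin 3) :
    HasDerivAt (fun t : ℝ => regDist ε x (y + t • EuclideanSpace.single i (1 : ℝ)))
      ((y i - x i) / regDist ε x y) 0 := by
  have h1 : HasDerivAt (fun t : ℝ => x - (y + t • EuclideanSpace.single i (1 : ℝ)))
      (-EuclideanSpace.single i (1 : ℝ)) 0 := by
    simpa using (((hasDerivAt_id (0 : ℝ)).smul_const
      (EuclideanSpace.single i (1 : ℝ))).const_add y).const_sub x
  have h0 : ‖x - y‖ ^ 2 + ε ^ 2 ≠ 0 := by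
    intro h0
    exact h (by rw [regDist, h0, Real.sqrt_zero])
  have h2 := (h1.norm_sq.add_const (ε ^ 2)).sqrt (by simpa using h0)
  refine h2.congr_deriv ?_
  simp [regDist, EuclideanSpace.inner_single_right]
  field_simp

theorem contDiff_gRad_regDist (k : ℂ) {ε : ℝ} (hε : 0 < ε) (x : E3) :
    ContDiff ℝ 1 fun y => gRad k (regDist ε x y) := by
  rw [← contDiffOn_univ]
  exact (contDiffOn_gRad k).comp (contDiff_regDist hε x).contDiffOn
    fun y _ => regDist_pos hε x y

theorem pd_gRad_regDist (k : ℂ) {ε : ℝ} (hε : 0 < ε) (x y : E3) (i : Fin 3) :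
    pd i (fun y => gRad k (regDist ε x y)) y =
      gRad' k (regDist ε x y) * ((y i : ℂ) - x i) := by
  refine pd_eq_of_hasDerivAt ((contDiff_gRad_regDist k hε x).differentiable one_ne_zero y) ?_
  have hp := (regDist_pos hε x y).ne'
  have hd : HasDerivAt (gRad k) (gRad' k (regDist ε x y) * regDist ε x y)
      (regDist ε x (y + (0 : ℝ) • EuclideanSpace.single i (1 : ℝ))) := by
    simpa using hasDerivAt_gRad k hp
  have h := HasDerivAt.scomp (h := fun t : ℝ =>
    regDist ε x (y + t • EuclideanSpace.single i (1 : ℝ))) 0 hd (hasDerivAt_regDist x y hp i)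
  refine h.congr_deriv ?_
  have hpc : (regDist ε x y : ℂ) ≠ 0 := by exact_mod_cast hp
  rw [Complex.real_smul]
  push_cast
  field_simp

theorem pd_gRad_dist (k : ℂ) {x y : E3} (hxy : x ≠ y) (i : Fin 3) :
    DifferentiableAt ℝ (fun z => G k z y) x ∧
    pd i (fun z => G k z y) x = gRad' k ‖x - y‖ * ((x i : ℂ) - y i) := by
  have hn : ‖x - y‖ ≠ 0 := norm_ne_zero_iff.2 (sub_ne_zero.2 hxy)
  have hr : ∀ z, regDist 0 y z = ‖z - y‖ := fun z => by
    rw [regDist, norm_sub_rev]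
    simp
  have hdiff : DifferentiableAt ℝ (fun z => G k z y) x := by
    have h1 : DifferentiableAt ℝ (fun z : E3 => ‖z - y‖) x :=
      (differentiableAt_id.sub_const y).norm ℝ (sub_ne_zero.2 hxy)
    exact DifferentiableAt.comp x (g := gRad k) (hasDerivAt_gRad k hn).differentiableAt h1
  refine ⟨hdiff, pd_eq_of_hasDerivAt hdiff ?_⟩
  have hp : regDist 0 y x ≠ 0 := by rwa [hr]
  have hd : HasDerivAt (gRad k) (gRad' k (regDist 0 y x) * regDist 0 y x)
      (regDist 0 y (x + (0 : ℝ) • EuclideanSpace.single i (1 : ℝ))) := by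
    simpa using hasDerivAt_gRad k hp
  have h := HasDerivAt.scomp (h := fun t : ℝ =>
    regDist 0 y (x + t • EuclideanSpace.single i (1 : ℝ))) 0 hd (hasDerivAt_regDist y x hp i)
  simp only [Function.comp_def, hr] at h
  refine h.congr_deriv ?_
  have hpc : (‖x - y‖ : ℂ) ≠ 0 := by exact_mod_cast hn
  rw [Complex.real_smul]
  push_cast
  field_simp

theorem abs_coord_sub_le (x y : E3) (i : Fin 3) : |x i - y i| ≤ ‖x - y‖ := by
  have h := PiLp.norm_apply_le (x - y) i
  simpa using h

theorem norm_wedge_le {R : ℝ} {x : E3} (hx : ‖x‖ = R) (y : E3) (i j : Fin 3) :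
    ‖(x i : ℂ) * y j - x j * y i‖ ≤ 2 * R * ‖x - y‖ := by
  have h1 : (x i : ℂ) * y j - x j * y i = ((x j * (x i - y i) - x i * (x j - y j) : ℝ) : ℂ) := by
    push_cast
    ring
  have hxi : ∀ l, |x l| ≤ R := fun l => by
    have h := PiLp.norm_apply_le x l
    rwa [hx, Real.norm_eq_abs] at h
  have hR : 0 ≤ R := hx ▸ norm_nonneg x
  rw [h1, Complex.norm_real, Real.norm_eq_abs]
  refine (abs_sub _ _).trans ?_
  rw [abs_mul, abs_mul]
  have h2 := mul_le_mul (hxi j) (abs_coord_sub_le x y i) (abs_nonneg _) hR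
  have h3 := mul_le_mul (hxi i) (abs_coord_sub_le x y j) (abs_nonneg _) hR
  linarith

/-- Integration by parts along a rotation, against the fundamental solution. The function `p`
vanishes at the singularity, so that both integrals converge. -/
theorem integral_rot_G {R : ℝ} (hR : 0 < R) (k : ℂ) {x : E3} (hx : ‖x‖ = R)
    {p : E3 → ℂ} (hp : ContDiff ℝ 1 p) {C : ℝ} (hC : ∀ y, ‖y‖ = R → ‖p y‖ ≤ C * ‖x - y‖)
    (i j : Fin 3) :
    Integrable (fun y => gRad' k ‖x - y‖ * ((x i : ℂ) * y j - x j * y i) * p y) (surfMeasure R) ∧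
    ∫ y, gRad' k ‖x - y‖ * ((x i : ℂ) * y j - x j * y i) * p y ∂surfMeasure R =
      -∫ y, G k x y * ((y i : ℂ) * pd j p y - y j * pd i p y) ∂surfMeasure R := by
  set B : ℝ := 2 * R + 1 with hB
  set L : E3 → ℂ := fun y => (y i : ℂ) * pd j p y - y j * pd i p y with hL
  have hcx : ∀ j : Fin 3, Continuous fun x : E3 => ((x j : ℝ) : ℂ) := fun j =>
    Complex.continuous_ofReal.comp (EuclideanSpace.proj j : E3 →L[ℝ] ℝ).continuous
  have hpd : ∀ l, Continuous fun y => pd l p y := fun l =>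
    (hp.continuous_fderiv one_ne_zero).clm_apply continuous_const
  have hLc : Continuous L := by
    have := hcx i
    have := hcx j
    have := hpd i
    have := hpd j
    fun_prop
  obtain ⟨D, hD⟩ := (isCompact_sphere (0 : E3) R).exists_bound_of_continuousOn hLc.continuousOn
  have hinv := (integral_inv_dist hR hx).1
  set ε : ℕ → ℝ := fun m => 1 / ((m : ℝ) + 1) with hε
  have hεpos : ∀ m, 0 < ε m := fun m => by positivity
  have hεle : ∀ m, ε m ≤ 1 := fun m => by
    rw [hε, div_le_one (by positivity)]
    linarith [m.cast_nonneg (α := ℝ)]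
  have hεlim : Filter.Tendsto ε Filter.atTop (nhds 0) := tendsto_one_div_add_atTop_nhds_zero_nat
  have hρlim : ∀ y, Filter.Tendsto (fun m => regDist (ε m) x y) Filter.atTop (nhds ‖x - y‖) := by
    intro y
    have h1 : Continuous fun e : ℝ => regDist e x y := by unfold regDist; fun_prop
    have h2 := (h1.tendsto 0).comp hεlim
    simpa [regDist, Function.comp_def] using h2
  have hρB : ∀ m y, ‖y‖ = R → regDist (ε m) x y ≤ B := by
    intro m y hy
    have h1 := regDist_le (hεpos m).le x y
    have h2 := norm_sub_le x y
    rw [hx, hy] at h2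
    linarith [hεle m]
  -- the regularised identity
  have hreg : ∀ m, ∫ y, gRad' k (regDist (ε m) x y) * ((x i : ℂ) * y j - x j * y i) * p y
      ∂surfMeasure R + ∫ y, gRad k (regDist (ε m) x y) * L y ∂surfMeasure R = 0 := by
    intro m
    have hg := contDiff_gRad_regDist k (hεpos m) x
    have h1 := integral_rot_eq_zero hR i j (hg.mul hp)
    have hρc : Continuous fun y => regDist (ε m) x y := (contDiff_regDist (hεpos m) x).continuous
    have hg' : Continuous fun y => gRad' k (regDist (ε m) x y) :=
      (continuousOn_gRad' k).comp_continuous hρc fun y => regDist_pos (hεpos m) x y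
    rw [← integral_add, ← h1]
    · refine integral_congr_ae (Filter.Eventually.of_forall fun y => ?_)
      have hprod : ∀ l, pd l (fun y => gRad k (regDist (ε m) x y) * p y) y =
          gRad k (regDist (ε m) x y) * pd l p y +
            gRad' k (regDist (ε m) x y) * ((y l : ℂ) - x l) * p y := by
        intro l
        have h2 := pd_gRad_regDist k (hεpos m) x y l
        rw [pd] at h2
        rw [pd, fderiv_fun_mul (hg.differentiable one_ne_zero y) (hp.differentiable one_ne_zero y)]
        simp only [_root_.add_apply, _root_.smul_apply, smul_eq_mul, h2]
        rw [pd]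
        ring
      simp only [hprod, hL]
      ring
    · refine integrable_of_continuous hR.le ?_
      have := hcx i
      have := hcx j
      have := hp.continuous
      fun_prop
    · refine integrable_of_continuous hR.le ?_
      have := hg.continuous
      fun_prop
  have hne := ae_ne hR x hx
  have hnorm := ae_norm_eq hR.le
  set K : ℝ := (‖k‖ * B + 1) * Real.exp (‖k‖ * B) with hK
  have hK0 : 0 ≤ K := by positivity
  -- the limit of the first term
  have hbound1 : ∀ ρ y, ‖y‖ = R → y ≠ x → ‖x - y‖ ≤ ρ → ρ ≤ B →
      ‖gRad' k ρ * ((x i : ℂ) * y j - x j * y i) * p y‖ ≤ K * (2 * R) * C * ‖x - y‖⁻¹ := by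
    intro ρ y hy hyx hρ1 hρ2
    have hr : 0 < ‖x - y‖ := norm_pos_iff.2 (sub_ne_zero.2 hyx.symm)
    have h1 := norm_gRad'_le k (hr.trans_le hρ1) hρ2
    have h2 : (ρ⁻¹) ^ 3 ≤ (‖x - y‖⁻¹) ^ 3 :=
      pow_le_pow_left₀ (inv_nonneg.2 (hr.le.trans hρ1)) (inv_anti₀ hr hρ1) 3
    rw [norm_mul, norm_mul]
    calc _ ≤ (K * (‖x - y‖⁻¹) ^ 3) * (2 * R * ‖x - y‖) * (C * ‖x - y‖) := by
          have hC' := hC y hy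
          have h3 := norm_wedge_le hx y i j
          have h4 : ‖gRad' k ρ‖ ≤ K * (‖x - y‖⁻¹) ^ 3 :=
            h1.trans (mul_le_mul_of_nonneg_left h2 hK0)
          gcongr
      _ = _ := by field_simp
  have hmeasx : AEStronglyMeasurable
      (fun y => gRad' k ‖x - y‖ * ((x i : ℂ) * y j - x j * y i) * p y) (surfMeasure R) := by
    have h1 : Measurable (gRad' k) := by unfold gRad'; fun_prop
    have h2 : Measurable fun y : E3 => gRad' k ‖x - y‖ := h1.comp (by fun_prop)
    have := (hcx i).measurable
    have := (hcx j).measurable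
    have := hp.continuous.measurable
    exact Measurable.aestronglyMeasurable (by fun_prop)
  have hlim1 : Filter.Tendsto (fun m => ∫ y, gRad' k (regDist (ε m) x y) *
      ((x i : ℂ) * y j - x j * y i) * p y ∂surfMeasure R) Filter.atTop
      (nhds (∫ y, gRad' k ‖x - y‖ * ((x i : ℂ) * y j - x j * y i) * p y ∂surfMeasure R)) := by
    refine tendsto_integral_of_dominated_convergence
      (fun y => K * (2 * R) * C * ‖x - y‖⁻¹) (fun m => ?_) (hinv.const_mul _) (fun m => ?_) ?_
    · have hρc : Continuous fun y => regDist (ε m) x y := (contDiff_regDist (hεpos m) x).continuous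
      have hg' : Continuous fun y => gRad' k (regDist (ε m) x y) :=
        (continuousOn_gRad' k).comp_continuous hρc fun y => regDist_pos (hεpos m) x y
      have := hcx i
      have := hcx j
      have := hp.continuous
      exact Continuous.aestronglyMeasurable (by fun_prop)
    · filter_upwards [hne, hnorm] with y hyx hy
      exact hbound1 _ y hy hyx (le_regDist _ x y) (hρB m y hy)
    · filter_upwards [hne] with y hyx
      have hr : 0 < ‖x - y‖ := norm_pos_iff.2 (sub_ne_zero.2 hyx.symm)
      have h1 : ContinuousAt (gRad' k) ‖x - y‖ :=
        (continuousOn_gRad' k).continuousAt (Ioi_mem_nhds hr)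
      exact ((h1.tendsto.comp (hρlim y)).mul_const _).mul_const _
  have hlim2 : Filter.Tendsto (fun m => ∫ y, gRad k (regDist (ε m) x y) * L y ∂surfMeasure R)
      Filter.atTop (nhds (∫ y, G k x y * L y ∂surfMeasure R)) := by
    refine tendsto_integral_of_dominated_convergence
      (fun y => Real.exp (‖k‖ * B) * D * ‖x - y‖⁻¹) (fun m => ?_) (hinv.const_mul _) (fun m => ?_) ?_
    · have hg := contDiff_gRad_regDist k (hεpos m) x
      exact (hg.continuous.mul hLc).aestronglyMeasurable
    · filter_upwards [hne, hnorm] with y hyx hy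
      have hr : 0 < ‖x - y‖ := norm_pos_iff.2 (sub_ne_zero.2 hyx.symm)
      have hρ := le_regDist (ε m) x y
      have h1 := norm_gRad_le k (hr.trans_le hρ) (hρB m y hy)
      have h2 : (regDist (ε m) x y)⁻¹ ≤ ‖x - y‖⁻¹ := inv_anti₀ hr hρ
      have h3 := hD y (by simp [hy])
      rw [norm_mul]
      calc _ ≤ (Real.exp (‖k‖ * B) * ‖x - y‖⁻¹) * D := by
            have h4 : ‖gRad k (regDist (ε m) x y)‖ ≤ Real.exp (‖k‖ * B) * ‖x - y‖⁻¹ :=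
              h1.trans (mul_le_mul_of_nonneg_left h2 (Real.exp_pos _).le)
            gcongr
        _ = _ := by ring
    · filter_upwards [hne] with y hyx
      have hr : 0 < ‖x - y‖ := norm_pos_iff.2 (sub_ne_zero.2 hyx.symm)
      have h1 : ContinuousAt (gRad k) ‖x - y‖ := (hasDerivAt_gRad k hr.ne').continuousAt
      exact (h1.tendsto.comp (hρlim y)).mul_const _
  refine ⟨?_, ?_⟩
  · refine Integrable.mono' (hinv.const_mul (K * (2 * R) * C)) hmeasx ?_
    filter_upwards [hne, hnorm] with y hyx hy
    refine hbound1 _ y hy hyx le_rfl ?_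
    have h2 := norm_sub_le x y
    rw [hx, hy] at h2
    linarith
  · have h := hlim1.add hlim2
    simp only [hreg] at h
    exact eq_neg_of_add_eq_zero_left (tendsto_nhds_unique h tendsto_const_nhds)

/-! ### The operator `M` on polynomial tangential fields -/

theorem normal_apply {R : ℝ} {x : E3} (hx : ‖x‖ = R) (i : Fin 3) :
    normal x i = (x i : ℂ) / R := by
  simp [normal, toC, hx]
  ring

theorem toC_apply (x : E3) (i : Fin 3) : toC x i = (x i : ℂ) := rfl

/-- The kernel of `M`, written out. -/
def mKer (k : ℂ) (x y : E3) (v : C3) : C3 :=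
  WithLp.toLp 2 fun i => gRad' k ‖x - y‖ *
    (dot (normal x) v * ((x i : ℂ) - y i) - dot (normal x) (toC (x - y)) * v i)

theorem mKer_apply (k : ℂ) (x y : E3) (v : C3) (i : Fin 3) : mKer k x y v i = gRad' k ‖x - y‖ *
    (dot (normal x) v * ((x i : ℂ) - y i) - dot (normal x) (toC (x - y)) * v i) := rfl

/-- The double vector product in the kernel of `M`, expanded. -/
theorem cross_curl_eq (k : ℂ) {x y : E3} (hxy : x ≠ y) (v : C3) :
    cross (normal x) (curl (fun z => G k z y • v) x) = mKer k x y v := by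
  have h : ∀ i l : Fin 3, pd i (fun z => (G k z y • v) l) x =
      gRad' k ‖x - y‖ * ((x i : ℂ) - y i) * v l := by
    intro i l
    have hd := pd_gRad_dist k hxy i
    have h1 : (fun z => (G k z y • v) l) = fun z => G k z y * v l := by
      funext z
      simp
    rw [h1, pd, fderiv_mul_const hd.1, ← hd.2]
    simp [pd, mul_comm]
  simp only [curl, h]
  ext i
  fin_cases i <;> simp [cross, crossProduct, mKer, dot, Fin.sum_univ_three, toC] <;> ring

theorem mKer_smul (k c : ℂ) (x y : E3) (v : C3) : mKer k x y (c • v) = c • mKer k x y v := by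
  ext i
  simp only [mKer_apply, PiLp.smul_apply, smul_eq_mul, dot, Fin.sum_univ_three]
  ring

/-- The vector field on `ℝ³` with polynomial components. -/
def polyField (Φ : Fin 3 → MvPolynomial (Fin 3) ℂ) (y : E3) : C3 :=
  WithLp.toLp 2 fun i => evalP (Φ i) y

theorem polyField_apply (Φ : Fin 3 → MvPolynomial (Fin 3) ℂ) (y : E3) (i : Fin 3) :
    polyField Φ y i = evalP (Φ i) y := rfl

/-- On a sphere, `ν_x · (x - y)` is quadratic in the distance: this is why `ν · ∇G` is only weakly
singular. -/
theorem dot_normal_sub {R : ℝ} (hR : 0 < R) {x y : E3} (hx : ‖x‖ = R) (hy : ‖y‖ = R) :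
    dot (normal x) (toC (x - y)) = (‖x - y‖ : ℂ) ^ 2 / (2 * R) := by
  have hRc : (R : ℂ) ≠ 0 := by exact_mod_cast hR.ne'
  have h1 := sum_sq_eq x
  have h2 := sum_sq_eq y
  have h3 := sum_sq_eq (x - y)
  rw [hx] at h1
  rw [hy] at h2
  push_cast at h3
  rw [← h3]
  simp only [dot, normal_apply hx, toC_apply, Fin.sum_univ_three, PiLp.sub_apply] at h1 h2 ⊢
  push_cast at h1 h2 ⊢
  field_simp
  linear_combination h1 - h2

/-- The operator `M` on a tangential polynomial field `Φ`. The kernel is split into `ν · ∇G`, applied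
to the components and projected, and a remainder that carries the factor `x · Φ(y)`. That factor
vanishes at `y = x`, since `Φ` is tangential, so the remainder can be integrated by parts along
rotations. `Kv` and `Lv` are the resulting scalar potentials at `x`. -/
theorem integral_mKer_polyField {R : ℝ} (hR : 0 < R) (k : ℂ) {Φ : Fin 3 → MvPolynomial (Fin 3) ℂ}
    (htan : ∀ y : E3, ‖y‖ = R → ∑ l, (y l : ℂ) * evalP (Φ l) y = 0) {x : E3} (hx : ‖x‖ = R)
    {Kv : Fin 3 → ℂ} {Lv : Fin 3 → Fin 3 → Fin 3 → ℂ}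
    (hK : ∀ l, Integrable (fun y => gNormal R k ‖x - y‖ * evalP (Φ l) y) (surfMeasure R) ∧
      ∫ y, gNormal R k ‖x - y‖ * evalP (Φ l) y ∂surfMeasure R = Kv l)
    (hL : ∀ i j l, Integrable (fun y => G k x y * evalP (rot i j (Φ l)) y) (surfMeasure R) ∧
      ∫ y, G k x y * evalP (rot i j (Φ l)) y ∂surfMeasure R = Lv i j l) (i : Fin 3) :
    Integrable (fun y => mKer k x y (polyField Φ y) i) (surfMeasure R) ∧
    ∫ y, mKer k x y (polyField Φ y) i ∂surfMeasure R =
      (x i : ℂ) / R * ∑ l, (x l : ℂ) / R * Kv l - Kv i -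
        1 / (R : ℂ) ^ 3 * ∑ j, (x j : ℂ) * ∑ l, (x l : ℂ) * Lv i j l := by
  have hRc : (R : ℂ) ≠ 0 := by exact_mod_cast hR.ne'
  set P : MvPolynomial (Fin 3) ℂ := ∑ l, MvPolynomial.C (x l : ℂ) * Φ l with hP
  have hPe : ∀ y, evalP P y = ∑ l, (x l : ℂ) * evalP (Φ l) y := fun y => by simp [hP]
  have hrotP : ∀ (j : Fin 3) (y : E3), (y i : ℂ) * pd j (evalP P) y - y j * pd i (evalP P) y =
      ∑ l, (x l : ℂ) * evalP (rot i j (Φ l)) y := by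
    intro j y
    rw [pd_evalP, pd_evalP]
    simp only [hP, map_sum, MvPolynomial.pderiv_C_mul, evalP_sum, evalP_mul, evalP_C, rot,
      evalP_sub, evalP_X, Finset.mul_sum, ← Finset.sum_sub_distrib]
    exact Finset.sum_congr rfl fun l _ => by ring
  have hbd : ∃ C : ℝ, ∀ y, ‖y‖ = R → ‖evalP P y‖ ≤ C * ‖x - y‖ := by
    choose D hD0 hD using fun l => exists_bound_evalP (Φ l) R
    refine ⟨∑ l, D l, fun y hy => ?_⟩
    have h1 : evalP P y = ∑ l, ((x l - y l : ℝ) : ℂ) * evalP (Φ l) y := by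
      rw [hPe]
      have h2 := htan y hy
      simp only [Fin.sum_univ_three] at h2 ⊢
      push_cast
      linear_combination h2
    rw [h1, Finset.sum_mul]
    refine (norm_sum_le _ _).trans (Finset.sum_le_sum fun l _ => ?_)
    rw [norm_mul, Complex.norm_real, Real.norm_eq_abs, mul_comm]
    exact mul_le_mul (hD l y hy) (abs_coord_sub_le x y l) (abs_nonneg _) (hD0 l)
  obtain ⟨C, hC⟩ := hbd
  have hibp := fun j => integral_rot_G hR k hx
    ((contDiff_evalP P).of_le (by exact_mod_cast le_top)) hC i j
  have hS : ∀ j, ∫ y, G k x y * ((y i : ℂ) * pd j (evalP P) y - y j * pd i (evalP P) y)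
      ∂surfMeasure R = ∑ l, (x l : ℂ) * Lv i j l := by
    intro j
    have e : ∀ y, G k x y * ((y i : ℂ) * pd j (evalP P) y - y j * pd i (evalP P) y) =
        ∑ l, (x l : ℂ) * (G k x y * evalP (rot i j (Φ l)) y) := by
      intro y
      rw [hrotP, Finset.mul_sum]
      exact Finset.sum_congr rfl fun l _ => by ring
    simp only [e]
    rw [integral_finsetSum _ fun l _ => (hL i j l).1.const_mul _]
    exact Finset.sum_congr rfl fun l _ => by rw [integral_const_mul, (hL i j l).2]
  have hsplit : (fun y => mKer k x y (polyField Φ y) i) =ᵐ[surfMeasure R] fun y =>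
      ((x i : ℂ) / R * ∑ l, (x l : ℂ) / R * (gNormal R k ‖x - y‖ * evalP (Φ l) y) -
        gNormal R k ‖x - y‖ * evalP (Φ i) y) +
      1 / (R : ℂ) ^ 3 * ∑ j, (x j : ℂ) * (gRad' k ‖x - y‖ * ((x i : ℂ) * y j - x j * y i) *
        evalP P y) := by
    filter_upwards [ae_norm_eq hR.le] with y hy
    have h1 := sum_sq_eq x
    rw [hx] at h1
    rw [mKer_apply, dot_normal_sub hR hx hy, gNormal]
    have h2 := dot_normal_sub hR hx hy
    have h3 : dot (normal x) (polyField Φ y) = evalP P y / R := by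
      rw [hPe, dot, Finset.sum_div]
      exact Finset.sum_congr rfl fun l _ => by rw [normal_apply hx, polyField_apply]; ring
    rw [h3]
    have h4 : ∑ l, (x l : ℂ) / R * (gRad' k ‖x - y‖ * (‖x - y‖ ^ 2 / (2 * R)) * evalP (Φ l) y) =
        gRad' k ‖x - y‖ * (‖x - y‖ ^ 2 / (2 * R)) * (evalP P y / R) := by
      rw [hPe, Finset.sum_div, Finset.mul_sum]
      exact Finset.sum_congr rfl fun l _ => by ring
    rw [h4, polyField_apply]
    simp only [dot, normal_apply hx, toC_apply, Fin.sum_univ_three, PiLp.sub_apply] at h1 h2 ⊢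
    push_cast at h1 h2 ⊢
    rw [← h2]
    field_simp
    linear_combination -(gRad' k ‖x - y‖ * (x i - y i) * evalP P y) * h1
  have hI1 : Integrable (fun y => (x i : ℂ) / R * ∑ l, (x l : ℂ) / R *
      (gNormal R k ‖x - y‖ * evalP (Φ l) y) - gNormal R k ‖x - y‖ * evalP (Φ i) y)
      (surfMeasure R) :=
    ((integrable_finsetSum _ fun l _ => (hK l).1.const_mul _).const_mul _).sub (hK i).1
  have hI2 : Integrable (fun y => 1 / (R : ℂ) ^ 3 * ∑ j, (x j : ℂ) * (gRad' k ‖x - y‖ *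
      ((x i : ℂ) * y j - x j * y i) * evalP P y)) (surfMeasure R) :=
    (integrable_finsetSum _ fun j _ => (hibp j).1.const_mul _).const_mul _
  refine ⟨(hI1.add hI2).congr hsplit.symm, ?_⟩
  rw [integral_congr_ae hsplit, integral_add hI1 hI2, integral_sub
    ((integrable_finsetSum _ fun l _ => (hK l).1.const_mul _).const_mul _) (hK i).1,
    integral_const_mul, integral_const_mul, integral_finsetSum _ fun l _ => (hK l).1.const_mul _,
    integral_finsetSum _ fun j _ => (hibp j).1.const_mul _]
  simp only [integral_const_mul, (hK _).2, (hibp _).2, hS]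
  simp only [mul_neg, Finset.sum_neg_distrib]
  ring

/-! ### The polynomial fields behind the vector spherical harmonics -/

/-- The field `∇p × x`. -/
def curlP (p : MvPolynomial (Fin 3) ℂ) : Fin 3 → MvPolynomial (Fin 3) ℂ :=
  ![rot 2 1 p, rot 0 2 p, rot 1 0 p]

/-- The field `|x|² ∇p - n p x`. -/
def gradP (n : ℕ) (p : MvPolynomial (Fin 3) ℂ) (l : Fin 3) : MvPolynomial (Fin 3) ℂ :=
  r2 * MvPolynomial.pderiv l p - (n : ℂ) • (MvPolynomial.X l * p)

theorem curlP_mem {n : ℕ} {p : MvPolynomial (Fin 3) ℂ} (hp : p ∈ SphHarm n) (l : Fin 3) :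
    curlP p l ∈ SphHarm n := by
  fin_cases l <;> exact rot_mem hp _ _

theorem sum_X_mul_curlP (p : MvPolynomial (Fin 3) ℂ) : ∑ l, MvPolynomial.X l * curlP p l = 0 := by
  simp [Fin.sum_univ_three, curlP, rot]
  ring

theorem sum_X_mul_gradP {n : ℕ} {p : MvPolynomial (Fin 3) ℂ} (hp : p ∈ SphHarm n) :
    ∑ l, MvPolynomial.X l * gradP n p l = 0 := by
  have h := euler (mem_SphHarm.1 hp).1
  simp only [gradP, r2, Fin.sum_univ_three, ← MvPolynomial.C_mul', map_natCast] at h ⊢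
  linear_combination (MvPolynomial.X 0 ^ 2 + MvPolynomial.X 1 ^ 2 + MvPolynomial.X 2 ^ 2) * h

/-- For a tangential field, the rotation of the identity `x · Φ = 0`. -/
theorem sum_X_mul_rot {Φ : Fin 3 → MvPolynomial (Fin 3) ℂ}
    (h : ∑ l, MvPolynomial.X l * Φ l = 0) (i j : Fin 3) :
    ∑ l, MvPolynomial.X l * rot i j (Φ l) = MvPolynomial.X j * Φ i - MvPolynomial.X i * Φ j := by
  have hi := congrArg (MvPolynomial.pderiv i) h
  have hj := congrArg (MvPolynomial.pderiv j) h
  simp only [map_sum, Derivation.leibniz, MvPolynomial.pderiv_X, smul_eq_mul,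
    Finset.sum_add_distrib, map_zero, Pi.single_apply] at hi hj
  simp only [mul_ite, mul_one, mul_zero, Finset.sum_ite_eq', Finset.mem_univ,
    if_true] at hi hj
  simp only [rot, Fin.sum_univ_three] at hi hj ⊢
  linear_combination MvPolynomial.X i * hj - MvPolynomial.X j * hi

theorem evalP_tangential {Φ : Fin 3 → MvPolynomial (Fin 3) ℂ}
    (h : ∑ l, MvPolynomial.X l * Φ l = 0) (y : E3) : ∑ l, (y l : ℂ) * evalP (Φ l) y = 0 := by
  have := congrArg (fun q => evalP q y) h
  simpa using this

/-- The field `gradP` in terms of harmonic polynomials of degrees `n - 1` and `n + 1`. -/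
theorem gradP_eq {n : ℕ} (p : MvPolynomial (Fin 3) ℂ) (l : Fin 3) :
    gradP n p l = ((n + 1 : ℂ) / (2 * n + 1)) • (r2 * MvPolynomial.pderiv l p) +
      (-n : ℂ) • raise n l p := by
  have h := two_mul_add_one_ne_zero n
  rw [gradP, raise, smul_sub, smul_smul]
  have h1 : (-n : ℂ) * (2 * n + 1 : ℂ)⁻¹ = (n + 1) / (2 * n + 1) - 1 := by
    rw [eq_sub_iff_add_eq, ← div_eq_mul_inv, div_add_one h]
    ring
  rw [h1]
  module

theorem rot_r2_mul (i j : Fin 3) (q : MvPolynomial (Fin 3) ℂ) :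
    rot i j (r2 * q) = r2 * rot i j q := by
  simp only [rot, Derivation.leibniz, pderiv_r2, smul_eq_mul]
  ring

theorem rot_add (i j : Fin 3) (p q : MvPolynomial (Fin 3) ℂ) :
    rot i j (p + q) = rot i j p + rot i j q := by
  simp only [rot, map_add]
  ring

theorem rot_smul (i j : Fin 3) (c : ℂ) (q : MvPolynomial (Fin 3) ℂ) :
    rot i j (c • q) = c • rot i j q := by
  simp only [rot, Derivation.map_smul, smul_sub, mul_smul_comm]

/-- A kernel that is diagonal on the spherical harmonics, applied to a combination of two of
them. -/
theorem integral_combination {R : ℝ} (hR : 0 < R) {κ : E3 → ℂ} {c : ℕ → ℂ} {x : E3} (hx : ‖x‖ = R)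
    (h : ∀ m, ∀ W ∈ SphHarm m, Integrable (fun y => κ y * evalP W y) (surfMeasure R) ∧
      ∫ y, κ y * evalP W y ∂surfMeasure R = c m * evalP W x)
    {m m' : ℕ} {a b : MvPolynomial (Fin 3) ℂ} (ha : a ∈ SphHarm m) (hb : b ∈ SphHarm m') (α β : ℂ) :
    Integrable (fun y => κ y * evalP (α • (r2 * a) + β • b) y) (surfMeasure R) ∧
    ∫ y, κ y * evalP (α • (r2 * a) + β • b) y ∂surfMeasure R =
      α * c m * evalP (r2 * a) x + β * c m' * evalP b x := by
  have e : (fun y => α * R ^ 2 * (κ y * evalP a y) + β * (κ y * evalP b y)) =ᵐ[surfMeasure R]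
      fun y => κ y * evalP (α • (r2 * a) + β • b) y := by
    filter_upwards [ae_norm_eq hR.le] with y hy
    simp only [evalP_add, evalP_smul, evalP_mul, evalP_r2, hy]
    ring
  have h1 := (h m a ha).1.const_mul (α * R ^ 2)
  have h2 := (h m' b hb).1.const_mul β
  refine ⟨(h1.add h2).congr e, ?_⟩
  rw [← integral_congr_ae e, integral_add h1 h2, integral_const_mul, integral_const_mul,
    (h m a ha).2, (h m' b hb).2, evalP_mul, evalP_r2, hx]
  ring

/-- The coefficients by which a kernel with eigenvalues `c` acts on the field `gradP`. -/
theorem integral_gradP {R : ℝ} (hR : 0 < R) {κ : E3 → ℂ} {c : ℕ → ℂ} {x : E3} (hx : ‖x‖ = R)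
    (h : ∀ m, ∀ W ∈ SphHarm m, Integrable (fun y => κ y * evalP W y) (surfMeasure R) ∧
      ∫ y, κ y * evalP W y ∂surfMeasure R = c m * evalP W x)
    {n : ℕ} {p : MvPolynomial (Fin 3) ℂ} (hp : p ∈ SphHarm n) (l : Fin 3) :
    Integrable (fun y => κ y * evalP (gradP n p l) y) (surfMeasure R) ∧
    ∫ y, κ y * evalP (gradP n p l) y ∂surfMeasure R =
      ((n + 1) * c (n - 1) + n * c (n + 1)) / (2 * n + 1) * evalP (gradP n p l) x +
      n * (n + 1) * ((c (n - 1) - c (n + 1)) / (2 * n + 1)) * ((x l : ℂ) * evalP p x) := by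
  have hn := two_mul_add_one_ne_zero n
  have h1 := integral_combination hR hx h (pderiv_mem hp l) (raise_mem hp l)
    ((n + 1 : ℂ) / (2 * n + 1)) (-n)
  rw [← gradP_eq] at h1
  refine ⟨h1.1, ?_⟩
  rw [h1.2]
  simp only [gradP, raise, evalP_sub, evalP_smul, evalP_mul, evalP_X]
  obtain ⟨d, hd⟩ : ∃ d : ℂ, d = 2 * n + 1 := ⟨_, rfl⟩
  have hn' : (n : ℂ) = (d - 1) / 2 := by rw [hd]; ring
  rw [← hd] at hn ⊢
  rw [hn']
  field_simp
  ring

/-- The same for the derivatives of `gradP` along rotations. -/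
theorem integral_rot_gradP {R : ℝ} (hR : 0 < R) {κ : E3 → ℂ} {c : ℕ → ℂ} {x : E3} (hx : ‖x‖ = R)
    (h : ∀ m, ∀ W ∈ SphHarm m, Integrable (fun y => κ y * evalP W y) (surfMeasure R) ∧
      ∫ y, κ y * evalP W y ∂surfMeasure R = c m * evalP W x)
    {n : ℕ} {p : MvPolynomial (Fin 3) ℂ} (hp : p ∈ SphHarm n) (i j l : Fin 3) :
    Integrable (fun y => κ y * evalP (rot i j (gradP n p l)) y) (surfMeasure R) ∧
    ∫ y, κ y * evalP (rot i j (gradP n p l)) y ∂surfMeasure R =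
      ((n + 1) * c (n - 1) + n * c (n + 1)) / (2 * n + 1) * evalP (rot i j (gradP n p l)) x +
      n * (n + 1) * ((c (n - 1) - c (n + 1)) / (2 * n + 1)) *
        evalP (rot i j (MvPolynomial.X l * p)) x := by
  have hn := two_mul_add_one_ne_zero n
  have h1 := integral_combination hR hx h (rot_mem (pderiv_mem hp l) i j)
    (rot_mem (raise_mem hp l) i j) ((n + 1 : ℂ) / (2 * n + 1)) (-n)
  have e : ((n + 1 : ℂ) / (2 * n + 1)) • (r2 * rot i j (MvPolynomial.pderiv l p)) +
      (-n : ℂ) • rot i j (raise n l p) = rot i j (gradP n p l) := by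
    rw [gradP_eq, rot_add, rot_smul, rot_smul, rot_r2_mul]
  rw [e] at h1
  refine ⟨h1.1, ?_⟩
  rw [h1.2]
  have e1 : rot i j (gradP n p l) = r2 * rot i j (MvPolynomial.pderiv l p) +
      (-n : ℂ) • rot i j (MvPolynomial.X l * p) := by
    rw [gradP, sub_eq_add_neg, ← neg_smul, rot_add, rot_smul, rot_r2_mul]
  have e2 : rot i j (raise n l p) = rot i j (MvPolynomial.X l * p) +
      (-(2 * n + 1 : ℂ)⁻¹) • (r2 * rot i j (MvPolynomial.pderiv l p)) := by
    rw [raise, sub_eq_add_neg, ← neg_smul, rot_add, rot_smul, rot_r2_mul]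
  simp only [e1, e2, evalP_add, evalP_smul, evalP_mul]
  obtain ⟨d, hd⟩ : ∃ d : ℂ, d = 2 * n + 1 := ⟨_, rfl⟩
  have hn' : (n : ℂ) = (d - 1) / 2 := by rw [hd]; ring
  rw [← hd] at hn ⊢
  rw [hn']
  field_simp
  ring

/-- The contribution of the radial field `p x` to the remainder in `integral_mKer_polyField`. -/
theorem sum_coord_mul_rot_X_mul {n : ℕ} {p : MvPolynomial (Fin 3) ℂ} (hp : p ∈ SphHarm n) {R : ℝ}
    {x : E3} (hx : ‖x‖ = R) (i : Fin 3) :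
    ∑ j, (x j : ℂ) * ∑ l, (x l : ℂ) * evalP (rot i j (MvPolynomial.X l * p)) x =
      -(R ^ 2 * evalP (gradP n p i) x) := by
  have hE := euler_evalP (mem_SphHarm.1 hp).1 x
  have h1 := sum_sq_eq x
  rw [hx] at h1
  have e : ∀ j, ∑ l, (x l : ℂ) * evalP (rot i j (MvPolynomial.X l * p)) x =
      R ^ 2 * evalP (rot i j p) x := by
    intro j
    have e2 : ∀ l, (x l : ℂ) * evalP (rot i j (MvPolynomial.X l * p)) x =
        (x l : ℂ) ^ 2 * evalP (rot i j p) x + evalP p x *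
          ((if l = j then (x l : ℂ) * x i else 0) - (if l = i then (x l : ℂ) * x j else 0)) := by
      intro l
      simp only [rot, Derivation.leibniz, MvPolynomial.pderiv_X, smul_eq_mul, Pi.single_apply,
        evalP_sub, evalP_mul, evalP_add, evalP_X]
      split_ifs <;> simp <;> ring
    simp only [e2]
    rw [Finset.sum_add_distrib, ← Finset.sum_mul, h1, ← Finset.mul_sum, Finset.sum_sub_distrib]
    simp [mul_comm]
  simp only [e]
  simp only [rot, gradP, evalP_sub, evalP_mul, evalP_X, evalP_smul, evalP_r2, hx]
  simp only [Fin.sum_univ_three] at hE h1 ⊢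
  push_cast at h1
  linear_combination (R ^ 2 * x i : ℂ) * hE - (R ^ 2 * evalP (MvPolynomial.pderiv i p) x) * h1

/-- The contribution of a tangential field to the remainder in `integral_mKer_polyField`. -/
theorem sum_coord_mul_rot {Φ : Fin 3 → MvPolynomial (Fin 3) ℂ}
    (h : ∑ l, MvPolynomial.X l * Φ l = 0) {R : ℝ} {x : E3} (hx : ‖x‖ = R) (i : Fin 3) :
    ∑ j, (x j : ℂ) * ∑ l, (x l : ℂ) * evalP (rot i j (Φ l)) x = R ^ 2 * evalP (Φ i) x := by
  have h0 := evalP_tangential h x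
  have h1 := sum_sq_eq x
  rw [hx] at h1
  have e : ∀ j, ∑ l, (x l : ℂ) * evalP (rot i j (Φ l)) x =
      x j * evalP (Φ i) x - x i * evalP (Φ j) x := by
    intro j
    have := congrArg (fun q => evalP q x) (sum_X_mul_rot h i j)
    simpa using this
  simp only [e]
  simp only [Fin.sum_univ_three] at h0 h1 ⊢
  push_cast at h1
  linear_combination evalP (Φ i) x * h1 - (x i : ℂ) * h0

theorem integral_mKer_curlP {R : ℝ} (hR : 0 < R) {k : ℂ} (hk : k ≠ 0) {n : ℕ} (hn : 1 ≤ n)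
    {p : MvPolynomial (Fin 3) ℂ} (hp : p ∈ SphHarm n) {x : E3} (hx : ‖x‖ = R) (i : Fin 3) :
    Integrable (fun y => mKer k x y (polyField (curlP p) y) i) (surfMeasure R) ∧
    ∫ y, mKer k x y (polyField (curlP p) y) i ∂surfMeasure R =
      m1 R k n * evalP (curlP p i) x := by
  have hRc : (R : ℂ) ≠ 0 := by exact_mod_cast hR.ne'
  have htan := sum_X_mul_curlP p
  have h := integral_mKer_polyField hR k (fun y _ => evalP_tangential htan y) hx
    (fun l => integral_gNormal hR hk (curlP_mem hp l) hx)
    (fun i j l => integral_G hR hk (rot_mem (curlP_mem hp l) i j) hx) i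
  refine ⟨h.1, ?_⟩
  have e1 := evalP_tangential htan x
  have e2 := sum_coord_mul_rot htan hx i
  have e3 : ∑ l, (x l : ℂ) / R * (lam R k n * evalP (curlP p l) x) =
      lam R k n / R * ∑ l, (x l : ℂ) * evalP (curlP p l) x := by
    rw [Finset.mul_sum]
    exact Finset.sum_congr rfl fun l _ => by ring
  have e4 : ∑ j, (x j : ℂ) * ∑ l, (x l : ℂ) * (chi R k n * evalP (rot i j (curlP p l)) x) =
      chi R k n * ∑ j, (x j : ℂ) * ∑ l, (x l : ℂ) * evalP (rot i j (curlP p l)) x := by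
    simp only [Finset.mul_sum]
    exact Finset.sum_congr rfl fun j _ => Finset.sum_congr rfl fun l _ => by ring
  rw [h.2, e3, e1, e4, e2, m1_eq_neg_m2 hR hk hn, m2]
  field_simp
  ring

theorem integral_mKer_gradP {R : ℝ} (hR : 0 < R) {k : ℂ} (hk : k ≠ 0) {n : ℕ} (hn : 1 ≤ n)
    {p : MvPolynomial (Fin 3) ℂ} (hp : p ∈ SphHarm n) {x : E3} (hx : ‖x‖ = R) (i : Fin 3) :
    Integrable (fun y => mKer k x y (polyField (gradP n p) y) i) (surfMeasure R) ∧
    ∫ y, mKer k x y (polyField (gradP n p) y) i ∂surfMeasure R =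
      m2 R k n * evalP (gradP n p i) x := by
  have hRc : (R : ℂ) ≠ 0 := by exact_mod_cast hR.ne'
  have htan := sum_X_mul_gradP hp
  have h := integral_mKer_polyField hR k (fun y _ => evalP_tangential htan y) hx
    (fun l => integral_gradP hR hx (fun m W hW => integral_gNormal hR hk hW hx) hp l)
    (fun i j l => integral_rot_gradP hR hx (fun m W hW => integral_G hR hk hW hx) hp i j l) i
  refine ⟨h.1, ?_⟩
  have e1 := evalP_tangential htan x
  have e2 := sum_coord_mul_rot htan hx i
  have e5 := sum_coord_mul_rot_X_mul hp hx i
  have h1 := sum_sq_eq x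
  rw [hx] at h1
  obtain ⟨pi3, hpi3⟩ : ∃ c, c = (lam R k (n - 1) - lam R k (n + 1)) / (2 * n + 1) := ⟨_, rfl⟩
  have e3 : ∑ l, (x l : ℂ) / R * (pi1 R k n * evalP (gradP n p l) x +
      n * (n + 1) * pi3 * ((x l : ℂ) * evalP p x)) =
      pi1 R k n / R * ∑ l, (x l : ℂ) * evalP (gradP n p l) x +
        n * (n + 1) * pi3 * evalP p x / R * ∑ l, (x l : ℂ) ^ 2 := by
    rw [Finset.mul_sum, Finset.mul_sum, ← Finset.sum_add_distrib]
    exact Finset.sum_congr rfl fun l _ => by ring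
  have e4 : ∑ j, (x j : ℂ) * ∑ l, (x l : ℂ) * (sig1 R k n * evalP (rot i j (gradP n p l)) x +
      n * (n + 1) * sig3 R k n * evalP (rot i j (MvPolynomial.X l * p)) x) =
      sig1 R k n * (∑ j, (x j : ℂ) * ∑ l, (x l : ℂ) * evalP (rot i j (gradP n p l)) x) +
      n * (n + 1) * sig3 R k n *
        ∑ j, (x j : ℂ) * ∑ l, (x l : ℂ) * evalP (rot i j (MvPolynomial.X l * p)) x := by
    simp only [Finset.mul_sum, ← Finset.sum_add_distrib]
    exact Finset.sum_congr rfl fun j _ => Finset.sum_congr rfl fun l _ => by ring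
  have hm2 : m2 R k n = -m1 R k n := by rw [m1_eq_neg_m2 hR hk hn, neg_neg]
  rw [h.2, ← hpi3]
  simp only [← sig1.eq_1, ← sig3.eq_1, ← pi1.eq_1]
  rw [e3, e1, e4, e2, e5, h1, hm2, m1]
  push_cast
  field_simp
  ring

/-! ### The surface divergence theorem -/

theorem continuous_pd {f : E3 → ℂ} (hf : ContDiff ℝ 1 f) (i : Fin 3) : Continuous (pd i f) :=
  (hf.continuous_fderiv (by simp)).clm_apply continuous_const

theorem continuous_coord (i : Fin 3) : Continuous fun x : E3 => (x i : ℂ) :=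
  Complex.continuous_ofReal.comp (EuclideanSpace.proj i : E3 →L[ℝ] ℝ).continuous

theorem integrable_mul_surfGrad {R : ℝ} (hR : 0 < R) {f u : E3 → ℂ} (hf : ContDiff ℝ 1 f)
    (hu : Continuous u) (i : Fin 3) :
    Integrable (fun x => u x * surfGrad R f x i) (surfMeasure R) := by
  have h : Integrable (fun x => u x * (pd i f x - (x i : ℂ) / R ^ 2 * ∑ j, (x j : ℂ) * pd j f x))
      (surfMeasure R) := by
    refine integrable_of_continuous hR.le (hu.mul ((continuous_pd hf i).sub ?_))
    exact ((continuous_coord i).div_const _).mul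
      (continuous_finsetSum _ fun j _ => (continuous_coord j).mul (continuous_pd hf j))
  refine h.congr ?_
  filter_upwards [ae_norm_eq hR.le] with x hx
  rw [surfGrad_apply hR hx (hf.differentiable (by simp) x) i]

/-- The surface divergence theorem for a tangential field. -/
theorem integral_dot_surfGrad {R : ℝ} (hR : 0 < R) {f : E3 → ℂ} {w : E3 → C3}
    (hf : ContDiff ℝ 1 f) (hw : ∀ i, ContDiff ℝ 1 fun x => w x i)
    (htan : ∀ x : E3, ‖x‖ = R → ∑ i, (x i : ℂ) * w x i = 0) :
    ∫ x, dot (w x) (surfGrad R f x) ∂surfMeasure R = -∫ x, f x * surfDiv R w x ∂surfMeasure R := by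
  have h1 : ∀ i, Integrable (fun x => f x * surfGrad R (fun y => w y i) x i) (surfMeasure R) :=
    fun i => integrable_mul_surfGrad hR (hw i) hf.continuous i
  have h2 : ∀ i, Integrable (fun x => w x i * surfGrad R f x i) (surfMeasure R) :=
    fun i => integrable_mul_surfGrad hR hf (hw i).continuous i
  have h3 : ∀ i, (∫ x, w x i * surfGrad R f x i ∂surfMeasure R) +
      ∫ x, f x * surfGrad R (fun y => w y i) x i ∂surfMeasure R =
      2 / R ^ 2 * ∫ x, (x i : ℂ) * (f x * w x i) ∂surfMeasure R := by
    intro i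
    rw [← integral_surfGrad hR (hf.mul (hw i)) i, ← integral_add (h2 i) (h1 i)]
    refine integral_congr_ae ?_
    filter_upwards [ae_norm_eq hR.le] with x hx
    have hfd := hf.differentiable (by simp) x
    have hwd := (hw i).differentiable (by simp) x
    have e : ∀ j, pd j (fun y => f y * w y i) x = f x * pd j (fun y => w y i) x +
        w x i * pd j f x := by
      intro j
      simp only [pd]
      rw [fderiv_fun_mul hfd hwd]
      rfl
    rw [surfGrad_apply hR hx hfd i, surfGrad_apply hR hx hwd i,
      surfGrad_apply hR hx (hfd.fun_mul hwd) i]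
    simp only [e, Fin.sum_univ_three]
    ring
  have h4 : ∑ i, ∫ x, (x i : ℂ) * (f x * w x i) ∂surfMeasure R = 0 := by
    have h0 : ∀ i, Integrable (fun x : E3 => (x i : ℂ) * (f x * w x i)) (surfMeasure R) := fun i =>
      integrable_of_continuous hR.le
        ((continuous_coord i).mul (hf.continuous.mul (hw i).continuous))
    rw [← integral_finsetSum _ fun i _ => h0 i]
    refine integral_eq_zero_of_ae ?_
    filter_upwards [ae_norm_eq hR.le] with x hx
    have := htan x hx
    simp only [Fin.sum_univ_three, Pi.zero_apply] at this ⊢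
    linear_combination f x * this
  have h5 : ∑ i, ((∫ x, w x i * surfGrad R f x i ∂surfMeasure R) +
      ∫ x, f x * surfGrad R (fun y => w y i) x i ∂surfMeasure R) = 0 := by
    simp only [h3, ← Finset.mul_sum, h4, mul_zero]
  rw [Finset.sum_add_distrib, ← integral_finsetSum _ fun i _ => h2 i,
    ← integral_finsetSum _ fun i _ => h1 i] at h5
  simp only [dot, surfDiv, Finset.mul_sum]
  linear_combination h5

theorem surfDiv_polyField {Φ : Fin 3 → MvPolynomial (Fin 3) ℂ}
    (h : ∑ l, MvPolynomial.X l * Φ l = 0) {R : ℝ} (hR : 0 < R) {x : E3} (hx : ‖x‖ = R) :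
    surfDiv R (polyField Φ) x = evalP (∑ l, MvPolynomial.pderiv l (Φ l)) x := by
  have h0 := evalP_tangential h x
  have hj : ∀ j, ∑ l, (x l : ℂ) * evalP (MvPolynomial.pderiv j (Φ l)) x = -evalP (Φ j) x := by
    intro j
    have h1 := congrArg (fun q => evalP q x) (congrArg (MvPolynomial.pderiv j) h)
    simp only [map_sum, Derivation.leibniz, MvPolynomial.pderiv_X, smul_eq_mul,
      Finset.sum_add_distrib, map_zero, Pi.single_apply, mul_ite, mul_one, mul_zero,
      Finset.sum_ite_eq', Finset.mem_univ, if_true, evalP_add, evalP_sum,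
      evalP_mul, evalP_X, evalP_zero] at h1
    linear_combination h1
  have e : ∀ i, surfGrad R (fun y => polyField Φ y i) x i = evalP (MvPolynomial.pderiv i (Φ i)) x -
      (x i : ℂ) / R ^ 2 * ∑ j, (x j : ℂ) * evalP (MvPolynomial.pderiv j (Φ i)) x := by
    intro i
    simp only [polyField_apply]
    rw [surfGrad_apply hR hx (differentiable_evalP _ x)]
    simp only [pd_evalP]
  simp only [surfDiv, e, evalP_sum]
  simp only [Fin.sum_univ_three] at hj h0 ⊢
  linear_combination -(1 / R ^ 2 * (x 0 : ℂ)) * hj 0 - (1 / R ^ 2 * (x 1 : ℂ)) * hj 1 -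
    (1 / R ^ 2 * (x 2 : ℂ)) * hj 2 + (1 / R ^ 2 : ℂ) * h0

theorem surfGrad_evalP {R : ℝ} (hR : 0 < R) {n : ℕ} {p : MvPolynomial (Fin 3) ℂ} (hp : p ∈ SphHarm n)
    {x : E3} (hx : ‖x‖ = R) : surfGrad R (evalP p) x = ((R : ℂ) ^ 2)⁻¹ • polyField (gradP n p) x := by
  have hRc : (R : ℂ) ≠ 0 := by exact_mod_cast hR.ne'
  ext i
  rw [surfGrad_apply hR hx (differentiable_evalP _ x)]
  simp only [pd_evalP, euler_evalP (mem_SphHarm.1 hp).1 x, PiLp.smul_apply, polyField_apply, gradP,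
    evalP_sub, evalP_mul, evalP_smul, evalP_X, evalP_r2, hx, smul_eq_mul]
  field_simp

theorem sum_pderiv_gradP {n : ℕ} {p : MvPolynomial (Fin 3) ℂ} (hp : p ∈ SphHarm n) :
    ∑ l, MvPolynomial.pderiv l (gradP n p l) = (-(n * (n + 1)) : ℂ) • p := by
  have h1 := euler (mem_SphHarm.1 hp).1
  have h2 := (mem_SphHarm.1 hp).2
  rw [polyLaplacian_apply] at h2
  simp only [gradP, map_sub, Derivation.leibniz, pderiv_r2, Derivation.map_smul, smul_eq_mul,
    MvPolynomial.pderiv_X, Fin.sum_univ_three, Pi.single_eq_same] at h1 h2 ⊢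
  simp only [← MvPolynomial.C_mul', map_neg, map_mul, map_add, map_natCast, map_one] at h1 h2 ⊢
  linear_combination r2 * h2 + (2 - (n : MvPolynomial (Fin 3) ℂ)) * h1

theorem sum_pderiv_curlP (p : MvPolynomial (Fin 3) ℂ) :
    ∑ l, MvPolynomial.pderiv l (curlP p l) = 0 := by
  have h01 := pderiv_comm 0 1 p
  have h02 := pderiv_comm 0 2 p
  have h12 := pderiv_comm 1 2 p
  simp [Fin.sum_univ_three, curlP, rot, MvPolynomial.pderiv_X, h01, h02, h12]

/-! ### Polynomials as elements of `L²` -/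

theorem continuous_polyField (Φ : Fin 3 → MvPolynomial (Fin 3) ℂ) : Continuous (polyField Φ) :=
  (PiLp.continuous_toLp 2 (fun _ : Fin 3 => ℂ)).comp
    (continuous_pi fun i => continuous_evalP (Φ i))

theorem memLp_of_continuous {F : Type*} [NormedAddCommGroup F] {R : ℝ} (hR : 0 < R) {f : E3 → F}
    (hf : Continuous f) : MemLp f 2 (surfMeasure R) := by
  obtain ⟨C, hC⟩ := (isCompact_sphere (0 : E3) R).exists_bound_of_continuousOn hf.continuousOn
  refine MemLp.of_bound hf.aestronglyMeasurable C ?_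
  filter_upwards [ae_norm_eq hR.le] with x hx
  exact hC x (by simpa using hx)

/-- A polynomial as an element of `L²(∂D)`. -/
def polyS {R : ℝ} (hR : 0 < R) (p : MvPolynomial (Fin 3) ℂ) : L2S R :=
  (memLp_of_continuous hR (continuous_evalP p)).toLp

/-- A field with polynomial components as an element of `L²(∂D)³`. -/
def polyV {R : ℝ} (hR : 0 < R) (Φ : Fin 3 → MvPolynomial (Fin 3) ℂ) : L2V R :=
  (memLp_of_continuous hR (continuous_polyField Φ)).toLp

theorem coeFn_polyS {R : ℝ} (hR : 0 < R) (p : MvPolynomial (Fin 3) ℂ) :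
    polyS hR p =ᵐ[surfMeasure R] evalP p := MemLp.coeFn_toLp _

theorem coeFn_polyV {R : ℝ} (hR : 0 < R) (Φ : Fin 3 → MvPolynomial (Fin 3) ℂ) :
    polyV hR Φ =ᵐ[surfMeasure R] polyField Φ := MemLp.coeFn_toLp _

theorem dot_normal_polyField {Φ : Fin 3 → MvPolynomial (Fin 3) ℂ}
    (h : ∑ l, MvPolynomial.X l * Φ l = 0) (x : E3) : dot (normal x) (polyField Φ x) = 0 := by
  have h0 := evalP_tangential h x
  rw [dot]
  simp only [normal_apply rfl, polyField_apply, div_mul_eq_mul_div, ← Finset.sum_div, h0, zero_div]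

theorem gradY_eq {R : ℝ} (hR : 0 < R) {n : ℕ} (hn : 1 ≤ n) {p : MvPolynomial (Fin 3) ℂ}
    (hp : p ∈ SphHarm n) {x : E3} (hx : ‖x‖ = R) :
    gradY p x = ((R : ℂ) ^ (n + 1))⁻¹ • polyField (gradP n p) x := by
  have hRc : (R : ℂ) ≠ 0 := by exact_mod_cast hR.ne'
  have hu : ‖‖x‖⁻¹ • x‖ = 1 := by rw [norm_smul, norm_inv, norm_norm, hx, inv_mul_cancel₀ hR.ne']
  rw [gradY, surfGrad_evalP one_pos hp hu]
  obtain ⟨m, rfl⟩ : ∃ m, n = m + 1 := ⟨n - 1, by omega⟩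
  ext i
  have h1 := evalP_real_smul (mem_SphHarm.1 (pderiv_mem hp i)).1 R⁻¹ x
  have h2 := evalP_real_smul (mem_SphHarm.1 hp).1 R⁻¹ x
  rw [Nat.add_sub_cancel] at h1
  rw [hx] at hu ⊢
  simp only [PiLp.smul_apply, polyField_apply, gradP, evalP_sub, evalP_mul, evalP_smul, evalP_X,
    evalP_r2, hx, hu, smul_eq_mul, h1, h2]
  push_cast
  rw [inv_pow, inv_pow]
  field_simp
  ring

/-- The rotation `ν ×` of the tangent plane takes `gradP` to `curlP`. -/
theorem cross_gradP {R : ℝ} {n : ℕ} {p : MvPolynomial (Fin 3) ℂ} {x : E3} (hR : 0 < R)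
    (hx : ‖x‖ = R) :
    cross (normal x) (polyField (gradP n p) x) = (-(R : ℂ)) • polyField (curlP p) x := by
  have hRc : (R : ℂ) ≠ 0 := by exact_mod_cast hR.ne'
  ext i
  fin_cases i <;> simp [cross, crossProduct, normal_apply hx, polyField_apply, gradP, curlP, rot, hx]
    <;> field_simp <;> ring

/-- The rotation `ν ×` of the tangent plane takes `curlP` to `gradP`. -/
theorem cross_curlP {R : ℝ} {n : ℕ} {p : MvPolynomial (Fin 3) ℂ} (hp : p ∈ SphHarm n) {x : E3}
    (hR : 0 < R) (hx : ‖x‖ = R) :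
    cross (normal x) (polyField (curlP p) x) = (R : ℂ)⁻¹ • polyField (gradP n p) x := by
  have hRc : (R : ℂ) ≠ 0 := by exact_mod_cast hR.ne'
  have h1 := sum_sq_eq x
  have h2 := euler_evalP (mem_SphHarm.1 hp).1 x
  simp only [Fin.sum_univ_three, hx] at h1 h2
  push_cast at h1
  ext i
  fin_cases i <;> simp [cross, crossProduct, normal_apply hx, polyField_apply, gradP, curlP, rot, hx]
    <;> field_simp
  · linear_combination evalP (MvPolynomial.pderiv 0 p) x * h1 - (x 0 : ℂ) * h2
  · linear_combination evalP (MvPolynomial.pderiv 1 p) x * h1 - (x 1 : ℂ) * h2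
  · linear_combination evalP (MvPolynomial.pderiv 2 p) x * h1 - (x 2 : ℂ) * h2

theorem cross_normal (v : C3) (x : E3) : cross v (normal x) = (-1 : ℂ) • cross (normal x) v := by
  ext i
  fin_cases i <;> simp [cross, crossProduct] <;> ring

theorem cross_add (a v w : C3) : cross a (v + w) = cross a v + cross a w := by
  simp [cross]

theorem cross_smul (a v : C3) (c : ℂ) : cross a (c • v) = c • cross a v := by
  simp [cross]

theorem curlY_eq {R : ℝ} (hR : 0 < R) {n : ℕ} (hn : 1 ≤ n) {p : MvPolynomial (Fin 3) ℂ}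
    (hp : p ∈ SphHarm n) {x : E3} (hx : ‖x‖ = R) :
    curlY p x = ((R : ℂ) ^ n)⁻¹ • polyField (curlP p) x := by
  have hRc : (R : ℂ) ≠ 0 := by exact_mod_cast hR.ne'
  rw [curlY, cross_normal, gradY_eq hR hn hp hx, cross_smul, cross_gradP hR hx, smul_smul, smul_smul]
  congr 1
  field_simp
  ring

theorem coe_gradYT {R : ℝ} (hR : 0 < R) {n : ℕ} (hn : 1 ≤ n) {p : MvPolynomial (Fin 3) ℂ}
    (hp : p ∈ SphHarm n) :
    (gradYT R p : L2V R) = ((R : ℂ) ^ (n + 1))⁻¹ • polyV hR (gradP n p) := by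
  refine Lp.ext ?_
  filter_upwards [(memLp_gradY R p).coeFn_toLp, coeFn_polyV hR (gradP n p), ae_norm_eq hR.le,
    Lp.coeFn_smul ((R : ℂ) ^ (n + 1))⁻¹ (polyV hR (gradP n p))] with x h1 h2 hx h3
  rw [h3, Pi.smul_apply, h2, ← gradY_eq hR hn hp hx]
  exact h1

theorem coe_curlYT {R : ℝ} (hR : 0 < R) {n : ℕ} (hn : 1 ≤ n) {p : MvPolynomial (Fin 3) ℂ}
    (hp : p ∈ SphHarm n) :
    (curlYT R p : L2V R) = ((R : ℂ) ^ n)⁻¹ • polyV hR (curlP p) := by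
  refine Lp.ext ?_
  filter_upwards [(memLp_curlY R p).coeFn_toLp, coeFn_polyV hR (curlP p), ae_norm_eq hR.le,
    Lp.coeFn_smul ((R : ℂ) ^ n)⁻¹ (polyV hR (curlP p))] with x h1 h2 hx h3
  rw [h3, Pi.smul_apply, h2, ← curlY_eq hR hn hp hx]
  exact h1

/-! ### The operators on vector spherical harmonics -/

theorem isWeakSurfDiv_polyV {R : ℝ} (hR : 0 < R) {Φ : Fin 3 → MvPolynomial (Fin 3) ℂ}
    (h : ∑ l, MvPolynomial.X l * Φ l = 0) :
    IsWeakSurfDiv R (polyV hR Φ) (polyS hR (∑ l, MvPolynomial.pderiv l (Φ l))) := by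
  intro η hη
  have h1 := integral_dot_surfGrad hR (f := η) (w := polyField Φ) (hη.of_le (by exact_mod_cast le_top))
    (fun i => (contDiff_evalP (Φ i)).of_le (by exact_mod_cast le_top))
    (fun x _ => evalP_tangential h x)
  have h2 : ∫ x, dot (polyV hR Φ x) (surfGrad R η x) ∂surfMeasure R =
      ∫ x, dot (polyField Φ x) (surfGrad R η x) ∂surfMeasure R := by
    refine integral_congr_ae ?_
    filter_upwards [coeFn_polyV hR Φ] with x hx
    rw [hx]
  rw [h2, h1, neg_neg]
  refine integral_congr_ae ?_
  filter_upwards [coeFn_polyS hR (∑ l, MvPolynomial.pderiv l (Φ l)), ae_norm_eq hR.le] with x h3 hx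
  rw [h3, surfDiv_polyField h hR hx, mul_comm]

theorem isWeakSurfGrad_polyS {R : ℝ} (hR : 0 < R) {n : ℕ} {p : MvPolynomial (Fin 3) ℂ}
    (hp : p ∈ SphHarm n) :
    IsWeakSurfGrad R (polyS hR p) (((R : ℂ) ^ 2)⁻¹ • polyV hR (gradP n p)) := by
  refine ⟨(L2T R).smul_mem _ ?_, fun w hw htan => ?_⟩
  · filter_upwards [coeFn_polyV hR (gradP n p)] with x hx
    rw [hx]
    exact dot_normal_polyField (sum_X_mul_gradP hp) x
  have hRc : (R : ℂ) ≠ 0 := by exact_mod_cast hR.ne'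
  have hw1 : ContDiff ℝ 1 w := hw.of_le (by exact_mod_cast le_top)
  have h1 := integral_dot_surfGrad hR (f := evalP p) (w := w)
    ((contDiff_evalP p).of_le (by exact_mod_cast le_top)) (fun i => ((EuclideanSpace.proj i : C3 →L[ℂ] ℂ).restrictScalars ℝ).contDiff.comp hw1)
    (fun x hx => by
      have h2 := htan x hx
      simp only [dot, normal_apply hx, div_mul_eq_mul_div, ← Finset.sum_div] at h2
      exact (div_eq_zero_iff.1 h2).resolve_right hRc)
  rw [show ∫ x, polyS hR p x * surfDiv R w x ∂surfMeasure R =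
    ∫ x, evalP p x * surfDiv R w x ∂surfMeasure R from integral_congr_ae (by
      filter_upwards [coeFn_polyS hR p] with x hx
      rw [hx]), ← h1]
  refine integral_congr_ae ?_
  filter_upwards [coeFn_polyV hR (gradP n p), ae_norm_eq hR.le,
    Lp.coeFn_smul ((R : ℂ) ^ 2)⁻¹ (polyV hR (gradP n p))] with x h2 hx h3
  rw [h3, Pi.smul_apply, h2, surfGrad_evalP hR hp hx]
  simp only [dot]
  exact Finset.sum_congr rfl fun i _ => mul_comm _ _

theorem isM_polyV {R : ℝ} (hR : 0 < R) {k m : ℂ} {Φ : Fin 3 → MvPolynomial (Fin 3) ℂ}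
    (h : ∀ x : E3, ‖x‖ = R → ∀ i,
      Integrable (fun y => mKer k x y (polyField Φ y) i) (surfMeasure R) ∧
      ∫ y, mKer k x y (polyField Φ y) i ∂surfMeasure R = m * evalP (Φ i) x) :
    IsM R k (polyV hR Φ) (m • polyV hR Φ) := by
  filter_upwards [ae_norm_eq hR.le, coeFn_polyV hR Φ, Lp.coeFn_smul m (polyV hR Φ)] with x hx h1 h2
  have e : (fun y => cross (normal x) (curl (fun z => G k z y • polyV hR Φ y) x)) =ᵐ[surfMeasure R]
      fun y => mKer k x y (polyField Φ y) := by
    filter_upwards [ae_ne hR x hx, coeFn_polyV hR Φ] with y hy h3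
    rw [h3, cross_curl_eq k (Ne.symm hy)]
  have hi := integrable_piLp_iff.2 fun i => (h x hx i).1
  refine ⟨hi.congr e.symm, ?_⟩
  rw [integral_congr_ae e, h2, Pi.smul_apply, h1]
  ext i
  rw [eval_integral_piLp fun i => (h x hx i).1, (h x hx i).2]
  rfl

theorem isM_curlP {R : ℝ} (hR : 0 < R) {k : ℂ} (hk : k ≠ 0) {n : ℕ} (hn : 1 ≤ n)
    {p : MvPolynomial (Fin 3) ℂ} (hp : p ∈ SphHarm n) :
    IsM R k (polyV hR (curlP p)) (m1 R k n • polyV hR (curlP p)) :=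
  isM_polyV hR fun _ hx i => integral_mKer_curlP hR hk hn hp hx i

theorem isM_gradP {R : ℝ} (hR : 0 < R) {k : ℂ} (hk : k ≠ 0) {n : ℕ} (hn : 1 ≤ n)
    {p : MvPolynomial (Fin 3) ℂ} (hp : p ∈ SphHarm n) :
    IsM R k (polyV hR (gradP n p)) (m2 R k n • polyV hR (gradP n p)) :=
  isM_polyV hR fun _ hx i => integral_mKer_gradP hR hk hn hp hx i

theorem isA_polyV {R : ℝ} (hR : 0 < R) {k : ℂ} {Φ Ψ : Fin 3 → MvPolynomial (Fin 3) ℂ}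
    (h : ∀ x : E3, ‖x‖ = R → ∀ i,
      Integrable (fun y => G k x y * evalP (Φ i) y) (surfMeasure R) ∧
      ∫ y, G k x y * evalP (Φ i) y ∂surfMeasure R = evalP (Ψ i) x) :
    IsA R k (polyV hR Φ) (polyV hR Ψ) := by
  filter_upwards [ae_norm_eq hR.le, coeFn_polyV hR Ψ] with x hx h1
  have e : (fun y => G k x y • polyV hR Φ y) =ᵐ[surfMeasure R]
      fun y => G k x y • polyField Φ y := by
    filter_upwards [coeFn_polyV hR Φ] with y h3
    rw [h3]
  have hi : Integrable (fun y => G k x y • polyField Φ y) (surfMeasure R) :=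
    integrable_piLp_iff.2 fun i => (h x hx i).1
  refine ⟨hi.congr e.symm, ?_⟩
  rw [integral_congr_ae e, h1]
  ext i
  rw [eval_integral_piLp fun i => (h x hx i).1]
  exact (h x hx i).2.symm

theorem isS_polyS {R : ℝ} (hR : 0 < R) {k : ℂ} (hk : k ≠ 0) {n : ℕ} {p : MvPolynomial (Fin 3) ℂ}
    (hp : p ∈ SphHarm n) : IsS R k (polyS hR p) (chi R k n • polyS hR p) := by
  filter_upwards [ae_norm_eq hR.le, coeFn_polyS hR p, Lp.coeFn_smul (chi R k n) (polyS hR p)]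
    with x hx h1 h2
  have e : (fun y => G k x y * polyS hR p y) =ᵐ[surfMeasure R] fun y => G k x y * evalP p y := by
    filter_upwards [coeFn_polyS hR p] with y h3
    rw [h3]
  have h := integral_G hR hk hp hx
  refine ⟨h.1.congr e.symm, ?_⟩
  rw [integral_congr_ae e, h.2, h2, Pi.smul_apply, h1, smul_eq_mul]

theorem IsM.smul {R : ℝ} {k : ℂ} {φ ψ : L2V R} (c : ℂ) (h : IsM R k φ ψ) (hR : 0 < R) :
    IsM R k (c • φ) (c • ψ) := by
  filter_upwards [h, ae_norm_eq hR.le, Lp.coeFn_smul c ψ] with x h1 hx h2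
  have e : (fun y => cross (normal x) (curl (fun z => G k z y • (c • φ : L2V R) y) x))
      =ᵐ[surfMeasure R]
      fun y => c • cross (normal x) (curl (fun z => G k z y • φ y) x) := by
    filter_upwards [ae_ne hR x hx, Lp.coeFn_smul c φ] with y hy h3
    rw [h3, Pi.smul_apply, cross_curl_eq k (Ne.symm hy), cross_curl_eq k (Ne.symm hy), mKer_smul]
  refine ⟨(h1.1.smul c).congr e.symm, ?_⟩
  rw [integral_congr_ae e, integral_smul, h2, Pi.smul_apply, h1.2]

theorem IsA.smul {R : ℝ} {k : ℂ} {φ ψ : L2V R} (c : ℂ) (h : IsA R k φ ψ) :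
    IsA R k (c • φ) (c • ψ) := by
  filter_upwards [h, Lp.coeFn_smul c ψ] with x h1 h2
  have e : (fun y => G k x y • (c • φ : L2V R) y) =ᵐ[surfMeasure R]
      fun y => c • G k x y • φ y := by
    filter_upwards [Lp.coeFn_smul c φ] with y h3
    rw [h3, Pi.smul_apply, smul_comm]
  refine ⟨(h1.1.smul c).congr e.symm, ?_⟩
  rw [integral_congr_ae e, integral_smul, h2, Pi.smul_apply, h1.2]

theorem IsS.smul {R : ℝ} {k : ℂ} {φ ψ : L2S R} (c : ℂ) (h : IsS R k φ ψ) :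
    IsS R k (c • φ) (c • ψ) := by
  filter_upwards [h, Lp.coeFn_smul c ψ] with x h1 h2
  have e : (fun y => G k x y * (c • φ : L2S R) y) =ᵐ[surfMeasure R]
      fun y => c • (G k x y * φ y) := by
    filter_upwards [Lp.coeFn_smul c φ] with y h3
    rw [h3, Pi.smul_apply, smul_eq_mul, smul_eq_mul]
    ring
  refine ⟨(h1.1.smul c).congr e.symm, ?_⟩
  rw [integral_congr_ae e, integral_smul, h2, Pi.smul_apply, h1.2]

theorem dot_smul_left (c : ℂ) (v w : C3) : dot (c • v) w = c * dot v w := by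
  simp only [dot, PiLp.smul_apply, smul_eq_mul, Finset.mul_sum, mul_assoc]

theorem IsWeakSurfDiv.smul {R : ℝ} {φ : L2V R} {g : L2S R} (c : ℂ) (h : IsWeakSurfDiv R φ g) :
    IsWeakSurfDiv R (c • φ) (c • g) := by
  intro η hη
  have h1 := h η hη
  rw [show ∫ x, (c • g : L2S R) x * η x ∂surfMeasure R = ∫ x, c * (g x * η x) ∂surfMeasure R from
    integral_congr_ae (by
      filter_upwards [Lp.coeFn_smul c g] with x hx
      rw [hx, Pi.smul_apply, smul_eq_mul, mul_assoc]),
    show ∫ x, dot ((c • φ : L2V R) x) (surfGrad R η x) ∂surfMeasure R =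
      ∫ x, c * dot (φ x) (surfGrad R η x) ∂surfMeasure R from integral_congr_ae (by
      filter_upwards [Lp.coeFn_smul c φ] with x hx
      rw [hx, Pi.smul_apply, dot_smul_left]), integral_const_mul, integral_const_mul, h1, mul_neg]

theorem IsWeakSurfGrad.smul {R : ℝ} {f : L2S R} {V : L2V R} (c : ℂ) (h : IsWeakSurfGrad R f V) :
    IsWeakSurfGrad R (c • f) (c • V) := by
  refine ⟨(L2T R).smul_mem c h.1, fun w hw htan => ?_⟩
  have h1 := h.2 w hw htan
  rw [show ∫ x, (c • f : L2S R) x * surfDiv R w x ∂surfMeasure R =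
      ∫ x, c * (f x * surfDiv R w x) ∂surfMeasure R from
    integral_congr_ae (by
      filter_upwards [Lp.coeFn_smul c f] with x hx
      rw [hx, Pi.smul_apply, smul_eq_mul, mul_assoc]),
    show ∫ x, dot ((c • V : L2V R) x) (w x) ∂surfMeasure R =
      ∫ x, c * dot (V x) (w x) ∂surfMeasure R from integral_congr_ae (by
      filter_upwards [Lp.coeFn_smul c V] with x hx
      rw [hx, Pi.smul_apply, dot_smul_left]), integral_const_mul, integral_const_mul, h1, mul_neg]

theorem IsL.smul {R : ℝ} {k : ℂ} {φ ψ : L2V R} (c : ℂ) (h : IsL R k φ ψ) :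
    IsL R k (c • φ) (c • ψ) := by
  obtain ⟨a, V, g, f, ha, hg, hf, hV, hψ⟩ := h
  refine ⟨c • a, c • V, c • g, c • f, ha.smul c, hg.smul c, hf.smul c, hV.smul c, ?_⟩
  filter_upwards [hψ, Lp.coeFn_smul c ψ, Lp.coeFn_smul c a, Lp.coeFn_smul c V] with x h1 h2 h3 h4
  rw [h2, h3, h4, Pi.smul_apply, Pi.smul_apply, Pi.smul_apply, h1, ← cross_smul, smul_add,
    smul_comm c]

/-- As `curlP p` is free of divergence, only the vector potential contributes to `L`. -/
theorem isL_curlP {R : ℝ} (hR : 0 < R) {k : ℂ} (hk : k ≠ 0) {n : ℕ}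
    {p : MvPolynomial (Fin 3) ℂ} (hp : p ∈ SphHarm n) :
    IsL R k (polyV hR (curlP p)) ((l1 R k n / R) • polyV hR (gradP n p)) := by
  have hz : (0 : MvPolynomial (Fin 3) ℂ) ∈ SphHarm n := zero_mem _
  have hdiv := isWeakSurfDiv_polyV hR (sum_X_mul_curlP p)
  rw [sum_pderiv_curlP] at hdiv
  refine ⟨polyV hR (fun i => chi R k n • curlP p i), _, _, _, isA_polyV hR fun x hx i => ?_, hdiv,
    isS_polyS hR hk hz, (isWeakSurfGrad_polyS hR hz).smul (chi R k n), ?_⟩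
  · have h := integral_G hR hk (curlP_mem hp i) hx
    exact ⟨h.1, by rw [h.2, evalP_smul]⟩
  · filter_upwards [Lp.coeFn_smul (l1 R k n / R) (polyV hR (gradP n p)),
      coeFn_polyV hR (gradP n p), coeFn_polyV hR (fun i => chi R k n • curlP p i),
      Lp.coeFn_smul (chi R k n) (((R : ℂ) ^ 2)⁻¹ • polyV hR (gradP n 0)),
      Lp.coeFn_smul ((R : ℂ) ^ 2)⁻¹ (polyV hR (gradP n 0)),
      coeFn_polyV hR (gradP n 0), ae_norm_eq hR.le] with x h1 h2 h3 h4 h5 h6 hx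
    have e1 : polyField (gradP n 0) x = 0 := by
      ext i
      simp [polyField_apply, gradP]
    have e2 : polyField (fun i => chi R k n • curlP p i) x = chi R k n • polyField (curlP p) x := by
      ext i
      simp [polyField_apply]
    rw [h1, Pi.smul_apply, h2, h3, h4, Pi.smul_apply, h5, Pi.smul_apply, h6, e1, e2, smul_zero,
      smul_zero, add_zero, cross_smul, cross_smul, cross_curlP hp hR hx, smul_smul, smul_smul, l1]
    rfl

/-- The vector potential of `gradP` has a radial part, which `ν ×` removes; the surface divergence of
`gradP` is a multiple of `p`, so the scalar potential contributes the term with `n (n + 1)`. -/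
theorem isL_gradP {R : ℝ} (hR : 0 < R) {k : ℂ} (hk : k ≠ 0) {n : ℕ}
    {p : MvPolynomial (Fin 3) ℂ} (hp : p ∈ SphHarm n) :
    IsL R k (polyV hR (gradP n p)) ((l2 R k n * R) • polyV hR (curlP p)) := by
  have hRc : (R : ℂ) ≠ 0 := by exact_mod_cast hR.ne'
  have hdiv := isWeakSurfDiv_polyV hR (sum_X_mul_gradP hp)
  rw [sum_pderiv_gradP hp] at hdiv
  have hq : (-(n * (n + 1)) : ℂ) • p ∈ SphHarm n := (SphHarm n).smul_mem _ hp
  refine ⟨polyV hR (fun i => sig1 R k n • gradP n p i +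
    (n * (n + 1) * sig3 R k n) • (MvPolynomial.X i * p)), _, _, _,
    isA_polyV hR fun x hx i => ?_, hdiv, isS_polyS hR hk hq,
    (isWeakSurfGrad_polyS hR hq).smul (chi R k n), ?_⟩
  · have h := integral_gradP hR hx (fun m W hW => integral_G hR hk hW hx) hp i
    refine ⟨h.1, h.2.trans ?_⟩
    simp only [evalP_add, evalP_smul, evalP_mul, evalP_X, sig1, sig3]
  · filter_upwards [Lp.coeFn_smul (l2 R k n * R) (polyV hR (curlP p)),
      coeFn_polyV hR (curlP p), coeFn_polyV hR (fun i => sig1 R k n • gradP n p i +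
        (n * (n + 1) * sig3 R k n) • (MvPolynomial.X i * p)),
      Lp.coeFn_smul (chi R k n) (((R : ℂ) ^ 2)⁻¹ • polyV hR (gradP n ((-(n * (n + 1)) : ℂ) • p))),
      Lp.coeFn_smul ((R : ℂ) ^ 2)⁻¹ (polyV hR (gradP n ((-(n * (n + 1)) : ℂ) • p))),
      coeFn_polyV hR (gradP n ((-(n * (n + 1)) : ℂ) • p)), ae_norm_eq hR.le]
      with x h1 h2 h3 h4 h5 h6 hx
    have e1 : polyField (gradP n ((-(n * (n + 1)) : ℂ) • p)) x =
        (-(n * (n + 1)) : ℂ) • polyField (gradP n p) x := by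
      ext i
      simp only [polyField_apply, gradP, Derivation.map_smul, evalP_sub, evalP_mul, evalP_smul,
        evalP_X, PiLp.smul_apply, smul_eq_mul]
      ring
    have e2 : polyField (fun i => sig1 R k n • gradP n p i +
        (n * (n + 1) * sig3 R k n) • (MvPolynomial.X i * p)) x =
        sig1 R k n • polyField (gradP n p) x + (n * (n + 1) * sig3 R k n * evalP p x * R) • normal x
        := by
      ext i
      simp only [polyField_apply, evalP_add, evalP_mul, evalP_smul, evalP_X, PiLp.smul_apply,
        PiLp.add_apply, smul_eq_mul, normal_apply hx]
      field_simp
    have e3 : cross (normal x) (normal x) = 0 := by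
      simp [cross]
    rw [h1, Pi.smul_apply, h2, h3, h4, Pi.smul_apply, h5, Pi.smul_apply, h6, e1, e2, cross_add,
      cross_smul, cross_smul, cross_smul, cross_smul, cross_add, cross_smul, cross_smul, e3,
      cross_gradP hR hx, smul_zero, add_zero, l2]
    module

/-! ### Orthogonality of the vector spherical harmonics -/

/-- The inner product of `L²(∂D)³`, on tangential fields. Named here because instance search would
otherwise find it in the guise of a `C⋆`-module structure. -/
instance instInnerL2T (R : ℝ) : Inner ℂ (L2T R) := (Submodule.innerProductSpace (L2T R)).toInner

/-- The polynomial with conjugated coefficients. -/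
def conjP (p : MvPolynomial (Fin 3) ℂ) : MvPolynomial (Fin 3) ℂ :=
  MvPolynomial.map (starRingEnd ℂ) p

theorem evalP_conjP (p : MvPolynomial (Fin 3) ℂ) (x : E3) :
    evalP (conjP p) x = (starRingEnd ℂ) (evalP p x) := by
  rw [evalP, evalP, MvPolynomial.map_eval, conjP]
  congr 2
  funext i
  simp

theorem pderiv_conjP (i : Fin 3) (p : MvPolynomial (Fin 3) ℂ) :
    MvPolynomial.pderiv i (conjP p) = conjP (MvPolynomial.pderiv i p) := MvPolynomial.pderiv_map

theorem conjP_mem {n : ℕ} {p : MvPolynomial (Fin 3) ℂ} (hp : p ∈ SphHarm n) :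
    conjP p ∈ SphHarm n := by
  rw [mem_SphHarm] at hp ⊢
  refine ⟨hp.1.map _, ?_⟩
  have h := congrArg conjP hp.2
  simp only [polyLaplacian_apply, pderiv_conjP] at h ⊢
  simpa [conjP] using h

theorem conjP_conjP (p : MvPolynomial (Fin 3) ℂ) : conjP (conjP p) = p := by
  rw [conjP, conjP, MvPolynomial.map_map]
  simp [MvPolynomial.map_id]

theorem gradP_conjP (n : ℕ) (p : MvPolynomial (Fin 3) ℂ) (l : Fin 3) :
    gradP n (conjP p) l = conjP (gradP n p l) := by
  rw [gradP, pderiv_conjP, gradP]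
  simp [conjP, r2, ← MvPolynomial.C_mul']

theorem curlP_conjP (p : MvPolynomial (Fin 3) ℂ) (l : Fin 3) :
    curlP (conjP p) l = conjP (curlP p l) := by
  have h : ∀ i j, rot i j (conjP p) = conjP (rot i j p) := by
    intro i j
    rw [rot, pderiv_conjP, pderiv_conjP, rot]
    simp [conjP]
  fin_cases l <;> exact h _ _

theorem dot_comm (v w : C3) : dot v w = dot w v :=
  Finset.sum_congr rfl fun _ _ => mul_comm _ _

theorem dot_smul_right (c : ℂ) (v w : C3) : dot v (c • w) = c * dot v w := by
  rw [dot_comm, dot_smul_left, dot_comm]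

/-- Integration by parts: the surface divergence of `gradP n p` is `-n (n + 1) p`. -/
theorem dot_gradP_gradP {R : ℝ} (hR : 0 < R) {n m : ℕ} {p q : MvPolynomial (Fin 3) ℂ}
    (hp : p ∈ SphHarm n) (hq : q ∈ SphHarm m) :
    ∫ x, dot (polyField (gradP n p) x) (polyField (gradP m q) x) ∂surfMeasure R =
      R ^ 2 * (n * (n + 1)) * ∫ x, evalP p x * evalP q x ∂surfMeasure R := by
  have hRc : (R : ℂ) ≠ 0 := by exact_mod_cast hR.ne'
  have h := integral_dot_surfGrad hR (f := evalP q) (w := polyField (gradP n p))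
    ((contDiff_evalP q).of_le (by exact_mod_cast le_top))
    (fun i => (contDiff_evalP (gradP n p i)).of_le (by exact_mod_cast le_top))
    (fun x _ => evalP_tangential (sum_X_mul_gradP hp) x)
  rw [← integral_const_mul]
  have e : ∫ x, dot (polyField (gradP n p) x) (polyField (gradP m q) x) ∂surfMeasure R =
      R ^ 2 * ∫ x, dot (polyField (gradP n p) x) (surfGrad R (evalP q) x) ∂surfMeasure R := by
    rw [← integral_const_mul]
    refine integral_congr_ae ?_
    filter_upwards [ae_norm_eq hR.le] with x hx
    rw [surfGrad_evalP hR hq hx, dot_smul_right, mul_inv_cancel_left₀ (pow_ne_zero 2 hRc)]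
  rw [e, h, ← integral_neg, ← integral_const_mul]
  refine integral_congr_ae ?_
  filter_upwards [ae_norm_eq hR.le] with x hx
  rw [surfDiv_polyField (sum_X_mul_gradP hp) hR hx, sum_pderiv_gradP hp, evalP_smul]
  ring

theorem dot_curlP_gradP {R : ℝ} (hR : 0 < R) {m : ℕ} (p : MvPolynomial (Fin 3) ℂ)
    {q : MvPolynomial (Fin 3) ℂ} (hq : q ∈ SphHarm m) :
    ∫ x, dot (polyField (curlP p) x) (polyField (gradP m q) x) ∂surfMeasure R = 0 := by
  have hRc : (R : ℂ) ≠ 0 := by exact_mod_cast hR.ne'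
  have h := integral_dot_surfGrad hR (f := evalP q) (w := polyField (curlP p))
    ((contDiff_evalP q).of_le (by exact_mod_cast le_top))
    (fun i => (contDiff_evalP (curlP p i)).of_le (by exact_mod_cast le_top))
    (fun x _ => evalP_tangential (sum_X_mul_curlP p) x)
  have e : ∫ x, dot (polyField (curlP p) x) (polyField (gradP m q) x) ∂surfMeasure R =
      R ^ 2 * ∫ x, dot (polyField (curlP p) x) (surfGrad R (evalP q) x) ∂surfMeasure R := by
    rw [← integral_const_mul]
    refine integral_congr_ae ?_
    filter_upwards [ae_norm_eq hR.le] with x hx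
    rw [surfGrad_evalP hR hq hx, dot_smul_right, mul_inv_cancel_left₀ (pow_ne_zero 2 hRc)]
  rw [e, h, mul_eq_zero, neg_eq_zero]
  right
  refine integral_eq_zero_of_ae ?_
  filter_upwards [ae_norm_eq hR.le] with x hx
  rw [surfDiv_polyField (sum_X_mul_curlP p) hR hx, sum_pderiv_curlP]
  simp

theorem dot_curlP_curlP {R : ℝ} (hR : 0 < R) {n m : ℕ} {p q : MvPolynomial (Fin 3) ℂ}
    (hp : p ∈ SphHarm n) (hq : q ∈ SphHarm m) :
    ∫ x, dot (polyField (curlP p) x) (polyField (curlP q) x) ∂surfMeasure R =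
      (n * (n + 1)) * ∫ x, evalP p x * evalP q x ∂surfMeasure R := by
  have hRc : (R : ℂ) ≠ 0 := by exact_mod_cast hR.ne'
  refine mul_left_cancel₀ (pow_ne_zero 2 hRc) ?_
  rw [← mul_assoc, ← dot_gradP_gradP hR hp hq, ← integral_const_mul]
  refine integral_congr_ae ?_
  filter_upwards [ae_norm_eq hR.le] with x hx
  have h0 := sum_sq_eq x
  have h1 := euler_evalP (mem_SphHarm.1 hp).1 x
  have h2 := euler_evalP (mem_SphHarm.1 hq).1 x
  have e1 : dot (polyField (curlP p) x) (polyField (curlP q) x) =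
      R ^ 2 * ∑ i, evalP (MvPolynomial.pderiv i p) x * evalP (MvPolynomial.pderiv i q) x -
        (n * evalP p x) * (m * evalP q x) := by
    rw [← h1, ← h2]
    rw [hx] at h0
    push_cast at h0
    rw [← h0]
    simp [dot, polyField_apply, curlP, rot, Fin.sum_univ_three]
    ring
  have e2 : dot (polyField (gradP n p) x) (polyField (gradP m q) x) =
      R ^ 4 * (∑ i, evalP (MvPolynomial.pderiv i p) x * evalP (MvPolynomial.pderiv i q) x) -
        R ^ 2 * (m * evalP q x) *
          (∑ i, (x i : ℂ) * evalP (MvPolynomial.pderiv i p) x) -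
        R ^ 2 * (n * evalP p x) * (∑ i, (x i : ℂ) * evalP (MvPolynomial.pderiv i q) x) +
        (n * evalP p x) * (m * evalP q x) * ∑ i, (x i : ℂ) ^ 2 := by
    simp [dot, polyField_apply, gradP, Fin.sum_univ_three, hx]
    ring
  rw [e1, e2, h0, h1, h2, hx]
  push_cast
  ring

/-- Spherical harmonics of different degrees are orthogonal, because both degrees compute the
integral of the product of the gradients. -/
theorem integral_mul_eq_zero {R : ℝ} (hR : 0 < R) {n m : ℕ} (hnm : n ≠ m)
    {p q : MvPolynomial (Fin 3) ℂ} (hp : p ∈ SphHarm n) (hq : q ∈ SphHarm m) :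
    ∫ x, evalP p x * evalP q x ∂surfMeasure R = 0 := by
  have hRc : (R : ℂ) ≠ 0 := by exact_mod_cast hR.ne'
  have h1 := dot_gradP_gradP hR hp hq
  have h2 := dot_gradP_gradP hR hq hp
  simp only [dot_comm (polyField (gradP m q) _), mul_comm (evalP q _)] at h2
  rw [h1] at h2
  have h3 : ((n : ℂ) - m) * (n + m + 1) ≠ 0 := by
    refine mul_ne_zero (sub_ne_zero.2 (by exact_mod_cast hnm)) ?_
    exact_mod_cast Nat.succ_ne_zero (n + m)
  have h4 : R ^ 2 * (((n : ℂ) - m) * (n + m + 1)) *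
      ∫ x, evalP p x * evalP q x ∂surfMeasure R = 0 := by linear_combination h2
  exact (mul_eq_zero.1 h4).resolve_left (mul_ne_zero (pow_ne_zero 2 hRc) h3)

theorem eq_zero_of_ae_eq_zero {f : E3 → ℝ} (hf : Continuous f)
    (h : ∀ᵐ x ∂surfMeasure 1, f x = 0) {x : E3} (hx : ‖x‖ = 1) : f x = 0 := by
  have hm : Measurable fun s : Metric.sphere (0 : E3) 1 => (1 : ℝ) • (s : E3) := by fun_prop
  rw [surfMeasure, one_pow, ENNReal.ofReal_one, one_smul] at h
  have h1 := ae_of_ae_map hm.aemeasurable h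
  have hc : Continuous fun s : Metric.sphere (0 : E3) 1 => f ((1 : ℝ) • (s : E3)) :=
    hf.comp (continuous_subtype_val.const_smul (1 : ℝ))
  have h2 := (hc.ae_eq_iff_eq (g := fun _ => (0 : ℝ)) (volume : Measure E3).toSphere
    continuous_const).1 h1
  have hx' : x ∈ Metric.sphere (0 : E3) 1 := mem_sphere_zero_iff_norm.2 hx
  have h3 := congrFun h2 ⟨x, hx'⟩
  rw [one_smul] at h3
  exact h3

theorem integral_mul_conjP_ne_zero {n : ℕ} {p : MvPolynomial (Fin 3) ℂ} (hp : p ∈ SphHarm n)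
    (h0 : p ≠ 0) : ∫ x, evalP p x * (starRingEnd ℂ) (evalP p x) ∂surfMeasure 1 ≠ 0 := by
  intro h
  have e : ∀ x, evalP p x * (starRingEnd ℂ) (evalP p x) = ((‖evalP p x‖ ^ 2 : ℝ) : ℂ) := fun x => by
    rw [Complex.mul_conj, Complex.normSq_eq_norm_sq]
  have hcont : Continuous fun x => ‖evalP p x‖ ^ 2 := (continuous_evalP p).norm.pow 2
  simp only [e] at h
  rw [integral_complex_ofReal, Complex.ofReal_eq_zero, integral_eq_zero_iff_of_nonneg
    (fun x => sq_nonneg _) (integrable_of_continuous zero_le_one hcont)] at h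
  refine h0 (eq_zero_of_evalP_eq_zero (mem_SphHarm.1 hp).1 fun x hx => ?_)
  exact norm_eq_zero.1 (pow_eq_zero_iff two_ne_zero |>.1 (eq_zero_of_ae_eq_zero hcont h hx))

theorem inner_polyV {R : ℝ} (hR : 0 < R) (Φ : Fin 3 → MvPolynomial (Fin 3) ℂ) (φ : L2V R) :
    inner ℂ (polyV hR Φ) φ =
      ∫ x, dot (φ x) (polyField (fun i => conjP (Φ i)) x) ∂surfMeasure R := by
  rw [L2.inner_def]
  refine integral_congr_ae ?_
  filter_upwards [coeFn_polyV hR Φ] with x hx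
  rw [hx, PiLp.inner_apply, dot]
  refine Finset.sum_congr rfl fun i _ => ?_
  rw [RCLike.inner_apply, polyField_apply, polyField_apply, evalP_conjP]

theorem inner_polyV_polyV {R : ℝ} (hR : 0 < R) (Φ Ψ : Fin 3 → MvPolynomial (Fin 3) ℂ) :
    inner ℂ (polyV hR Φ) (polyV hR Ψ) =
      ∫ x, dot (polyField Ψ x) (polyField (fun i => conjP (Φ i)) x) ∂surfMeasure R := by
  rw [inner_polyV]
  refine integral_congr_ae ?_
  filter_upwards [coeFn_polyV hR Ψ] with x hx
  rw [hx]

theorem integral_mul_conj_scale {R : ℝ} (hR : 0 < R) {n : ℕ} {p q : MvPolynomial (Fin 3) ℂ}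
    (hp : p ∈ SphHarm n) (hq : q ∈ SphHarm n) :
    ∫ x, evalP q x * evalP (conjP p) x ∂surfMeasure R = R ^ (2 * n + 2) *
      ∫ x, evalP q x * (starRingEnd ℂ) (evalP p x) ∂surfMeasure 1 := by
  rw [integral_surf hR, ← integral_smul, ← integral_const_mul]
  refine integral_congr_ae (Filter.Eventually.of_forall fun x => ?_)
  simp only [evalP_real_smul (mem_SphHarm.1 hq).1, evalP_real_smul (mem_SphHarm.1 (conjP_mem hp)).1,
    ← evalP_conjP, Complex.real_smul]
  push_cast
  ring

theorem inner_gradYT_gradYT {R : ℝ} (hR : 0 < R) {n : ℕ} (hn : 1 ≤ n)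
    {p q : MvPolynomial (Fin 3) ℂ} (hp : p ∈ SphHarm n) (hq : q ∈ SphHarm n) :
    inner ℂ (gradYT R p) (gradYT R q) = R ^ 2 * (n * (n + 1)) *
      ∫ x, evalP q x * (starRingEnd ℂ) (evalP p x) ∂surfMeasure 1 := by
  have hRc : (R : ℂ) ≠ 0 := by exact_mod_cast hR.ne'
  rw [Submodule.coe_inner, coe_gradYT hR hn hp, coe_gradYT hR hn hq, inner_smul_left,
    inner_smul_right, inner_polyV_polyV]
  simp only [← gradP_conjP]
  rw [dot_gradP_gradP hR hq (conjP_mem hp), integral_mul_conj_scale hR hp hq]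
  simp only [map_inv₀, map_pow, Complex.conj_ofReal]
  field_simp
  ring

theorem inner_curlYT_curlYT {R : ℝ} (hR : 0 < R) {n : ℕ} (hn : 1 ≤ n)
    {p q : MvPolynomial (Fin 3) ℂ} (hp : p ∈ SphHarm n) (hq : q ∈ SphHarm n) :
    inner ℂ (curlYT R p) (curlYT R q) = R ^ 2 * (n * (n + 1)) *
      ∫ x, evalP q x * (starRingEnd ℂ) (evalP p x) ∂surfMeasure 1 := by
  have hRc : (R : ℂ) ≠ 0 := by exact_mod_cast hR.ne'
  rw [Submodule.coe_inner, coe_curlYT hR hn hp, coe_curlYT hR hn hq, inner_smul_left,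
    inner_smul_right, inner_polyV_polyV]
  simp only [← curlP_conjP]
  rw [dot_curlP_curlP hR hq (conjP_mem hp), integral_mul_conj_scale hR hp hq]
  simp only [map_inv₀, map_pow, Complex.conj_ofReal]
  field_simp
  ring

theorem inner_gradYT_gradYT_of_ne {R : ℝ} (hR : 0 < R) {n m : ℕ} (hn : 1 ≤ n) (hm : 1 ≤ m)
    (hnm : n ≠ m) {p q : MvPolynomial (Fin 3) ℂ} (hp : p ∈ SphHarm n) (hq : q ∈ SphHarm m) :
    inner ℂ (gradYT R p) (gradYT R q) = 0 := by
  rw [Submodule.coe_inner, coe_gradYT hR hn hp, coe_gradYT hR hm hq, inner_smul_left,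
    inner_smul_right, inner_polyV_polyV]
  simp only [← gradP_conjP]
  rw [dot_gradP_gradP hR hq (conjP_mem hp), integral_mul_eq_zero hR hnm.symm hq (conjP_mem hp)]
  simp

theorem inner_curlYT_curlYT_of_ne {R : ℝ} (hR : 0 < R) {n m : ℕ} (hn : 1 ≤ n) (hm : 1 ≤ m)
    (hnm : n ≠ m) {p q : MvPolynomial (Fin 3) ℂ} (hp : p ∈ SphHarm n) (hq : q ∈ SphHarm m) :
    inner ℂ (curlYT R p) (curlYT R q) = 0 := by
  rw [Submodule.coe_inner, coe_curlYT hR hn hp, coe_curlYT hR hm hq, inner_smul_left,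
    inner_smul_right, inner_polyV_polyV]
  simp only [← curlP_conjP]
  rw [dot_curlP_curlP hR hq (conjP_mem hp), integral_mul_eq_zero hR hnm.symm hq (conjP_mem hp)]
  simp

theorem inner_gradYT_curlYT {R : ℝ} (hR : 0 < R) {n m : ℕ} (hn : 1 ≤ n) (hm : 1 ≤ m)
    {p q : MvPolynomial (Fin 3) ℂ} (hp : p ∈ SphHarm n) (hq : q ∈ SphHarm m) :
    inner ℂ (gradYT R p) (curlYT R q) = 0 := by
  rw [Submodule.coe_inner, coe_gradYT hR hn hp, coe_curlYT hR hm hq, inner_smul_left,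
    inner_smul_right, inner_polyV_polyV]
  simp only [← gradP_conjP]
  rw [dot_curlP_gradP hR q (conjP_mem hp)]
  simp

theorem ofNat_mul_succ_ne_zero {n : ℕ} (hn : 1 ≤ n) : (n * (n + 1) : ℂ) ≠ 0 := by
  exact_mod_cast (Nat.mul_pos hn (Nat.succ_pos n)).ne'

theorem gradYT_ne_zero {R : ℝ} (hR : 0 < R) {n : ℕ} (hn : 1 ≤ n) {p : MvPolynomial (Fin 3) ℂ}
    (hp : p ∈ SphHarm n) (h0 : p ≠ 0) : gradYT R p ≠ 0 := by
  have hRc : (R : ℂ) ≠ 0 := by exact_mod_cast hR.ne'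
  intro h
  have h1 := inner_gradYT_gradYT hR hn hp hp
  rw [h, inner_zero_left] at h1
  exact mul_ne_zero (mul_ne_zero (pow_ne_zero 2 hRc) (ofNat_mul_succ_ne_zero hn))
    (integral_mul_conjP_ne_zero hp h0) h1.symm

theorem curlYT_ne_zero {R : ℝ} (hR : 0 < R) {n : ℕ} (hn : 1 ≤ n) {p : MvPolynomial (Fin 3) ℂ}
    (hp : p ∈ SphHarm n) (h0 : p ≠ 0) : curlYT R p ≠ 0 := by
  have hRc : (R : ℂ) ≠ 0 := by exact_mod_cast hR.ne'
  intro h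
  have h1 := inner_curlYT_curlYT hR hn hp hp
  rw [h, inner_zero_left] at h1
  exact mul_ne_zero (mul_ne_zero (pow_ne_zero 2 hRc) (ofNat_mul_succ_ne_zero hn))
    (integral_mul_conjP_ne_zero hp h0) h1.symm

/-! ### The eigenpairs -/

theorem isM_curlYT {R : ℝ} (hR : 0 < R) {k : ℂ} (hk : k ≠ 0) {n : ℕ} (hn : 1 ≤ n)
    {p : MvPolynomial (Fin 3) ℂ} (hp : p ∈ SphHarm n) :
    IsM R k (curlYT R p) (m1 R k n • (curlYT R p : L2V R)) := by
  rw [coe_curlYT hR hn hp, smul_comm]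
  exact (isM_curlP hR hk hn hp).smul _ hR

theorem isM_gradYT {R : ℝ} (hR : 0 < R) {k : ℂ} (hk : k ≠ 0) {n : ℕ} (hn : 1 ≤ n)
    {p : MvPolynomial (Fin 3) ℂ} (hp : p ∈ SphHarm n) :
    IsM R k (gradYT R p) (m2 R k n • (gradYT R p : L2V R)) := by
  rw [coe_gradYT hR hn hp, smul_comm]
  exact (isM_gradP hR hk hn hp).smul _ hR

theorem isL_curlYT {R : ℝ} (hR : 0 < R) {k : ℂ} (hk : k ≠ 0) {n : ℕ} (hn : 1 ≤ n)
    {p : MvPolynomial (Fin 3) ℂ} (hp : p ∈ SphHarm n) :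
    IsL R k (curlYT R p) (l1 R k n • (gradYT R p : L2V R)) := by
  have hRc : (R : ℂ) ≠ 0 := by exact_mod_cast hR.ne'
  rw [coe_gradYT hR hn hp, coe_curlYT hR hn hp]
  have h := (isL_curlP hR hk hp).smul ((R : ℂ) ^ n)⁻¹
  rw [smul_smul] at h ⊢
  convert h using 2
  field_simp
  ring

theorem isL_gradYT {R : ℝ} (hR : 0 < R) {k : ℂ} (hk : k ≠ 0) {n : ℕ} (hn : 1 ≤ n)
    {p : MvPolynomial (Fin 3) ℂ} (hp : p ∈ SphHarm n) :
    IsL R k (gradYT R p) (l2 R k n • (curlYT R p : L2V R)) := by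
  have hRc : (R : ℂ) ≠ 0 := by exact_mod_cast hR.ne'
  rw [coe_gradYT hR hn hp, coe_curlYT hR hn hp]
  have h := (isL_gradP hR hk hp).smul ((R : ℂ) ^ (n + 1))⁻¹
  rw [smul_smul] at h ⊢
  convert h using 2
  field_simp
  ring

/-- The coefficient of the upper left entry of `𝕀 + 𝕂` on an eigenspace of `M` with eigenvalues
`mc` and `mm`. -/
def blockA (μm μc mc mm : ℂ) : ℂ := (μc + μm) / 2 + μc * mc - μm * mm

/-- The coefficient of the lower right entry of `𝕀 + 𝕂` on an eigenspace of `M` with eigenvalues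
`mc` and `mm`. -/
def blockD (km kc μm μc mc mm : ℂ) : ℂ :=
  kc ^ 2 / μc * mc - km ^ 2 / μm * mm + kc ^ 2 / (2 * μc) + km ^ 2 / (2 * μm)

theorem q1_eq {R : ℝ} {km kc μm μc : ℂ} (hm : μm ≠ 0) (hc : μc ≠ 0) (n : ℕ) :
    q1 R km kc μm μc n = 2 * (μc * μm) * (blockA μm μc (m1 R kc n) (m1 R km n) -
      blockD km kc μm μc (m2 R kc n) (m2 R km n)) := by
  simp only [q1, blockA, blockD]
  field_simp
  ring

theorem q2_eq {R : ℝ} {km kc μm μc : ℂ} (hm : μm ≠ 0) (hc : μc ≠ 0) (n : ℕ) :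
    q2 R km kc μm μc n = 2 * (μc * μm) * (blockA μm μc (m2 R kc n) (m2 R km n) -
      blockD km kc μm μc (m1 R kc n) (m1 R km n)) := by
  simp only [q2, blockA, blockD]
  field_simp
  ring

/-- The quadratic equation solved by the numbers `α`. -/
theorem alpha_quadratic {δ₁ δ₂ A D q s μ : ℂ} (hδ : δ₁ ≠ 0) (hμ : μ ≠ 0) (hq : q = 2 * μ * (A - D))
    (hs : s ^ 2 = 16 * δ₁ * δ₂ * μ ^ 2 + q ^ 2) :
    (q + s) / (4 * δ₁ * μ) * A + δ₂ =
      ((q + s) / (4 * δ₁ * μ) * δ₁ + D) * ((q + s) / (4 * δ₁ * μ)) := by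
  have hA : A = q / (2 * μ) + D := by
    rw [hq]
    field_simp
    ring
  rw [hA]
  field_simp
  linear_combination (-2 : ℂ) * hs

/-- Eigenfunctions in the block of `(∇_𝕊 Y × ν, ∇_𝕊 Y)`. -/
theorem isEigenpair_curl_grad {R : ℝ} (hR : 0 < R) {km kc μm μc : ℂ} (hkm : km ≠ 0) (hkc : kc ≠ 0)
    {n : ℕ} (hn : 1 ≤ n) {p : MvPolynomial (Fin 3) ℂ}
    (hp : p ∈ SphHarm n) (h0 : p ≠ 0) {α τ : ℂ}
    (h1 : α * blockA μm μc (m1 R kc n) (m1 R km n) + dl2 R km kc n = τ * α)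
    (h2 : τ = α * dl1 R km kc n + blockD km kc μm μc (m2 R kc n) (m2 R km n)) :
    IsEigenpair R km kc μm μc τ (α • curlYT R p, gradYT R p) := by
  refine ⟨fun h => gradYT_ne_zero hR hn hp h0 (congrArg Prod.snd h), _, _, _, _, _, _, _, _,
    (isM_curlYT hR hkc hn hp).smul α hR, (isM_curlYT hR hkm hn hp).smul α hR,
    isM_gradYT hR hkc hn hp, isM_gradYT hR hkm hn hp,
    (isL_curlYT hR hkc hn hp).smul α, (isL_curlYT hR hkm hn hp).smul α,
    isL_gradYT hR hkc hn hp, isL_gradYT hR hkm hn hp, ?_, ?_⟩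
  · simp only [Prod.smul_fst, Submodule.coe_smul, smul_smul, ← h1]
    simp only [blockA, dl2]
    module
  · simp only [Prod.smul_snd, Submodule.coe_smul, smul_smul, h2]
    simp only [blockD, dl1]
    module

/-- Eigenfunctions in the block of `(∇_𝕊 Y, ∇_𝕊 Y × ν)`. -/
theorem isEigenpair_grad_curl {R : ℝ} (hR : 0 < R) {km kc μm μc : ℂ} (hkm : km ≠ 0) (hkc : kc ≠ 0)
    {n : ℕ} (hn : 1 ≤ n) {p : MvPolynomial (Fin 3) ℂ}
    (hp : p ∈ SphHarm n) (h0 : p ≠ 0) {α τ : ℂ}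
    (h1 : α * blockA μm μc (m2 R kc n) (m2 R km n) + dl1 R km kc n = τ * α)
    (h2 : τ = α * dl2 R km kc n + blockD km kc μm μc (m1 R kc n) (m1 R km n)) :
    IsEigenpair R km kc μm μc τ (α • gradYT R p, curlYT R p) := by
  refine ⟨fun h => curlYT_ne_zero hR hn hp h0 (congrArg Prod.snd h), _, _, _, _, _, _, _, _,
    (isM_gradYT hR hkc hn hp).smul α hR, (isM_gradYT hR hkm hn hp).smul α hR,
    isM_curlYT hR hkc hn hp, isM_curlYT hR hkm hn hp,
    (isL_gradYT hR hkc hn hp).smul α, (isL_gradYT hR hkm hn hp).smul α,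
    isL_curlYT hR hkc hn hp, isL_curlYT hR hkm hn hp, ?_, ?_⟩
  · simp only [Prod.smul_fst, Submodule.coe_smul, smul_smul, ← h1]
    simp only [blockA, dl1]
    module
  · simp only [Prod.smul_snd, Submodule.coe_smul, smul_smul, h2]
    simp only [blockD, dl2]
    module

/-- The numbers `α₁`, `α₂` and `τ₁`, `τ₂` diagonalize the block of `curl` and `grad`. -/
theorem alpha_tau_eq {R : ℝ} {km kc μm μc s₁ s₂ : ℂ} (hm : μm ≠ 0) (hc : μc ≠ 0) {n : ℕ}
    (hs : s₁ ^ 2 = beta1 R km kc μm μc n) (hδ : dl1 R km kc n ≠ 0) {i : Fin 4}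
    (hi : i = 0 ∨ i = 1) :
    alpha R km kc μm μc s₁ s₂ n i * blockA μm μc (m1 R kc n) (m1 R km n) + dl2 R km kc n =
      tau R km kc μm μc s₁ s₂ n i * alpha R km kc μm μc s₁ s₂ n i ∧
    tau R km kc μm μc s₁ s₂ n i = alpha R km kc μm μc s₁ s₂ n i * dl1 R km kc n +
      blockD km kc μm μc (m2 R kc n) (m2 R km n) := by
  have h2 : tau R km kc μm μc s₁ s₂ n i = alpha R km kc μm μc s₁ s₂ n i * dl1 R km kc n +
      blockD km kc μm μc (m2 R kc n) (m2 R km n) := by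
    rcases hi with rfl | rfl <;> simp [tau, blockD]
  refine ⟨?_, h2⟩
  rw [h2]
  have hb : ∀ s : ℂ, s ^ 2 = beta1 R km kc μm μc n → s ^ 2 = 16 * dl1 R km kc n * dl2 R km kc n *
      (μc * μm) ^ 2 + q1 R km kc μm μc n ^ 2 := fun s hs => by
    rw [hs, beta1]
    ring
  rcases hi with rfl | rfl
  · have := alpha_quadratic hδ (mul_ne_zero hc hm) (q1_eq hm hc n) (hb _ hs)
    simpa [alpha, mul_assoc] using this
  · have := alpha_quadratic hδ (mul_ne_zero hc hm) (q1_eq hm hc n) (hb (-s₁) (by rw [neg_sq, hs]))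
    simpa [alpha, mul_assoc, sub_eq_add_neg] using this

/-- The numbers `α₃`, `α₄` and `τ₃`, `τ₄` diagonalize the block of `grad` and `curl`. -/
theorem alpha_tau_eq' {R : ℝ} {km kc μm μc s₁ s₂ : ℂ} (hm : μm ≠ 0) (hc : μc ≠ 0) {n : ℕ}
    (hs : s₂ ^ 2 = beta2 R km kc μm μc n) (hδ : dl2 R km kc n ≠ 0) {i : Fin 4}
    (hi : i = 2 ∨ i = 3) :
    alpha R km kc μm μc s₁ s₂ n i * blockA μm μc (m2 R kc n) (m2 R km n) + dl1 R km kc n =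
      tau R km kc μm μc s₁ s₂ n i * alpha R km kc μm μc s₁ s₂ n i ∧
    tau R km kc μm μc s₁ s₂ n i = alpha R km kc μm μc s₁ s₂ n i * dl2 R km kc n +
      blockD km kc μm μc (m1 R kc n) (m1 R km n) := by
  have h2 : tau R km kc μm μc s₁ s₂ n i = alpha R km kc μm μc s₁ s₂ n i * dl2 R km kc n +
      blockD km kc μm μc (m1 R kc n) (m1 R km n) := by
    rcases hi with rfl | rfl <;> simp [tau, blockD]
  refine ⟨?_, h2⟩
  rw [h2]
  have hb : ∀ s : ℂ, s ^ 2 = beta2 R km kc μm μc n → s ^ 2 = 16 * dl2 R km kc n * dl1 R km kc n *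
      (μc * μm) ^ 2 + q2 R km kc μm μc n ^ 2 := fun s hs => by
    rw [hs, beta2]
    ring
  rcases hi with rfl | rfl
  · have := alpha_quadratic hδ (mul_ne_zero hc hm) (q2_eq hm hc n) (hb _ hs)
    simpa [alpha, mul_assoc] using this
  · have := alpha_quadratic hδ (mul_ne_zero hc hm) (q2_eq hm hc n) (hb (-s₂) (by rw [neg_sq, hs]))
    simpa [alpha, mul_assoc, sub_eq_add_neg] using this

/-! ### Completeness of the spherical harmonics -/

/-- A polynomial approximates a continuous function on the unit sphere, and it may be taken
harmonic. -/
theorem exists_harmonic_near {g : E3 → ℝ} (hg : Continuous g) {ε : ℝ} (hε : 0 < ε) :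
    ∃ q ∈ ⨆ n, SphHarm n, ∀ x : E3, ‖x‖ = 1 → ‖(g x : ℂ) - evalP q x‖ < ε := by
  let X : Fin 3 → C(E3, ℝ) := fun i => ⟨fun x => x i,
    (EuclideanSpace.proj i : E3 →L[ℝ] ℝ).continuous⟩
  have hev : ∀ (P : MvPolynomial (Fin 3) ℝ) (x : E3),
      MvPolynomial.aeval X P x = MvPolynomial.eval (fun i => x i) P := by
    intro P x
    induction P using MvPolynomial.induction_on with
    | C c => simp
    | add p q hp hq => rw [map_add, map_add, ContinuousMap.add_apply, hp, hq]
    | mul_X p i hp =>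
      rw [map_mul, map_mul, ContinuousMap.mul_apply, hp, MvPolynomial.aeval_X, MvPolynomial.eval_X]
      rfl
  have hA : (MvPolynomial.aeval (R := ℝ) X).range.SeparatesPoints := by
    intro s t hst
    have h1 : ∃ i, s i ≠ t i := by
      by_contra! h
      exact hst (by ext i; exact h i)
    obtain ⟨i, hi⟩ := h1
    refine ⟨_, ⟨X i, ⟨MvPolynomial.X i, by simp⟩, rfl⟩, hi⟩
  obtain ⟨_, ⟨P, rfl⟩, ha⟩ :=
    ContinuousMap.exists_mem_subalgebra_near_continuous_of_isCompact_of_separatesPoints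
      hA ⟨g, hg⟩ (isCompact_sphere (0 : E3) 1) hε
  obtain ⟨q, hq, hq1⟩ := exists_harmonic_eqOn (MvPolynomial.map Complex.ofRealHom P)
  refine ⟨q, hq, fun x hx => ?_⟩
  have h2 : ‖MvPolynomial.aeval X P x - g x‖ < ε := ha x (mem_sphere_zero_iff_norm.2 hx)
  rw [hev] at h2
  rw [← hq1 x hx]
  have h1 : evalP (MvPolynomial.map Complex.ofRealHom P) x =
      ((MvPolynomial.eval (fun i => x i) P : ℝ) : ℂ) := by
    rw [evalP, ← Complex.ofRealHom_eq_coe, MvPolynomial.map_eval]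
    rfl
  rw [h1, ← Complex.ofReal_sub, Complex.norm_real, norm_sub_rev]
  exact h2

theorem integrable_evalP_mul {R : ℝ} (hR : 0 < R) (p : MvPolynomial (Fin 3) ℂ) (c : ℝ) {f : E3 → ℂ}
    (hf : Integrable f (surfMeasure R)) :
    Integrable (fun x => evalP p (c • x) * f x) (surfMeasure R) := by
  have hc : Continuous fun x : E3 => evalP p (c • x) :=
    (continuous_evalP p).comp (continuous_const_smul c)
  obtain ⟨C, hC⟩ := (isCompact_sphere (0 : E3) R).exists_bound_of_continuousOn hc.continuousOn
  refine hf.bdd_mul (c := C) hc.aestronglyMeasurable ?_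
  filter_upwards [ae_norm_eq hR.le] with x hx
  exact hC x (by simpa using hx)

/-- A function that is orthogonal to all spherical harmonics vanishes. -/
theorem ae_eq_zero_of_forall_harmonic {R : ℝ} (hR : 0 < R) {f : E3 → ℂ}
    (hf : Integrable f (surfMeasure R))
    (h : ∀ n, ∀ W ∈ SphHarm n, ∫ x, evalP W x * f x ∂surfMeasure R = 0) :
    ∀ᵐ x ∂surfMeasure R, f x = 0 := by
  have hq : ∀ q ∈ ⨆ n, SphHarm n, ∫ x, evalP q (R⁻¹ • x) * f x ∂surfMeasure R = 0 := by
    intro q hq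
    refine Submodule.iSup_induction SphHarm (motive := fun q =>
      ∫ x, evalP q (R⁻¹ • x) * f x ∂surfMeasure R = 0) hq ?_ (by simp) ?_
    · intro n W hW
      simp only [evalP_real_smul (mem_SphHarm.1 hW).1, mul_assoc]
      rw [integral_const_mul, h n W hW, mul_zero]
    · intro p q hp hq
      simp only [evalP_add, add_mul]
      rw [integral_add (integrable_evalP_mul hR p _ hf) (integrable_evalP_mul hR q _ hf), hp, hq,
        add_zero]
  refine ae_eq_zero_of_integral_contDiff_smul_eq_zero hf.locallyIntegrable fun g hg hgc => ?_
  have hgf : Integrable (fun x => g x • f x) (surfMeasure R) := by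
    obtain ⟨C, hC⟩ := hg.continuous.bounded_above_of_compact_support hgc
    exact hf.bdd_smul C hg.continuous.aestronglyMeasurable (Filter.Eventually.of_forall hC)
  have hle : ∀ ε > 0, ‖∫ x, g x • f x ∂surfMeasure R‖ ≤ ε * ∫ x, ‖f x‖ ∂surfMeasure R := by
    intro ε hε
    obtain ⟨q, hqm, hq1⟩ := exists_harmonic_near (g := fun u => g (R • u))
      (hg.continuous.comp (continuous_const_smul R)) hε
    have e : ∫ x, g x • f x ∂surfMeasure R =
        ∫ x, (g x • f x - evalP q (R⁻¹ • x) * f x) ∂surfMeasure R := by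
      rw [integral_sub hgf (integrable_evalP_mul hR q _ hf), hq q hqm, sub_zero]
    rw [e, ← integral_const_mul]
    refine norm_integral_le_of_norm_le (hf.norm.const_mul ε) ?_
    filter_upwards [ae_norm_eq hR.le] with x hx
    have hu : ‖R⁻¹ • x‖ = 1 := by
      rw [norm_smul, norm_inv, Real.norm_of_nonneg hR.le, hx, inv_mul_cancel₀ hR.ne']
    have h1 := hq1 _ hu
    rw [smul_inv_smul₀ hR.ne'] at h1
    rw [Complex.real_smul, ← sub_mul, norm_mul]
    gcongr
  have h0 : ‖∫ x, g x • f x ∂surfMeasure R‖ ≤ 0 := by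
    refine le_of_forall_pos_le_add fun δ hδ => ?_
    have hI : 0 ≤ ∫ x, ‖f x‖ ∂surfMeasure R := integral_nonneg fun x => norm_nonneg _
    refine (hle (δ / (∫ x, ‖f x‖ ∂surfMeasure R + 1)) (by positivity)).trans ?_
    rw [zero_add, div_mul_eq_mul_div, div_le_iff₀ (by positivity)]
    nlinarith
  exact norm_le_zero_iff.1 h0

/-! ### Completeness of the vector spherical harmonics -/

/-- The bilinear pairing of a square integrable field with a polynomial one. -/
def pair {R : ℝ} (φ : L2V R) (Φ : Fin 3 → MvPolynomial (Fin 3) ℂ) : ℂ :=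
  ∫ x, dot (φ x) (polyField Φ x) ∂surfMeasure R

theorem inner_polyV_eq_pair {R : ℝ} (hR : 0 < R) (Φ : Fin 3 → MvPolynomial (Fin 3) ℂ) (φ : L2V R) :
    inner ℂ (polyV hR Φ) φ = pair φ fun i => conjP (Φ i) := inner_polyV hR Φ φ

theorem integrable_coord {R : ℝ} (φ : L2V R) (i : Fin 3) :
    Integrable (fun x => φ x i) (surfMeasure R) :=
  integrable_piLp_iff.1 ((Lp.memLp φ).integrable one_le_two) i

theorem integrable_coord_mul {R : ℝ} (hR : 0 < R) (φ : L2V R) (i : Fin 3)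
    (p : MvPolynomial (Fin 3) ℂ) : Integrable (fun x => φ x i * evalP p x) (surfMeasure R) := by
  simpa [mul_comm] using integrable_evalP_mul hR p 1 (integrable_coord φ i)

theorem integrable_dot_polyField {R : ℝ} (hR : 0 < R) (φ : L2V R)
    (Φ : Fin 3 → MvPolynomial (Fin 3) ℂ) :
    Integrable (fun x => dot (φ x) (polyField Φ x)) (surfMeasure R) :=
  integrable_finsetSum _ fun i _ => integrable_coord_mul hR φ i (Φ i)

theorem pair_add {R : ℝ} (hR : 0 < R) (φ : L2V R) (Φ Ψ : Fin 3 → MvPolynomial (Fin 3) ℂ) :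
    pair φ (Φ + Ψ) = pair φ Φ + pair φ Ψ := by
  rw [pair, pair, pair, ← integral_add (integrable_dot_polyField hR φ Φ)
    (integrable_dot_polyField hR φ Ψ)]
  refine integral_congr_ae (Filter.Eventually.of_forall fun x => ?_)
  simp [dot, polyField_apply, mul_add, Finset.sum_add_distrib]

theorem pair_smul {R : ℝ} (φ : L2V R) (c : ℂ) (Φ : Fin 3 → MvPolynomial (Fin 3) ℂ) :
    pair φ (c • Φ) = c * pair φ Φ := by
  rw [pair, pair, ← integral_const_mul]
  refine integral_congr_ae (Filter.Eventually.of_forall fun x => ?_)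
  simp only [dot, polyField_apply, Pi.smul_apply, evalP_smul, Finset.mul_sum]
  exact Finset.sum_congr rfl fun i _ => by ring

theorem pair_radial {R : ℝ} {φ : L2V R} (hφ : φ ∈ L2T R) (q : MvPolynomial (Fin 3) ℂ) :
    pair φ (fun i => MvPolynomial.X i * q) = 0 := by
  refine integral_eq_zero_of_ae ?_
  filter_upwards [hφ] with x hx
  by_cases h0 : x = 0
  · simp [h0, dot, polyField_apply]
  · have hn : ((‖x‖ : ℝ) : ℂ) ≠ 0 := by exact_mod_cast norm_ne_zero_iff.2 h0
    simp only [dot, normal_apply rfl, div_mul_eq_mul_div, ← Finset.sum_div] at hx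
    have h1 := (div_eq_zero_iff.1 hx).resolve_right hn
    simp only [dot, polyField_apply, evalP_mul, evalP_X, Fin.sum_univ_three, Pi.zero_apply] at h1 ⊢
    linear_combination evalP q x * h1

theorem pair_r2_mul {R : ℝ} (hR : 0 < R) (φ : L2V R) (Φ : Fin 3 → MvPolynomial (Fin 3) ℂ) :
    pair φ (fun i => r2 * Φ i) = R ^ 2 * pair φ Φ := by
  rw [pair, pair, ← integral_const_mul]
  refine integral_congr_ae ?_
  filter_upwards [ae_norm_eq hR.le] with x hx
  simp only [dot, polyField_apply, evalP_mul, evalP_r2, hx, Finset.mul_sum]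
  exact Finset.sum_congr rfl fun i _ => by ring

theorem pderiv_eq_zero_of_mem_zero {p : MvPolynomial (Fin 3) ℂ} (hp : p ∈ SphHarm 0) (i : Fin 3) :
    MvPolynomial.pderiv i p = 0 := by
  have h := (mem_SphHarm.1 hp).1.totalDegree_le
  rw [Nat.le_zero, MvPolynomial.totalDegree_eq_zero_iff_eq_C] at h
  rw [h, MvPolynomial.pderiv_C]

/-- The identity `n (x × C) = ∇(∇W × x)_l × x - x (x · ∇∂_l W) + |x|² ∇∂_l W` for the field
`C = ∇W × e_l`. -/
theorem curlP_curlP {n : ℕ} (hn : 1 ≤ n) {W : MvPolynomial (Fin 3) ℂ} (hW : W ∈ SphHarm n)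
    (l i : Fin 3) :
    curlP (curlP W l) i - (n - 1 : MvPolynomial (Fin 3) ℂ) *
        (MvPolynomial.X i * MvPolynomial.pderiv l W) +
      r2 * MvPolynomial.pderiv i (MvPolynomial.pderiv l W) =
    (n : MvPolynomial (Fin 3) ℂ) * (MvPolynomial.X l * MvPolynomial.pderiv i W -
      (n : MvPolynomial (Fin 3) ℂ) * (if i = l then W else 0)) := by
  have hE := euler (mem_SphHarm.1 hW).1
  have hΔ := (mem_SphHarm.1 hW).2
  rw [polyLaplacian_apply] at hΔ
  have e : ∀ j, ∑ i, MvPolynomial.X i * MvPolynomial.pderiv i (MvPolynomial.pderiv j W) =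
      (n - 1 : MvPolynomial (Fin 3) ℂ) * MvPolynomial.pderiv j W := by
    intro j
    rw [euler (mem_SphHarm.1 (pderiv_mem hW j)).1, Nat.cast_sub hn, Nat.cast_one]
  have h01 := pderiv_comm 1 0 W
  have h02 := pderiv_comm 2 0 W
  have h12 := pderiv_comm 2 1 W
  simp only [Fin.sum_univ_three] at hE hΔ e
  have e0 := e 0
  have e1 := e 1
  have e2 := e 2
  fin_cases l <;> fin_cases i <;>
    simp [curlP, rot, MvPolynomial.pderiv_X, r2, Fin.sum_univ_three] <;>
    simp only [h01, h02, h12] at e0 e1 e2 ⊢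
  · linear_combination (MvPolynomial.X 1 ^ 2 + MvPolynomial.X 2 ^ 2) * hΔ + MvPolynomial.X 0 * e0 - MvPolynomial.X 1 * e1 -
      MvPolynomial.X 2 * e2 - (n : MvPolynomial (Fin 3) ℂ) * hE
  · linear_combination -(MvPolynomial.X 0 * MvPolynomial.X 1) * hΔ + MvPolynomial.X 0 * e1 + MvPolynomial.X 1 * e0
  · linear_combination -(MvPolynomial.X 0 * MvPolynomial.X 2) * hΔ + MvPolynomial.X 0 * e2 + MvPolynomial.X 2 * e0
  · linear_combination -(MvPolynomial.X 1 * MvPolynomial.X 0) * hΔ + MvPolynomial.X 1 * e0 + MvPolynomial.X 0 * e1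
  · linear_combination (MvPolynomial.X 0 ^ 2 + MvPolynomial.X 2 ^ 2) * hΔ + MvPolynomial.X 1 * e1 - MvPolynomial.X 0 * e0 -
      MvPolynomial.X 2 * e2 - (n : MvPolynomial (Fin 3) ℂ) * hE
  · linear_combination -(MvPolynomial.X 1 * MvPolynomial.X 2) * hΔ + MvPolynomial.X 1 * e2 + MvPolynomial.X 2 * e1
  · linear_combination -(MvPolynomial.X 2 * MvPolynomial.X 0) * hΔ + MvPolynomial.X 2 * e0 + MvPolynomial.X 0 * e2
  · linear_combination -(MvPolynomial.X 2 * MvPolynomial.X 1) * hΔ + MvPolynomial.X 2 * e1 + MvPolynomial.X 1 * e2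
  · linear_combination (MvPolynomial.X 0 ^ 2 + MvPolynomial.X 1 ^ 2) * hΔ + MvPolynomial.X 2 * e2 - MvPolynomial.X 0 * e0 -
      MvPolynomial.X 1 * e1 - (n : MvPolynomial (Fin 3) ℂ) * hE

/-- A tangential field that is orthogonal to all vector spherical harmonics is orthogonal to all
gradients of harmonic polynomials. -/
theorem pair_pderiv_eq_zero {R : ℝ} (hR : 0 < R) {φ : L2V R} (hφ : φ ∈ L2T R)
    (hg : ∀ n, 1 ≤ n → ∀ p ∈ SphHarm n, pair φ (gradP n p) = 0) {n : ℕ}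
    {p : MvPolynomial (Fin 3) ℂ} (hp : p ∈ SphHarm n) :
    pair φ (fun i => MvPolynomial.pderiv i p) = 0 := by
  have hRc : (R : ℂ) ≠ 0 := by exact_mod_cast hR.ne'
  rcases Nat.eq_zero_or_pos n with rfl | hn
  · simp [pderiv_eq_zero_of_mem_zero hp, pair, polyField, dot]
  · have e : (fun i => r2 * MvPolynomial.pderiv i p) =
        gradP n p + (n : ℂ) • fun i => MvPolynomial.X i * p := by
      funext i
      simp [gradP]
    have h := pair_r2_mul hR φ fun i => MvPolynomial.pderiv i p
    rw [e, pair_add hR, pair_smul, pair_radial hφ, hg n hn p hp, mul_zero, add_zero] at h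
    exact (mul_eq_zero.1 h.symm).resolve_left (pow_ne_zero 2 hRc)

/-- A tangential field that is orthogonal to all vector spherical harmonics is orthogonal to the
fields `W e_l`: the pairings `a` with `W e_l` and `b` with `x_l ∇W` satisfy `a + b = 0`, from the
gradient of `x_l W`, and `n (b - n a) = 0`, from `curlP_curlP`. -/
theorem pair_single_eq_zero {R : ℝ} (hR : 0 < R) {φ : L2V R} (hφ : φ ∈ L2T R)
    (hg : ∀ n, 1 ≤ n → ∀ p ∈ SphHarm n, pair φ (gradP n p) = 0)
    (hc : ∀ n, 1 ≤ n → ∀ p ∈ SphHarm n, pair φ (curlP p) = 0) {n : ℕ}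
    {W : MvPolynomial (Fin 3) ℂ} (hW : W ∈ SphHarm n) (l : Fin 3) :
    pair φ (fun i => if i = l then W else 0) = 0 := by
  have hgr := fun {m : ℕ} {p : MvPolynomial (Fin 3) ℂ} (hp : p ∈ SphHarm m) =>
    pair_pderiv_eq_zero hR hφ hg hp
  -- the gradient of `x_l W`, through the decomposition of `x_l W` into harmonic polynomials
  have h1 : pair φ (fun i => MvPolynomial.pderiv i (MvPolynomial.X l * W)) = 0 := by
    have e : (fun i => MvPolynomial.pderiv i (MvPolynomial.X l * W)) =
        (fun i => MvPolynomial.pderiv i (raise n l W)) + (2 * n + 1 : ℂ)⁻¹ •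
          (((2 : ℂ) • fun i => MvPolynomial.X i * MvPolynomial.pderiv l W) +
            fun i => r2 * MvPolynomial.pderiv i (MvPolynomial.pderiv l W)) := by
      funext i
      have e' : MvPolynomial.X l * W =
          raise n l W + (2 * n + 1 : ℂ)⁻¹ • (r2 * MvPolynomial.pderiv l W) := by
        simp [raise]
      rw [e', map_add, Derivation.map_smul, Derivation.leibniz, pderiv_r2]
      simp only [Pi.add_apply, Pi.smul_apply, smul_eq_mul]
      rw [← MvPolynomial.C_mul' (a := (2 : ℂ)), map_ofNat]
      congr 2
      ring
    rw [e, pair_add hR, pair_smul, pair_add hR, pair_smul, pair_radial hφ, pair_r2_mul hR,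
      hgr (raise_mem hW l), hgr (pderiv_mem hW l)]
    ring
  have h2 : (fun i => MvPolynomial.pderiv i (MvPolynomial.X l * W)) =
      (fun i => if i = l then W else 0) + fun i => MvPolynomial.X l * MvPolynomial.pderiv i W := by
    funext i
    by_cases hil : i = l
    · subst hil
      simp [Derivation.leibniz, add_comm]
    · simp [Derivation.leibniz, hil, MvPolynomial.pderiv_X_of_ne (Ne.symm hil)]
  rw [h2, pair_add hR] at h1
  rcases Nat.eq_zero_or_pos n with rfl | hn
  · have h3 : pair φ (fun i => MvPolynomial.X l * MvPolynomial.pderiv i W) = 0 := by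
      simp [pderiv_eq_zero_of_mem_zero hW, pair, polyField, dot]
    rwa [h3, add_zero] at h1
  · have e : (curlP (curlP W l) + (-(n - 1 : ℂ)) • fun i =>
        MvPolynomial.X i * MvPolynomial.pderiv l W) +
        (fun i => r2 * MvPolynomial.pderiv i (MvPolynomial.pderiv l W)) =
        (n : ℂ) • ((fun i => MvPolynomial.X l * MvPolynomial.pderiv i W) +
          (-(n : ℂ)) • fun i => if i = l then W else 0) := by
      funext i
      have := curlP_curlP hn hW l i
      simp only [Pi.add_apply, Pi.smul_apply, ← MvPolynomial.C_mul', map_neg, map_sub, map_natCast,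
        map_one]
      linear_combination this
    have h3 := congrArg (pair φ) e
    rw [pair_add hR, pair_add hR, pair_smul, pair_smul, pair_add hR, pair_smul, pair_radial hφ,
      pair_r2_mul hR, hc n hn _ (curlP_mem hW l), hgr (pderiv_mem hW l)] at h3
    have hn0 : (n : ℂ) * (n + 1) ≠ 0 := ofNat_mul_succ_ne_zero hn
    have h4 : (n : ℂ) * (n + 1) * pair φ (fun i => if i = l then W else 0) = 0 := by
      linear_combination (n : ℂ) * h1 + h3
    exact (mul_eq_zero.1 h4).resolve_left hn0

/-- The vector spherical harmonics are complete: only the zero field is orthogonal to all of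
them. -/
theorem eq_zero_of_forall_pair {R : ℝ} (hR : 0 < R) {φ : L2V R} (hφ : φ ∈ L2T R)
    (hg : ∀ n, 1 ≤ n → ∀ p ∈ SphHarm n, pair φ (gradP n p) = 0)
    (hc : ∀ n, 1 ≤ n → ∀ p ∈ SphHarm n, pair φ (curlP p) = 0) : φ = 0 := by
  have h : ∀ l, ∀ᵐ x ∂surfMeasure R, φ x l = 0 := fun l =>
    ae_eq_zero_of_forall_harmonic hR (integrable_coord φ l) fun n W hW => by
      rw [← pair_single_eq_zero hR hφ hg hc hW l, pair]
      refine integral_congr_ae (Filter.Eventually.of_forall fun x => ?_)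
      have : ∀ i, φ x i * evalP (if i = l then W else 0) x =
          if i = l then evalP W x * φ x i else 0 := by
        intro i
        split_ifs <;> simp [mul_comm]
      simp [dot, polyField_apply, this]
  refine Lp.ext ?_
  filter_upwards [ae_all_iff.2 h, Lp.coeFn_zero C3 2 (surfMeasure R)] with x h1 h2
  rw [h2]
  ext i
  exact h1 i

/-! ### Transposed boundary integral operators -/

theorem ae_prod_norm_eq {R : ℝ} (hR : 0 < R) :
    ∀ᵐ z ∂(surfMeasure R).prod (surfMeasure R), ‖z.1‖ = R ∧ ‖z.2‖ = R := by
  filter_upwards [Measure.quasiMeasurePreserving_fst.ae (ae_norm_eq hR.le),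
    Measure.quasiMeasurePreserving_snd.ae (ae_norm_eq hR.le)] with z h1 h2
  exact ⟨h1, h2⟩

/-- A function dominated by a weakly singular kernel is integrable on the product. -/
theorem integrable_prod_of_le_inv_dist {R : ℝ} (hR : 0 < R) {F : E3 × E3 → ℂ} {h : E3 → ℝ}
    (hF : AEStronglyMeasurable F ((surfMeasure R).prod (surfMeasure R)))
    (hh : Integrable h (surfMeasure R))
    (hb : ∀ᵐ z ∂(surfMeasure R).prod (surfMeasure R), ‖F z‖ ≤ ‖z.1 - z.2‖⁻¹ * h z.2) :
    Integrable F ((surfMeasure R).prod (surfMeasure R)) := by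
  refine Integrable.mono' ?_ hF hb
  have hm : AEStronglyMeasurable (fun z : E3 × E3 => ‖z.1 - z.2‖⁻¹ * h z.2)
      ((surfMeasure R).prod (surfMeasure R)) := by
    refine AEStronglyMeasurable.mul ?_ hh.1.comp_snd
    exact (measurable_fst.sub measurable_snd).norm.inv.aestronglyMeasurable
  refine (integrable_prod_iff' hm).2 ⟨?_, ?_⟩
  · filter_upwards [ae_norm_eq hR.le] with y hy
    have h1 := (integral_inv_dist hR hy).1
    simp only [norm_sub_rev y] at h1
    exact h1.mul_const _
  · refine (hh.norm.const_mul (4 * Real.pi * R)).congr ?_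
    filter_upwards [ae_norm_eq hR.le] with y hy
    have h1 := (integral_inv_dist hR hy).2
    simp only [norm_sub_rev y] at h1
    simp only [norm_mul, norm_inv, norm_norm]
    rw [integral_mul_const, h1]

theorem measurable_gRad' (k : ℂ) : Measurable (gRad' k) := by
  unfold gRad'
  fun_prop

theorem measurable_gRad (k : ℂ) : Measurable (gRad k) := by
  unfold gRad
  fun_prop

theorem measurable_normal_apply (i : Fin 3) : Measurable fun x : E3 => normal x i := by
  have h : Measurable fun x : E3 => (‖x‖⁻¹ • x : E3) i :=
    (EuclideanSpace.proj i : E3 →L[ℝ] ℝ).measurable.comp (measurable_norm.inv.smul measurable_id)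
  exact Complex.measurable_ofReal.comp h

theorem G_comm (k : ℂ) (x y : E3) : G k x y = G k y x := by
  rw [G_eq_gRad, G_eq_gRad, norm_sub_rev]

/-- The single layer operator is symmetric, by Fubini's theorem. -/
theorem integral_G_swap {R : ℝ} (hR : 0 < R) (k : ℂ) {u : E3 → ℂ}
    (hu : Integrable u (surfMeasure R)) (p : MvPolynomial (Fin 3) ℂ) :
    ∫ x, (∫ y, G k x y * u y ∂surfMeasure R) * evalP p x ∂surfMeasure R =
      ∫ y, u y * ∫ x, G k y x * evalP p x ∂surfMeasure R ∂surfMeasure R := by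
  obtain ⟨C, hC0, hC⟩ := exists_bound_evalP p R
  have hint : Integrable (Function.uncurry fun x y => G k x y * u y * evalP p x)
      ((surfMeasure R).prod (surfMeasure R)) := by
    refine integrable_prod_of_le_inv_dist hR
      (h := fun y => Real.exp (‖k‖ * (2 * R)) * C * ‖u y‖) ?_ (hu.norm.const_mul _) ?_
    · refine AEStronglyMeasurable.mul (AEStronglyMeasurable.mul ?_ hu.1.comp_snd) ?_
      · exact ((measurable_gRad k).comp
          (measurable_fst.sub measurable_snd).norm).aestronglyMeasurable
      · exact ((continuous_evalP p).comp continuous_fst).aestronglyMeasurable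
    · filter_upwards [ae_prod_norm_eq hR] with z hz
      have h1 : ‖G k z.1 z.2‖ ≤ Real.exp (‖k‖ * (2 * R)) * ‖z.1 - z.2‖⁻¹ := by
        rw [G_eq_gRad]
        rcases (norm_nonneg (z.1 - z.2)).eq_or_lt with h0 | h0
        · simp [← h0, gRad]
        · refine norm_gRad_le k h0 ((norm_sub_le _ _).trans ?_)
          rw [hz.1, hz.2, two_mul]
      have h2 := hC z.1 hz.1
      rw [Function.uncurry, norm_mul, norm_mul]
      calc ‖G k z.1 z.2‖ * ‖u z.2‖ * ‖evalP p z.1‖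
          ≤ (Real.exp (‖k‖ * (2 * R)) * ‖z.1 - z.2‖⁻¹) * ‖u z.2‖ * C := by gcongr
        _ = _ := by ring
  simp only [← integral_mul_const, ← integral_const_mul]
  rw [integral_integral_swap hint]
  refine integral_congr_ae (Filter.Eventually.of_forall fun y => ?_)
  refine integral_congr_ae (Filter.Eventually.of_forall fun x => ?_)
  simp only [G_comm k x y]
  ring

theorem pair_A {R : ℝ} (hR : 0 < R) {k : ℂ} {φ a : L2V R} (h : IsA R k φ a)
    {Φ Ψ : Fin 3 → MvPolynomial (Fin 3) ℂ}
    (hG : ∀ y : E3, ‖y‖ = R → ∀ i, ∫ x, G k y x * evalP (Φ i) x ∂surfMeasure R = evalP (Ψ i) y) :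
    pair a Φ = pair φ Ψ := by
  have e : ∀ (φ : L2V R) (Φ : Fin 3 → MvPolynomial (Fin 3) ℂ),
      pair φ Φ = ∑ i, ∫ x, φ x i * evalP (Φ i) x ∂surfMeasure R := fun φ Φ =>
    integral_finsetSum _ fun i _ => integrable_coord_mul hR φ i (Φ i)
  rw [e, e]
  refine Finset.sum_congr rfl fun i _ => ?_
  have h1 : ∫ x, a x i * evalP (Φ i) x ∂surfMeasure R =
      ∫ x, (∫ y, G k x y * φ y i ∂surfMeasure R) * evalP (Φ i) x ∂surfMeasure R := by
    refine integral_congr_ae ?_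
    filter_upwards [h] with x hx
    rw [hx.2, eval_integral_piLp fun i => integrable_piLp_iff.1 hx.1 i]
    rfl
  rw [h1, integral_G_swap hR k (integrable_coord φ i)]
  refine integral_congr_ae ?_
  filter_upwards [ae_norm_eq hR.le] with y hy
  rw [hG y hy i]

theorem integral_S {R : ℝ} (hR : 0 < R) {k : ℂ} (hk : k ≠ 0) {g f : L2S R} (h : IsS R k g f) {n : ℕ}
    {p : MvPolynomial (Fin 3) ℂ} (hp : p ∈ SphHarm n) :
    ∫ x, f x * evalP p x ∂surfMeasure R = chi R k n * ∫ x, g x * evalP p x ∂surfMeasure R := by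
  have h1 : ∫ x, f x * evalP p x ∂surfMeasure R =
      ∫ x, (∫ y, G k x y * g y ∂surfMeasure R) * evalP p x ∂surfMeasure R := by
    refine integral_congr_ae ?_
    filter_upwards [h] with x hx
    rw [hx.2]
  rw [h1, integral_G_swap hR k ((Lp.memLp g).integrable one_le_two), ← integral_const_mul]
  refine integral_congr_ae ?_
  filter_upwards [ae_norm_eq hR.le] with y hy
  rw [(integral_G hR hk hp hy).2]
  ring

theorem dot_add_left (u v w : C3) : dot (u + v) w = dot u w + dot v w := by
  simp [dot, add_mul, Finset.sum_add_distrib]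

theorem dot_cross_left (a u w : C3) : dot (cross a u) w = -dot u (cross a w) := by
  simp [dot, cross, crossProduct, Fin.sum_univ_three]
  ring

/-- The transposed of `L`, in terms of the vector potential and of the surface gradient. -/
theorem pair_L {R : ℝ} (hR : 0 < R) {ψ a V : L2V R} {k c : ℂ}
    (hψ : ∀ᵐ x ∂surfMeasure R, ψ x = cross (normal x) (k ^ 2 • a x + V x))
    {Φ Ψ : Fin 3 → MvPolynomial (Fin 3) ℂ}
    (hΦ : ∀ x : E3, ‖x‖ = R → cross (normal x) (polyField Φ x) = c • polyField Ψ x) :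
    pair ψ Φ = -(c * (k ^ 2 * pair a Ψ + pair V Ψ)) := by
  rw [pair, pair, pair, ← integral_const_mul, ← integral_add
    ((integrable_dot_polyField hR a Ψ).const_mul _) (integrable_dot_polyField hR V Ψ),
    ← integral_const_mul, ← integral_neg]
  refine integral_congr_ae ?_
  filter_upwards [hψ, ae_norm_eq hR.le] with x h1 hx
  rw [h1, dot_cross_left, hΦ x hx, dot_smul_right, dot_add_left, dot_smul_left]

theorem pair_surfGrad {R : ℝ} (hR : 0 < R) {f : L2S R} {V : L2V R} (h : IsWeakSurfGrad R f V)
    {Φ : Fin 3 → MvPolynomial (Fin 3) ℂ} (hΦ : ∑ l, MvPolynomial.X l * Φ l = 0) :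
    pair V Φ = -∫ x, f x * evalP (∑ l, MvPolynomial.pderiv l (Φ l)) x ∂surfMeasure R := by
  have hc : ContDiff ℝ (⊤ : ℕ∞) (polyField Φ) :=
    (contDiff_piLp 2).2 fun i => contDiff_evalP (Φ i)
  rw [pair, h.2 _ hc fun x _ => dot_normal_polyField hΦ x]
  congr 1
  refine integral_congr_ae ?_
  filter_upwards [ae_norm_eq hR.le] with x hx
  rw [surfDiv_polyField hΦ hR hx]

theorem pair_surfDiv {R : ℝ} (hR : 0 < R) {φ : L2V R} {g : L2S R} (h : IsWeakSurfDiv R φ g) {n : ℕ}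
    {p : MvPolynomial (Fin 3) ℂ} (hp : p ∈ SphHarm n) :
    pair φ (gradP n p) = -(R ^ 2 * ∫ x, g x * evalP p x ∂surfMeasure R) := by
  have hRc : (R : ℂ) ≠ 0 := by exact_mod_cast hR.ne'
  rw [h _ (contDiff_evalP p), mul_neg, neg_neg, pair, ← integral_const_mul]
  refine integral_congr_ae ?_
  filter_upwards [ae_norm_eq hR.le] with x hx
  rw [surfGrad_evalP hR hp hx, dot_smul_right, mul_inv_cancel_left₀ (pow_ne_zero 2 hRc)]

/-- The transposed of `L` on `gradP`, which `ν ×` rotates into the divergence-free field `curlP`. -/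
theorem pair_L_gradP {R : ℝ} (hR : 0 < R) {k : ℂ} (hk : k ≠ 0) {φ ψ : L2V R} (h : IsL R k φ ψ)
    {n : ℕ} {p : MvPolynomial (Fin 3) ℂ} (hp : p ∈ SphHarm n) :
    pair ψ (gradP n p) = R * l1 R k n * pair φ (curlP p) := by
  obtain ⟨a, V, g, f, ha, hg, hf, hV, hψ⟩ := h
  rw [pair_L hR hψ fun x hx => cross_gradP hR hx, pair_surfGrad hR hV (sum_X_mul_curlP p),
    sum_pderiv_curlP, pair_A hR ha (Ψ := chi R k n • curlP p) fun y hy i => by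
      rw [(integral_G hR hk (curlP_mem hp i) hy).2, Pi.smul_apply, evalP_smul], pair_smul, l1]
  simp
  ring

/-- The transposed of `L` on `curlP`. The radial part of the vector potential of `gradP` is invisible
to the tangential field `φ`. -/
theorem pair_L_curlP {R : ℝ} (hR : 0 < R) {k : ℂ} (hk : k ≠ 0) {φ ψ : L2V R} (hφ : φ ∈ L2T R)
    (h : IsL R k φ ψ) {n : ℕ} {p : MvPolynomial (Fin 3) ℂ} (hp : p ∈ SphHarm n) :
    pair ψ (curlP p) = l2 R k n / R * pair φ (gradP n p) := by
  have hRc : (R : ℂ) ≠ 0 := by exact_mod_cast hR.ne'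
  obtain ⟨a, V, g, f, ha, hg, hf, hV, hψ⟩ := h
  have hS := integral_S hR hk hf hp
  rw [pair_L hR hψ fun x hx => cross_curlP hp hR hx, pair_surfGrad hR hV (sum_X_mul_gradP hp),
    sum_pderiv_gradP hp, pair_A hR ha (Ψ := sig1 R k n • gradP n p +
        (n * (n + 1) * sig3 R k n) • fun i => MvPolynomial.X i * p) fun y hy i => by
      rw [(integral_gradP hR hy (fun m W hW => integral_G hR hk hW hy) hp i).2]
      simp only [Pi.add_apply, Pi.smul_apply, evalP_add, evalP_smul, evalP_mul, evalP_X, sig1, sig3],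
    pair_add hR, pair_smul, pair_smul, pair_radial hφ, pair_surfDiv hR hg hp, l2]
  have e : ∫ x, f x * evalP ((-(n * (n + 1)) : ℂ) • p) x ∂surfMeasure R =
      -(n * (n + 1)) * ∫ x, f x * evalP p x ∂surfMeasure R := by
    rw [← integral_const_mul]
    refine integral_congr_ae (Filter.Eventually.of_forall fun x => ?_)
    simp only [evalP_smul]
    ring
  rw [e, hS]
  field_simp
  ring

theorem dot_mKer_right (k : ℂ) (x y : E3) (c v : C3) :
    dot c (mKer k x y v) = gRad' k ‖x - y‖ *
      (dot (normal x) v * dot c (toC (x - y)) - dot (normal x) (toC (x - y)) * dot c v) := by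
  simp only [dot, mKer_apply, toC_apply, Fin.sum_univ_three, PiLp.sub_apply]
  push_cast
  ring

theorem dot_cross_mul (a b v w : C3) :
    dot b (cross w a) * dot (cross v b) a = dot b v * (dot w b * dot a a - dot w a * dot a b) -
      dot b b * (dot w v * dot a a - dot w a * dot a v) -
      dot b a * (dot w b * dot a v - dot w v * dot a b) := by
  simp [dot, cross, crossProduct, Fin.sum_univ_three]
  ring

theorem dot_cross_cross (a b v w : C3) :
    dot (cross v b) (cross w a) = dot v w * dot b a - dot v a * dot b w := by
  simp [dot, cross, crossProduct, Fin.sum_univ_three]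
  ring

theorem dot_normal_normal {R : ℝ} (hR : 0 < R) {x : E3} (hx : ‖x‖ = R) :
    dot (normal x) (normal x) = 1 := by
  have hRc : (R : ℂ) ≠ 0 := by exact_mod_cast hR.ne'
  have h := sum_sq_eq x
  simp only [hx, Fin.sum_univ_three] at h
  push_cast at h
  simp only [dot, normal_apply hx, Fin.sum_univ_three]
  field_simp
  linear_combination h

/-- The transposed of the kernel of `M`, on tangential vectors: up to the rotation `w ↦ w × ν` on
both sides, it is the kernel of `-M`. -/
theorem dot_mKer_left {R : ℝ} (hR : 0 < R) (k : ℂ) {x y : E3} (hx : ‖x‖ = R) (hy : ‖y‖ = R) {v : C3}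
    (hv : dot (normal y) v = 0) (w : C3) :
    dot (mKer k x y v) w =
      -dot (cross v (normal y)) (mKer k y x (cross w (normal x))) := by
  have hRc : (R : ℂ) ≠ 0 := by exact_mod_cast hR.ne'
  have hxy : toC (x - y) = (R : ℂ) • (normal x + (-1 : ℂ) • normal y) := by
    ext i
    simp only [toC_apply, PiLp.sub_apply, PiLp.smul_apply, PiLp.add_apply, normal_apply hx,
      normal_apply hy, smul_eq_mul]
    push_cast
    field_simp
    ring
  have hyx : toC (y - x) = (R : ℂ) • (normal y + (-1 : ℂ) • normal x) := by
    ext i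
    simp only [toC_apply, PiLp.sub_apply, PiLp.smul_apply, PiLp.add_apply, normal_apply hx,
      normal_apply hy, smul_eq_mul]
    push_cast
    field_simp
    ring
  have hx1 := dot_normal_normal hR hx
  have hy1 := dot_normal_normal hR hy
  rw [dot_comm, dot_mKer_right, dot_mKer_right, hxy, hyx, norm_sub_rev y x]
  generalize normal x = a at *
  generalize normal y = b at *
  have h1 := dot_cross_mul a b v w
  have h2 := dot_cross_cross a b v w
  have h3 : dot (cross v b) b = 0 := by
    simp [dot, cross, crossProduct, Fin.sum_univ_three]
    ring
  simp only [dot_smul_right, dot_comm _ (_ + _), dot_add_left, dot_smul_left] at *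
  rw [dot_comm a (cross v b), dot_comm b (cross v b), h3, h2]
  rw [hv, hx1, hy1] at h1
  rw [dot_comm b a, dot_comm a w, dot_comm b w, dot_comm v w, dot_comm v a, hx1, hy1] at *
  linear_combination -(gRad' k ‖x - y‖ * R) * h1

/-- The kernel of `M` is weakly singular on tangential vectors. -/
theorem norm_mKer_le {R : ℝ} (hR : 0 < R) (k : ℂ) {x y : E3} (hx : ‖x‖ = R) (hy : ‖y‖ = R) {v : C3}
    (hv : dot (normal y) v = 0) (i : Fin 3) :
    ‖mKer k x y v i‖ ≤ (‖k‖ * (2 * R) + 1) * Real.exp (‖k‖ * (2 * R)) * (4 / R) *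
      ‖x - y‖⁻¹ * ‖v‖ := by
  have hRc : (R : ℂ) ≠ 0 := by exact_mod_cast hR.ne'
  have hvi : ∀ j, ‖v j‖ ≤ ‖v‖ := fun j => PiLp.norm_apply_le v j
  have hc : ∀ j, ‖(x j : ℂ) - y j‖ ≤ ‖x - y‖ := fun j => by
    rw [← Complex.ofReal_sub, Complex.norm_real]
    exact abs_coord_sub_le x y j
  rcases (norm_nonneg (x - y)).eq_or_lt with h0 | h0
  · have hxy : x = y := sub_eq_zero.1 (norm_eq_zero.1 h0.symm)
    subst hxy
    simp [mKer_apply, dot, toC]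
  have hr : ‖x - y‖ ≤ 2 * R := (norm_sub_le _ _).trans (by rw [hx, hy, two_mul])
  have h1 := norm_gRad'_le k h0 hr
  have h2 : dot (normal x) v = ∑ j, ((x j : ℂ) - y j) * v j / R := by
    rw [← sub_zero (dot (normal x) v), ← hv, dot, dot, ← Finset.sum_sub_distrib]
    refine Finset.sum_congr rfl fun j _ => ?_
    rw [normal_apply hx, normal_apply hy]
    ring
  have h3 : ‖dot (normal x) v‖ ≤ 3 / R * ‖x - y‖ * ‖v‖ := by
    rw [h2]
    refine (norm_sum_le _ _).trans ?_
    calc ∑ j, ‖((x j : ℂ) - y j) * v j / R‖ ≤ ∑ _j : Fin 3, ‖x - y‖ * ‖v‖ / R := by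
          refine Finset.sum_le_sum fun j _ => ?_
          rw [norm_div, norm_mul, Complex.norm_real, Real.norm_of_nonneg hR.le]
          gcongr
          · exact hc j
          · exact hvi j
      _ = _ := by
          rw [Finset.sum_const, Finset.card_univ, Fintype.card_fin, nsmul_eq_mul]
          push_cast
          ring
  have h4 : ‖dot (normal x) (toC (x - y))‖ ≤ 1 / R * ‖x - y‖ ^ 2 := by
    rw [dot_normal_sub hR hx hy, norm_div, norm_pow, norm_mul, Complex.norm_real, Complex.norm_real,
      norm_norm, Real.norm_of_nonneg hR.le, Complex.norm_ofNat, div_eq_inv_mul]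
    gcongr
    rw [one_div]
    gcongr
    linarith
  rw [mKer_apply, norm_mul]
  calc ‖gRad' k ‖x - y‖‖ * ‖dot (normal x) v * ((x i : ℂ) - y i) -
        dot (normal x) (toC (x - y)) * v i‖
      ≤ ((‖k‖ * (2 * R) + 1) * Real.exp (‖k‖ * (2 * R)) * (‖x - y‖⁻¹) ^ 3) *
        ((3 / R * ‖x - y‖ * ‖v‖) * ‖x - y‖ + (1 / R * ‖x - y‖ ^ 2) * ‖v‖) := by
        gcongr
        refine (norm_sub_le _ _).trans ?_
        rw [norm_mul, norm_mul]
        gcongr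
        · exact hc i
        · exact hvi i
    _ = _ := by
        field_simp
        ring

theorem dot_integral_left {μ : Measure E3} {f : E3 → C3} (hf : Integrable f μ) (w : C3) :
    dot (∫ y, f y ∂μ) w = ∫ y, dot (f y) w ∂μ := by
  have h := integrable_piLp_iff.1 hf
  simp only [dot]
  rw [integral_finsetSum _ fun i _ => (h i).mul_const _]
  refine Finset.sum_congr rfl fun i _ => ?_
  rw [eval_integral_piLp h, integral_mul_const]

theorem integrable_dot_mKer {R : ℝ} (hR : 0 < R) (k : ℂ) {φ : L2V R} (hφ : φ ∈ L2T R)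
    (Φ : Fin 3 → MvPolynomial (Fin 3) ℂ) :
    Integrable (Function.uncurry fun x y => dot (mKer k x y (φ y)) (polyField Φ x))
      ((surfMeasure R).prod (surfMeasure R)) := by
  have hφm : ∀ i, Measurable fun y => φ y i := fun i =>
    (EuclideanSpace.proj i : C3 →L[ℂ] ℂ).measurable.comp (Lp.stronglyMeasurable φ).measurable
  change Integrable (fun z : E3 × E3 => ∑ i, mKer k z.1 z.2 (φ z.2) i * polyField Φ z.1 i) _
  refine integrable_finsetSum _ fun i _ => ?_
  obtain ⟨C, hC0, hC⟩ := exists_bound_evalP (Φ i) R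
  refine integrable_prod_of_le_inv_dist hR (h := fun y => (‖k‖ * (2 * R) + 1) *
    Real.exp (‖k‖ * (2 * R)) * (4 / R) * C * ‖φ y‖) ?_
    (((Lp.memLp φ).integrable one_le_two).norm.const_mul _) ?_
  · have hco : ∀ j, Measurable fun x : E3 => (x j : ℂ) := fun j => (continuous_coord j).measurable
    have hg : Measurable fun z : E3 × E3 => gRad' k ‖z.1 - z.2‖ :=
      (measurable_gRad' k).comp (measurable_fst.sub measurable_snd).norm
    have hn := measurable_normal_apply
    have hp := (continuous_evalP (Φ i)).measurable
    simp only [mKer_apply, dot, toC_apply, PiLp.sub_apply, polyField_apply, Fin.sum_univ_three]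
    push_cast
    exact Measurable.aestronglyMeasurable (by fun_prop)
  · filter_upwards [ae_prod_norm_eq hR, Measure.quasiMeasurePreserving_snd.ae hφ] with z hz hv
    have h1 := norm_mKer_le hR k hz.1 hz.2 hv i
    have h2 := hC z.1 hz.1
    rw [norm_mul, polyField_apply]
    exact (mul_le_mul h1 h2 (norm_nonneg _) (by positivity)).trans (le_of_eq (by ring))

/-- The transposed of `M`, on a polynomial field `Φ` that is rotated into an eigenfield `Ψ`. -/
theorem pair_M {R : ℝ} (hR : 0 < R) {k m c c' : ℂ} {φ ψ : L2V R} (hφ : φ ∈ L2T R)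
    (h : IsM R k φ ψ) {Φ Ψ : Fin 3 → MvPolynomial (Fin 3) ℂ}
    (hΦ : ∀ x : E3, ‖x‖ = R → cross (normal x) (polyField Φ x) = c • polyField Ψ x)
    (hΨ : ∀ x : E3, ‖x‖ = R → cross (normal x) (polyField Ψ x) = c' • polyField Φ x)
    (hM : ∀ y : E3, ‖y‖ = R → ∀ i,
      Integrable (fun x => mKer k y x (polyField Ψ x) i) (surfMeasure R) ∧
      ∫ x, mKer k y x (polyField Ψ x) i ∂surfMeasure R = m * evalP (Ψ i) y) :
    pair ψ Φ = c * c' * m * pair φ Φ := by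
  have h1 : pair ψ Φ = ∫ x, ∫ y, dot (mKer k x y (φ y)) (polyField Φ x) ∂surfMeasure R
      ∂surfMeasure R := by
    refine integral_congr_ae ?_
    filter_upwards [h, ae_norm_eq hR.le] with x hx hn
    have e : (fun y => cross (normal x) (curl (fun z => G k z y • φ y) x)) =ᵐ[surfMeasure R]
        fun y => mKer k x y (φ y) := by
      filter_upwards [ae_ne hR x hn] with y hy
      exact cross_curl_eq k (Ne.symm hy) _
    rw [hx.2, integral_congr_ae e, dot_integral_left (hx.1.congr e)]
  rw [h1, integral_integral_swap (integrable_dot_mKer hR k hφ Φ), pair, ← integral_const_mul]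
  refine integral_congr_ae ?_
  filter_upwards [hφ, ae_norm_eq hR.le] with y hv hy
  have h2 : ∫ x, dot (mKer k x y (φ y)) (polyField Φ x) ∂surfMeasure R =
      ∫ x, c * dot (mKer k y x (polyField Ψ x)) (cross (φ y) (normal y)) ∂surfMeasure R := by
    refine integral_congr_ae ?_
    filter_upwards [ae_norm_eq hR.le] with x hx
    rw [dot_mKer_left hR k hx hy hv, cross_normal (polyField Φ x), hΦ x hx, smul_smul, mKer_smul, dot_smul_right,
      dot_comm]
    ring
  have hi := fun i => (hM y hy i).1
  have h3 : ∫ x, mKer k y x (polyField Ψ x) ∂surfMeasure R = m • polyField Ψ y := by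
    ext i
    rw [eval_integral_piLp hi, (hM y hy i).2]
    rfl
  rw [h2, integral_const_mul, ← dot_integral_left (integrable_piLp_iff.2 hi), h3, dot_smul_left,
    cross_normal, dot_smul_right, dot_comm, dot_cross_left, hΨ y hy, dot_smul_right]
  ring

theorem pair_M_gradP {R : ℝ} (hR : 0 < R) {k : ℂ} (hk : k ≠ 0) {φ ψ : L2V R} (hφ : φ ∈ L2T R)
    (h : IsM R k φ ψ) {n : ℕ} (hn : 1 ≤ n) {p : MvPolynomial (Fin 3) ℂ} (hp : p ∈ SphHarm n) :
    pair ψ (gradP n p) = m2 R k n * pair φ (gradP n p) := by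
  have hRc : (R : ℂ) ≠ 0 := by exact_mod_cast hR.ne'
  rw [pair_M hR hφ h (fun x hx => cross_gradP hR hx) (fun x hx => cross_curlP hp hR hx)
    (fun y hy i => integral_mKer_curlP hR hk hn hp hy i), m1_eq_neg_m2 hR hk hn]
  field_simp

theorem pair_M_curlP {R : ℝ} (hR : 0 < R) {k : ℂ} (hk : k ≠ 0) {φ ψ : L2V R} (hφ : φ ∈ L2T R)
    (h : IsM R k φ ψ) {n : ℕ} (hn : 1 ≤ n) {p : MvPolynomial (Fin 3) ℂ} (hp : p ∈ SphHarm n) :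
    pair ψ (curlP p) = m1 R k n * pair φ (curlP p) := by
  have hRc : (R : ℂ) ≠ 0 := by exact_mod_cast hR.ne'
  rw [pair_M hR hφ h (fun x hx => cross_curlP hp hR hx) (fun x hx => cross_gradP hR hx)
    (fun y hy i => integral_mKer_gradP hR hk hn hp hy i), m1_eq_neg_m2 hR hk hn]
  field_simp

/-! ### There are no other eigenvalues -/

theorem pair_eq_inner {R : ℝ} (hR : 0 < R) (φ : L2V R) (Φ : Fin 3 → MvPolynomial (Fin 3) ℂ) :
    pair φ Φ = inner ℂ (polyV hR fun i => conjP (Φ i)) φ := by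
  rw [inner_polyV_eq_pair]
  simp only [conjP_conjP]

theorem pair_add_left {R : ℝ} (hR : 0 < R) (φ ψ : L2V R) (Φ : Fin 3 → MvPolynomial (Fin 3) ℂ) :
    pair (φ + ψ) Φ = pair φ Φ + pair ψ Φ := by
  simp only [pair_eq_inner hR, inner_add_right]

theorem pair_sub_left {R : ℝ} (hR : 0 < R) (φ ψ : L2V R) (Φ : Fin 3 → MvPolynomial (Fin 3) ℂ) :
    pair (φ - ψ) Φ = pair φ Φ - pair ψ Φ := by
  simp only [pair_eq_inner hR, inner_sub_right]

theorem pair_smul_left {R : ℝ} (hR : 0 < R) (c : ℂ) (φ : L2V R)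
    (Φ : Fin 3 → MvPolynomial (Fin 3) ℂ) : pair (c • φ) Φ = c * pair φ Φ := by
  simp only [pair_eq_inner hR, inner_smul_right]

/-- The eigenvalues of a block are the two numbers `τ`. -/
theorem eq_tau_of_block {δ₁ δ₂ A D q s μ τ u v : ℂ} (hδ : δ₁ ≠ 0) (hμ : μ ≠ 0)
    (hq : q = 2 * μ * (A - D)) (hs : s ^ 2 = 16 * δ₁ * δ₂ * μ ^ 2 + q ^ 2)
    (h1 : τ * u = A * u + δ₂ * v) (h2 : τ * v = δ₁ * u + D * v) (h0 : u ≠ 0 ∨ v ≠ 0) :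
    τ = (q + s) / (4 * δ₁ * μ) * δ₁ + D ∨ τ = (q - s) / (4 * δ₁ * μ) * δ₁ + D := by
  have hdet : (τ - A) * (τ - D) = δ₁ * δ₂ := by
    rcases h0 with h0 | h0
    · exact mul_right_cancel₀ h0 (by linear_combination (τ - D) * h1 + δ₂ * h2)
    · exact mul_right_cancel₀ h0 (by linear_combination (τ - A) * h2 + δ₁ * h1)
  have h3 : (τ - ((q + s) / (4 * δ₁ * μ) * δ₁ + D)) * (τ - ((q - s) / (4 * δ₁ * μ) * δ₁ + D)) = 0 := by
    have hA : A = q / (2 * μ) + D := by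
      rw [hq]
      field_simp
      ring
    rw [hA] at hdet
    field_simp at hdet ⊢
    linear_combination 8 * μ * hdet - hs
  rcases mul_eq_zero.1 h3 with h | h
  · exact Or.inl (sub_eq_zero.1 h)
  · exact Or.inr (sub_eq_zero.1 h)

/-- Every eigenvalue occurs in some block: the pairings of an eigenfunction with the vector spherical
harmonics solve the eigenvalue equations of the blocks, and they do not all vanish. -/
theorem exists_eq_tau {R : ℝ} (hR : 0 < R) {km kc μm μc : ℂ} (hkm : km ≠ 0) (hkc : kc ≠ 0)
    (hm : μm ≠ 0) (hc : μc ≠ 0) {s₁ s₂ : ℕ+ → ℂ}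
    (hs₁ : ∀ n : ℕ+, s₁ n ^ 2 = beta1 R km kc μm μc n)
    (hs₂ : ∀ n : ℕ+, s₂ n ^ 2 = beta2 R km kc μm μc n)
    (hδ : ∀ n : ℕ+, dl1 R km kc n ≠ 0 ∧ dl2 R km kc n ≠ 0) {τ : ℂ} {Φ : L2T R × L2T R}
    (h : IsEigenpair R km kc μm μc τ Φ) :
    ∃ (n : ℕ+) (i : Fin 4), τ = tau R km kc μm μc (s₁ n) (s₂ n) n i := by
  have hRc : (R : ℂ) ≠ 0 := by exact_mod_cast hR.ne'
  obtain ⟨h0, Mc₁, Mm₁, Mc₂, Mm₂, Lc₁, Lm₁, Lc₂, Lm₂, hMc₁, hMm₁, hMc₂, hMm₂, hLc₁, hLm₁, hLc₂,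
    hLm₂, e1, e2⟩ := h
  have hΦ₁ := Φ.1.2
  have hΦ₂ := Φ.2.2
  have e1 : τ • (Φ.1 : L2V R) = _ := e1
  have e2 : τ • (Φ.2 : L2V R) = _ := e2
  by_contra! hne
  -- every pairing of the eigenfunction with a vector spherical harmonic vanishes
  have hblock1 : ∀ n, 1 ≤ n → ∀ p ∈ SphHarm n,
      pair (Φ.1 : L2V R) (curlP p) = 0 ∧ pair (Φ.2 : L2V R) (gradP n p) = 0 := by
    intro n hn p hp
    by_contra hnz
    obtain ⟨N, rfl⟩ : ∃ N : ℕ+, (N : ℕ) = n := ⟨⟨n, hn⟩, rfl⟩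
    have f1 := congrArg (fun φ => pair φ (curlP p)) e1
    have f2 := congrArg (fun φ => pair φ (gradP N p)) e2
    simp only [pair_add_left hR, pair_sub_left hR, pair_smul_left hR,
      pair_M_curlP hR hkc hΦ₁ hMc₁ hn hp, pair_M_curlP hR hkm hΦ₁ hMm₁ hn hp,
      pair_M_gradP hR hkc hΦ₂ hMc₂ hn hp, pair_M_gradP hR hkm hΦ₂ hMm₂ hn hp,
      pair_L_curlP hR hkc hΦ₂ hLc₂ hp, pair_L_curlP hR hkm hΦ₂ hLm₂ hp,
      pair_L_gradP hR hkc hLc₁ hp, pair_L_gradP hR hkm hLm₁ hp] at f1 f2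
    have hs : s₁ N ^ 2 = 16 * dl1 R km kc N * dl2 R km kc N * (μc * μm) ^ 2 +
        q1 R km kc μm μc N ^ 2 := by
      rw [hs₁, beta1]
      ring
    rcases eq_tau_of_block (τ := τ) (u := R * pair (Φ.1 : L2V R) (curlP p))
      (v := pair (Φ.2 : L2V R) (gradP N p)) (hδ N).1 (mul_ne_zero hc hm) (q1_eq hm hc N) hs
      (by
        simp only [blockA, dl2]
        field_simp at f1 ⊢
        linear_combination f1)
      (by
        simp only [blockD, dl1]
        linear_combination f2)
      (by
        by_contra! hz
        exact hnz ⟨(mul_eq_zero.1 hz.1).resolve_left hRc, hz.2⟩) with h | h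
    · refine hne N 0 (h.trans ?_)
      simp [tau, alpha, blockD, mul_assoc]
    · refine hne N 1 (h.trans ?_)
      simp [tau, alpha, blockD, mul_assoc]
  have hblock2 : ∀ n, 1 ≤ n → ∀ p ∈ SphHarm n,
      pair (Φ.1 : L2V R) (gradP n p) = 0 ∧ pair (Φ.2 : L2V R) (curlP p) = 0 := by
    intro n hn p hp
    by_contra hnz
    obtain ⟨N, rfl⟩ : ∃ N : ℕ+, (N : ℕ) = n := ⟨⟨n, hn⟩, rfl⟩
    have f1 := congrArg (fun φ => pair φ (gradP N p)) e1
    have f2 := congrArg (fun φ => pair φ (curlP p)) e2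
    simp only [pair_add_left hR, pair_sub_left hR, pair_smul_left hR,
      pair_M_curlP hR hkc hΦ₂ hMc₂ hn hp, pair_M_curlP hR hkm hΦ₂ hMm₂ hn hp,
      pair_M_gradP hR hkc hΦ₁ hMc₁ hn hp, pair_M_gradP hR hkm hΦ₁ hMm₁ hn hp,
      pair_L_curlP hR hkc hΦ₁ hLc₁ hp, pair_L_curlP hR hkm hΦ₁ hLm₁ hp,
      pair_L_gradP hR hkc hLc₂ hp, pair_L_gradP hR hkm hLm₂ hp] at f1 f2
    have hs : s₂ N ^ 2 = 16 * dl2 R km kc N * dl1 R km kc N * (μc * μm) ^ 2 +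
        q2 R km kc μm μc N ^ 2 := by
      rw [hs₂, beta2]
      ring
    rcases eq_tau_of_block (τ := τ) (u := pair (Φ.1 : L2V R) (gradP N p))
      (v := R * pair (Φ.2 : L2V R) (curlP p)) (hδ N).2 (mul_ne_zero hc hm) (q2_eq hm hc N) hs
      (by
        simp only [blockA, dl1]
        linear_combination f1)
      (by
        simp only [blockD, dl2]
        field_simp at f2 ⊢
        linear_combination f2)
      (by
        by_contra! hz
        exact hnz ⟨hz.1, (mul_eq_zero.1 hz.2).resolve_left hRc⟩) with h | h
    · refine hne N 2 (h.trans ?_)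
      simp [tau, alpha, blockD, mul_assoc]
    · refine hne N 3 (h.trans ?_)
      simp [tau, alpha, blockD, mul_assoc]
  refine h0 (Prod.ext (Subtype.ext ?_) (Subtype.ext ?_))
  · exact eq_zero_of_forall_pair hR hΦ₁ (fun n hn p hp => (hblock2 n hn p hp).1)
      fun n hn p hp => (hblock1 n hn p hp).1
  · exact eq_zero_of_forall_pair hR hΦ₂ (fun n hn p hp => (hblock1 n hn p hp).2)
      fun n hn p hp => (hblock2 n hn p hp).2

/-! ### Expansions in vector spherical harmonics -/

/-- The expansion of a vector along a complete orthogonal family. -/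
theorem hasSum_of_orthogonal {H κ : Type*} [NormedAddCommGroup H] [InnerProductSpace ℂ H]
    [CompleteSpace H] {v : κ → H} (h0 : ∀ q, v q ≠ 0) (ho : ∀ q q', q ≠ q' → inner ℂ (v q) (v q') = 0)
    (hc : ∀ x, (∀ q, inner ℂ (v q) x = 0) → x = 0) (x : H) :
    HasSum (fun q => (inner ℂ (v q) x / inner ℂ (v q) (v q)) • v q) x := by
  classical
  have hn : ∀ q, ((‖v q‖ : ℝ) : ℂ) ≠ 0 := fun q => by exact_mod_cast norm_ne_zero_iff.2 (h0 q)
  have he : Orthonormal ℂ fun q => ((‖v q‖ : ℝ) : ℂ)⁻¹ • v q := by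
    rw [orthonormal_iff_ite]
    intro q q'
    rw [inner_smul_left, inner_smul_right, map_inv₀, Complex.conj_ofReal]
    split_ifs with h
    · subst h
      have := hn q
      rw [inner_self_eq_norm_sq_to_K]
      simp only [Complex.coe_algebraMap]
      field_simp
    · rw [ho q q' h, mul_zero, mul_zero]
  have hb : (Submodule.span ℂ (Set.range fun q => ((‖v q‖ : ℝ) : ℂ)⁻¹ • v q))ᗮ = ⊥ := by
    rw [Submodule.eq_bot_iff]
    intro y hy
    refine hc y fun q => ?_
    have h1 := (Submodule.mem_orthogonal _ _).1 hy _ (Submodule.subset_span ⟨q, rfl⟩)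
    rw [inner_smul_left, mul_eq_zero] at h1
    refine h1.resolve_left ?_
    rw [map_inv₀, Complex.conj_ofReal]
    exact inv_ne_zero (hn q)
  have h := (HilbertBasis.mkOfOrthogonalEqBot he hb).hasSum_repr x
  convert h using 2 with q
  have := hn q
  rw [HilbertBasis.repr_apply_apply, HilbertBasis.coe_mkOfOrthogonalEqBot, inner_smul_left,
    smul_smul, map_inv₀, Complex.conj_ofReal, inner_self_eq_norm_sq_to_K]
  simp only [Complex.coe_algebraMap]
  congr 1
  field_simp

/-- The tangential fields are those whose radial moments all vanish. -/
theorem mem_L2T_iff {R : ℝ} (hR : 0 < R) {φ : L2V R} :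
    φ ∈ L2T R ↔ ∀ n, ∀ W ∈ SphHarm n, pair φ (fun i => MvPolynomial.X i * W) = 0 := by
  have hRc : (R : ℂ) ≠ 0 := by exact_mod_cast hR.ne'
  refine ⟨fun h n W _ => pair_radial h W, fun h => ?_⟩
  have hx : Integrable (fun x => ∑ i, φ x i * evalP (MvPolynomial.X i) x) (surfMeasure R) :=
    integrable_finsetSum _ fun i _ => integrable_coord_mul hR φ i _
  filter_upwards [ae_eq_zero_of_forall_harmonic hR hx fun n W hW => by
    rw [← h n W hW, pair]
    refine integral_congr_ae (Filter.Eventually.of_forall fun x => ?_)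
    simp only [dot, polyField_apply, evalP_mul, Finset.mul_sum]
    exact Finset.sum_congr rfl fun i _ => by ring, ae_norm_eq hR.le] with x h1 h2
  simp only [evalP_X] at h1
  simp only [dot, normal_apply h2, div_mul_eq_mul_div, ← Finset.sum_div]
  simp only [mul_comm _ (φ x _), h1, zero_div]

theorem isClosed_L2T {R : ℝ} (hR : 0 < R) : IsClosed (L2T R : Set (L2V R)) := by
  have e : (L2T R : Set (L2V R)) = ⋂ n, ⋂ W ∈ SphHarm n,
      {φ | inner ℂ (polyV hR fun i => conjP (MvPolynomial.X i * W)) φ = 0} := by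
    ext φ
    simp only [SetLike.mem_coe, mem_L2T_iff hR, Set.mem_iInter, Set.mem_ofPred_eq, pair_eq_inner hR]
  rw [e]
  exact isClosed_iInter fun n => isClosed_iInter fun W => isClosed_iInter fun _ =>
    isClosed_eq (continuous_const.inner continuous_id) continuous_const

variable {ι : ℕ+ → Type}

/-- The family of all `∇_𝕊 Y` and `∇_𝕊 Y × ν`, for given spherical harmonics `Y`. -/
def vecHarm (R : ℝ) (Y : ∀ n : ℕ+, ι n → SphHarm n) (q : (Σ n : ℕ+, ι n) × Fin 2) : L2T R :=
  if q.2 = 0 then gradYT R (Y q.1.1 q.1.2) else curlYT R (Y q.1.1 q.1.2)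

theorem ne_zero_of_isOrthonormal {n : ℕ} {κ : Type} {Y : κ → SphHarm n}
    (hY : IsOrthonormalHarmonics n Y) (i : κ) : (Y i : MvPolynomial (Fin 3) ℂ) ≠ 0 := by
  intro h
  have := hY.1 i
  simp [h] at this

theorem vecHarm_ne_zero {R : ℝ} (hR : 0 < R) {Y : ∀ n : ℕ+, ι n → SphHarm n}
    (hY : ∀ n : ℕ+, IsOrthonormalHarmonics n (Y n)) (q : (Σ n : ℕ+, ι n) × Fin 2) :
    vecHarm R Y q ≠ 0 := by
  have h0 := ne_zero_of_isOrthonormal (hY q.1.1) q.1.2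
  rw [vecHarm]
  split_ifs
  · exact gradYT_ne_zero hR q.1.1.2 (Y q.1.1 q.1.2).2 h0
  · exact curlYT_ne_zero hR q.1.1.2 (Y q.1.1 q.1.2).2 h0

theorem inner_vecHarm_of_ne {R : ℝ} (hR : 0 < R) {Y : ∀ n : ℕ+, ι n → SphHarm n}
    (hY : ∀ n : ℕ+, IsOrthonormalHarmonics n (Y n)) {q q' : (Σ n : ℕ+, ι n) × Fin 2}
    (hq : q ≠ q') : inner ℂ (vecHarm R Y q) (vecHarm R Y q') = 0 := by
  obtain ⟨⟨n, i⟩, a⟩ := q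
  obtain ⟨⟨m, j⟩, b⟩ := q'
  have hn : 1 ≤ (n : ℕ) := n.2
  have hm : 1 ≤ (m : ℕ) := m.2
  have hgc : ∀ p ∈ SphHarm n, ∀ r ∈ SphHarm m, inner ℂ (curlYT R p) (gradYT R r) = 0 :=
    fun p hp r hr => by rw [← inner_conj_symm, inner_gradYT_curlYT hR hm hn hr hp, map_zero]
  by_cases hnm : n = m
  · subst hnm
    simp only [vecHarm]
    split_ifs with h1 h2 h2
    · have hij : j ≠ i := fun h => hq (by simp [h, h1, h2])
      rw [inner_gradYT_gradYT hR hn (Y n i).2 (Y n j).2, (hY n).2.1 j i hij, mul_zero]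
    · exact inner_gradYT_curlYT hR hn hn (Y n i).2 (Y n j).2
    · exact hgc _ (Y n i).2 _ (Y n j).2
    · have hij : j ≠ i := fun h => hq (by
        rw [h, show a = b by omega])
      rw [inner_curlYT_curlYT hR hn (Y n i).2 (Y n j).2, (hY n).2.1 j i hij, mul_zero]
  · have hnm' : (n : ℕ) ≠ m := fun h => hnm (PNat.coe_injective h)
    simp only [vecHarm]
    split_ifs with h1 h2 h2
    · exact inner_gradYT_gradYT_of_ne hR hn hm hnm' (Y n i).2 (Y m j).2
    · exact inner_gradYT_curlYT hR hn hm (Y n i).2 (Y m j).2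
    · exact hgc _ (Y n i).2 _ (Y m j).2
    · exact inner_curlYT_curlYT_of_ne hR hn hm hnm' (Y n i).2 (Y m j).2

/-- Completeness for given bases `Y`. Each `Y n` spans the spherical harmonics of degree `n`, and
conjugation, which relates inner products to the bilinear pairings, preserves them. -/
theorem eq_zero_of_inner_vecHarm {R : ℝ} (hR : 0 < R) {Y : ∀ n : ℕ+, ι n → SphHarm n}
    (hY : ∀ n : ℕ+, IsOrthonormalHarmonics n (Y n)) {φ : L2T R}
    (h : ∀ q, inner ℂ (vecHarm R Y q) φ = 0) : φ = 0 := by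
  have hRc : (R : ℂ) ≠ 0 := by exact_mod_cast hR.ne'
  have hspan : ∀ (n : ℕ+) (T : MvPolynomial (Fin 3) ℂ → Fin 3 → MvPolynomial (Fin 3) ℂ)
      (_ : ∀ p q, T (p + q) = T p + T q) (_ : ∀ (c : ℂ) p, T (c • p) = c • T p)
      (_ : ∀ i, pair (φ : L2V R) (T (conjP (Y n i))) = 0),
      ∀ p ∈ SphHarm n, pair (φ : L2V R) (T p) = 0 := by
    intro n T hadd hsmul hT p hp
    have h1 : (⟨conjP p, conjP_mem hp⟩ : SphHarm n) ∈ Submodule.span ℂ (Set.range (Y n)) := by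
      rw [(hY n).2.2]
      trivial
    have h2 : ∀ q ∈ Submodule.span ℂ (Set.range (Y n)), pair (φ : L2V R) (T (conjP q)) = 0 := by
      intro q hq
      induction hq using Submodule.span_induction with
      | mem q hq =>
        obtain ⟨i, rfl⟩ := hq
        exact hT i
      | zero =>
        have : T (conjP 0) = (0 : ℂ) • T 0 := by rw [← hsmul]; simp [conjP]
        rw [Submodule.coe_zero, this, pair_smul, zero_mul]
      | add q r _ _ hq hr =>
        have : T (conjP (q + r : SphHarm n)) = T (conjP q) + T (conjP r) := by
          rw [← hadd]; simp [conjP]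
        rw [this, pair_add hR, hq, hr, add_zero]
      | smul c q _ hq =>
        have : T (conjP (c • q : SphHarm n)) = (starRingEnd ℂ c) • T (conjP q) := by
          rw [← hsmul]; simp [conjP, ← MvPolynomial.C_mul']
        rw [this, pair_smul, hq, mul_zero]
    have h3 := h2 _ h1
    simpa only [conjP_conjP] using h3
  refine Subtype.ext (eq_zero_of_forall_pair hR φ.2 (fun n hn => ?_) fun n hn => ?_)
  · refine hspan ⟨n, hn⟩ (gradP n) (fun p q => ?_) (fun c p => ?_) fun i => ?_
    · funext l
      simp only [gradP, Pi.add_apply, map_add, mul_add, smul_add]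
      ring
    · funext l
      simp only [gradP, Pi.smul_apply, Derivation.map_smul, mul_smul_comm, smul_sub, smul_comm c]
    · have h1 := h (⟨⟨n, hn⟩, i⟩, 0)
      rw [vecHarm, if_pos rfl, Submodule.coe_inner, coe_gradYT hR hn (Y ⟨n, hn⟩ i).2,
        inner_smul_left, inner_polyV_eq_pair] at h1
      simp only [← gradP_conjP] at h1
      refine (mul_eq_zero.1 h1).resolve_left ?_
      simp [hRc]
  · refine hspan ⟨n, hn⟩ curlP (fun p q => ?_) (fun c p => ?_) fun i => ?_
    · funext l
      fin_cases l <;> exact rot_add _ _ p q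
    · funext l
      fin_cases l <;> exact rot_smul _ _ c p
    · have h1 := h (⟨⟨n, hn⟩, i⟩, 1)
      rw [vecHarm, if_neg (by simp), Submodule.coe_inner, coe_curlYT hR hn (Y ⟨n, hn⟩ i).2,
        inner_smul_left, inner_polyV_eq_pair] at h1
      simp only [← curlP_conjP] at h1
      refine (mul_eq_zero.1 h1).resolve_left ?_
      simp [hRc]

theorem inner_smul_add_smul {R : ℝ} (v a b : L2T R) (s t : ℂ) :
    inner ℂ v (s • a + t • b) = s * inner ℂ v a + t * inner ℂ v b := by
  rw [Submodule.coe_inner, Submodule.coe_add, Submodule.coe_smul, Submodule.coe_smul,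
    inner_add_right, inner_smul_right, inner_smul_right]
  rfl

/-- The coefficient of a field along a vector spherical harmonic. -/
def coeff {R : ℝ} (v φ : L2T R) : ℂ := inner ℂ v φ / inner ℂ v v

theorem hasSum_vecHarm {R : ℝ} (hR : 0 < R) {Y : ∀ n : ℕ+, ι n → SphHarm n}
    (hY : ∀ n : ℕ+, IsOrthonormalHarmonics n (Y n)) (φ : L2T R) :
    HasSum (fun j : Σ n : ℕ+, ι n => coeff (gradYT R (Y j.1 j.2)) φ • gradYT R (Y j.1 j.2) +
      coeff (curlYT R (Y j.1 j.2)) φ • curlYT R (Y j.1 j.2)) φ := by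
  have : CompleteSpace (L2T R) := (isClosed_L2T hR).completeSpace_coe
  have h := hasSum_of_orthogonal (vecHarm_ne_zero hR hY)
    (fun q q' hq => inner_vecHarm_of_ne hR hY hq)
    (fun x hx => eq_zero_of_inner_vecHarm hR hY hx) φ
  refine h.prod_fiberwise fun j => ?_
  have h1 := hasSum_fintype fun a : Fin 2 =>
    (inner ℂ (vecHarm R Y (j, a)) φ / inner ℂ (vecHarm R Y (j, a)) (vecHarm R Y (j, a))) •
      vecHarm R Y (j, a)
  rw [Fin.sum_univ_two] at h1
  exact h1

/-- The coefficients of an expansion in vector spherical harmonics are determined by its sum. -/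
theorem coeff_eq_of_hasSum {R : ℝ} (hR : 0 < R) {Y : ∀ n : ℕ+, ι n → SphHarm n}
    (hY : ∀ n : ℕ+, IsOrthonormalHarmonics n (Y n)) {a b : (Σ n : ℕ+, ι n) → ℂ} {φ : L2T R}
    (h : HasSum (fun j : Σ n : ℕ+, ι n => a j • gradYT R (Y j.1 j.2) +
      b j • curlYT R (Y j.1 j.2)) φ) (j : Σ n : ℕ+, ι n) :
    coeff (gradYT R (Y j.1 j.2)) φ = a j ∧ coeff (curlYT R (Y j.1 j.2)) φ = b j := by
  have key : ∀ c : Fin 2, inner ℂ (vecHarm R Y (j, c)) φ =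
      (if c = 0 then a j else b j) * inner ℂ (vecHarm R Y (j, c)) (vecHarm R Y (j, c)) := by
    intro c
    have h1 := (innerSL ℂ (vecHarm R Y (j, c))).hasSum h
    have h2 : ∀ j', j' ≠ j → innerSL ℂ (vecHarm R Y (j, c)) (a j' • gradYT R (Y j'.1 j'.2) +
        b j' • curlYT R (Y j'.1 j'.2)) = 0 := by
      intro j' hj
      have e1 := inner_vecHarm_of_ne hR hY (q := (j, c)) (q' := (j', 0))
        (fun h => hj (congrArg Prod.fst h).symm)
      have e2 := inner_vecHarm_of_ne hR hY (q := (j, c)) (q' := (j', 1))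
        (fun h => hj (congrArg Prod.fst h).symm)
      have e1' : inner ℂ (vecHarm R Y (j, c)) (gradYT R (Y j'.1 j'.2)) = 0 := e1
      have e2' : inner ℂ (vecHarm R Y (j, c)) (curlYT R (Y j'.1 j'.2)) = 0 := e2
      rw [innerSL_apply_apply, inner_smul_add_smul, e1', e2', mul_zero, mul_zero, add_zero]
    have h3 := h1.unique (hasSum_single j h2)
    rw [innerSL_apply_apply] at h3
    rw [h3, innerSL_apply_apply, inner_smul_add_smul]
    have e1 : (1 : Fin 2) ≠ 0 := by decide
    fin_cases c
    · have e := inner_vecHarm_of_ne hR hY (q := (j, 0)) (q' := (j, 1)) (by simp)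
      have e' : inner ℂ (vecHarm R Y (j, 0)) (curlYT R (Y j.1 j.2)) = 0 := e
      simp only [Fin.zero_eta, e', mul_zero, add_zero, if_true]
      rfl
    · have e := inner_vecHarm_of_ne hR hY (q := (j, 1)) (q' := (j, 0)) (by simp)
      have e' : inner ℂ (vecHarm R Y (j, 1)) (gradYT R (Y j.1 j.2)) = 0 := e
      simp only [Fin.mk_one, e', mul_zero, zero_add, if_neg e1]
      rfl
  have hne : ∀ c, inner ℂ (vecHarm R Y (j, c)) (vecHarm R Y (j, c)) ≠ 0 := fun c =>
    inner_self_ne_zero.2 (vecHarm_ne_zero hR hY (j, c))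
  exact ⟨(div_eq_iff (hne 0)).2 (key 0), (div_eq_iff (hne 1)).2 (key 1)⟩

theorem sum_Xi {R : ℝ} {km kc μm μc s₁ s₂ : ℂ} {n : ℕ} (Y : SphHarm n) (c : Fin 4 → ℂ) :
    ∑ i, c i • Xi R km kc μm μc s₁ s₂ n Y i =
      ((c 2 * alpha R km kc μm μc s₁ s₂ n 2 + c 3 * alpha R km kc μm μc s₁ s₂ n 3) • gradYT R Y +
        (c 0 * alpha R km kc μm μc s₁ s₂ n 0 + c 1 * alpha R km kc μm μc s₁ s₂ n 1) • curlYT R Y,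
      (c 0 + c 1) • gradYT R Y + (c 2 + c 3) • curlYT R Y) := by
  simp only [Fin.sum_univ_four, Xi, Matrix.cons_val]
  refine Prod.ext ?_ ?_
  · simp only [Prod.fst_add, Prod.smul_fst]
    module
  · simp only [Prod.snd_add, Prod.smul_snd]
    module

theorem alpha_ne {R : ℝ} {km kc μm μc s₁ s₂ : ℂ} (hm : μm ≠ 0) (hc : μc ≠ 0) {n : ℕ}
    (hs₁ : s₁ ≠ 0) (hs₂ : s₂ ≠ 0) (h1 : dl1 R km kc n ≠ 0) (h2 : dl2 R km kc n ≠ 0) :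
    alpha R km kc μm μc s₁ s₂ n 0 - alpha R km kc μm μc s₁ s₂ n 1 ≠ 0 ∧
    alpha R km kc μm μc s₁ s₂ n 2 - alpha R km kc μm μc s₁ s₂ n 3 ≠ 0 := by
  constructor
  · have : alpha R km kc μm μc s₁ s₂ n 0 - alpha R km kc μm μc s₁ s₂ n 1 =
        2 * s₁ / (4 * dl1 R km kc n * μc * μm) := by
      simp only [alpha, Matrix.cons_val]
      ring
    rw [this]
    simp [hs₁, h1, hm, hc]
  · have : alpha R km kc μm μc s₁ s₂ n 2 - alpha R km kc μm μc s₁ s₂ n 3 =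
        2 * s₂ / (4 * dl2 R km kc n * μc * μm) := by
      simp only [alpha, Matrix.cons_val]
      ring
    rw [this]
    simp [hs₂, h2, hm, hc]

/-- The system of equations that relates the coefficients of an expansion in the `Ξ` to those in the
vector spherical harmonics. -/
theorem existsUnique_coeffs {A : Fin 4 → ℂ} (h1 : A 0 - A 1 ≠ 0) (h2 : A 2 - A 3 ≠ 0)
    (a b a' b' : ℂ) : ∃! c : Fin 4 → ℂ, (c 2 * A 2 + c 3 * A 3 = a ∧ c 0 * A 0 + c 1 * A 1 = b) ∧
      c 0 + c 1 = a' ∧ c 2 + c 3 = b' := by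
  refine ⟨![(b - A 1 * a') / (A 0 - A 1), (A 0 * a' - b) / (A 0 - A 1),
    (a - A 3 * b') / (A 2 - A 3), (A 2 * b' - a) / (A 2 - A 3)], ?_, ?_⟩
  · simp only [Matrix.cons_val]
    refine ⟨⟨?_, ?_⟩, ?_, ?_⟩ <;> field_simp <;> ring
  · rintro c ⟨⟨e1, e2⟩, e3, e4⟩
    funext i
    fin_cases i <;> simp only [Fin.zero_eta, Fin.mk_one, Fin.reduceFinMk, Matrix.cons_val] <;>
      rw [eq_div_iff (by assumption)]
    · linear_combination e2 - A 1 * e3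
    · linear_combination A 0 * e3 - e2
    · linear_combination e1 - A 3 * e4
    · linear_combination A 2 * e4 - e1

theorem hasSum_fst_snd {J A B : Type*} [AddCommMonoid A] [TopologicalSpace A] [AddCommMonoid B]
    [TopologicalSpace B] {f : J → A} {g : J → B} {F : A × B} (h : HasSum (fun j => (f j, g j)) F) :
    HasSum f F.1 ∧ HasSum g F.2 :=
  ⟨h.map (AddMonoidHom.fst A B) continuous_fst, h.map (AddMonoidHom.snd A B) continuous_snd⟩

/-- Every pair of tangential fields has a unique expansion in the `Ξ`. -/
theorem existsUnique_expansion {R : ℝ} (hR : 0 < R) {km kc μm μc : ℂ} (hm : μm ≠ 0) (hc : μc ≠ 0)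
    {s₁ s₂ : ℕ+ → ℂ} (hs₁ : ∀ n, s₁ n ≠ 0) (hs₂ : ∀ n, s₂ n ≠ 0)
    (hδ : ∀ n : ℕ+, dl1 R km kc n ≠ 0 ∧ dl2 R km kc n ≠ 0) {Y : ∀ n : ℕ+, ι n → SphHarm n}
    (hY : ∀ n : ℕ+, IsOrthonormalHarmonics n (Y n)) (F : L2T R × L2T R) :
    ∃! c : (Σ n : ℕ+, ι n) → Fin 4 → ℂ,
      HasSum (fun j : Σ n : ℕ+, ι n => ∑ i : Fin 4, c j i •
        Xi R km kc μm μc (s₁ j.1) (s₂ j.1) j.1 (Y j.1 j.2) i) F := by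
  have hα := fun n : ℕ+ => alpha_ne (R := R) (km := km) (kc := kc) hm hc (hs₁ n) (hs₂ n) (hδ n).1
    (hδ n).2
  have hsol := fun j : Σ n : ℕ+, ι n => existsUnique_coeffs (hα j.1).1 (hα j.1).2
    (coeff (gradYT R (Y j.1 j.2)) F.1) (coeff (curlYT R (Y j.1 j.2)) F.1)
    (coeff (gradYT R (Y j.1 j.2)) F.2) (coeff (curlYT R (Y j.1 j.2)) F.2)
  choose c hcs hcu using hsol
  refine ⟨c, ?_, fun d hd => ?_⟩
  · simp only [sum_Xi]
    refine HasSum.prodMk ?_ ?_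
    · simp only [(hcs _).1.1, (hcs _).1.2]
      exact hasSum_vecHarm hR hY F.1
    · simp only [(hcs _).2.1, (hcs _).2.2]
      exact hasSum_vecHarm hR hY F.2
  · simp only [sum_Xi] at hd
    have h1 := coeff_eq_of_hasSum hR hY (hasSum_fst_snd hd).1
    have h2 := coeff_eq_of_hasSum hR hY (hasSum_fst_snd hd).2
    funext j
    exact hcu j (d j) ⟨⟨(h1 j).1.symm, (h1 j).2.symm⟩, (h2 j).1.symm, (h2 j).2.symm⟩

/-- Uniqueness of expansions gives linear independence. -/
theorem linearIndependent_of_existsUnique {H J : Type*} [AddCommGroup H] [Module ℂ H]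
    [TopologicalSpace H] [IsTopologicalAddGroup H] {X : J × Fin 4 → H}
    (h : ∀ F, ∃! c : J → Fin 4 → ℂ, HasSum (fun j => ∑ i, c j i • X (j, i)) F) :
    LinearIndependent ℂ X := by
  rw [linearIndependent_iff]
  intro l hl
  have h1 : HasSum (fun q => l q • X q) 0 := by
    rw [← hl, Finsupp.linearCombination_apply]
    exact hasSum_sum_of_ne_finset_zero fun q hq => by
      rw [Finsupp.notMem_support_iff.1 hq, zero_smul]
  have h2 : HasSum (fun j => ∑ i, l (j, i) • X (j, i)) 0 :=
    h1.prod_fiberwise fun j => hasSum_fintype _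
  have h3 : HasSum (fun j : J => ∑ i, (0 : J → Fin 4 → ℂ) j i • X (j, i)) 0 := by
    simp
  have h4 := (h 0).unique (y₁ := fun j i => l (j, i)) h2 h3
  ext q
  exact congrFun (congrFun h4 q.1) q.2

/-- Existence of expansions gives density of the linear span. -/
theorem topologicalClosure_span_eq_top {H J : Type*} [AddCommGroup H] [Module ℂ H]
    [TopologicalSpace H] [IsTopologicalAddGroup H] [ContinuousConstSMul ℂ H] {X : J × Fin 4 → H}
    (h : ∀ F, ∃ c : J → Fin 4 → ℂ, HasSum (fun j => ∑ i, c j i • X (j, i)) F) :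
    (Submodule.span ℂ (Set.range X)).topologicalClosure = ⊤ := by
  rw [Submodule.eq_top_iff']
  intro F
  obtain ⟨c, hc⟩ := h F
  refine mem_closure_of_tendsto hc (Filter.Eventually.of_forall fun s => ?_)
  exact Submodule.sum_mem _ fun j _ => Submodule.sum_mem _ fun i _ =>
    Submodule.smul_mem _ _ (Submodule.subset_span ⟨(j, i), rfl⟩)

end MaxwellBall

end

theorem theorem3p3 (R ω εm μm : ℝ) (hR : 0 < R) (hω : 0 < ω) (hεm : 0 < εm) (hμm : 0 < μm)
    (εc μc kc km : ℂ) (hkm : km = ((ω * √(εm * μm) : ℝ) : ℂ))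
    (hkc : kc ^ 2 = (ω : ℂ) ^ 2 * (εc * μc)) (hkc0 : kc ≠ 0)
    (s₁ s₂ : ℕ+ → ℂ)
    (hs₁ : ∀ n : ℕ+, s₁ n ^ 2 = MaxwellBall.beta1 R km kc μm μc n)
    (hs₂ : ∀ n : ℕ+, s₂ n ^ 2 = MaxwellBall.beta2 R km kc μm μc n) :
    -- the four eigenpairs attached to a spherical harmonic of degree n
    (∀ (n : ℕ+) (Y : MaxwellBall.SphHarm n), Y ≠ 0 →
      (MaxwellBall.dl1 R km kc n ≠ 0 → ∀ i : Fin 4, i = 0 ∨ i = 1 →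
        MaxwellBall.IsEigenpair R km kc μm μc
          (MaxwellBall.tau R km kc μm μc (s₁ n) (s₂ n) n i)
          (MaxwellBall.Xi R km kc μm μc (s₁ n) (s₂ n) n Y i)) ∧
      (MaxwellBall.dl2 R km kc n ≠ 0 → ∀ i : Fin 4, i = 2 ∨ i = 3 →
        MaxwellBall.IsEigenpair R km kc μm μc
          (MaxwellBall.tau R km kc μm μc (s₁ n) (s₂ n) n i)
          (MaxwellBall.Xi R km kc μm μc (s₁ n) (s₂ n) n Y i))) ∧
    -- there are no other eigenvalues
    ((∀ n : ℕ+, MaxwellBall.dl1 R km kc n ≠ 0 ∧ MaxwellBall.dl2 R km kc n ≠ 0) →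
      ∀ (τ : ℂ) (Φ : MaxwellBall.L2T R × MaxwellBall.L2T R),
        MaxwellBall.IsEigenpair R km kc μm μc τ Φ →
        ∃ (n : ℕ+) (i : Fin 4), τ = MaxwellBall.tau R km kc μm μc (s₁ n) (s₂ n) n i) ∧
    -- the eigenfunctions form a complete basis
    ((∀ n : ℕ+, MaxwellBall.dl1 R km kc n ≠ 0 ∧ MaxwellBall.dl2 R km kc n ≠ 0 ∧
        MaxwellBall.beta1 R km kc μm μc n ≠ 0 ∧ MaxwellBall.beta2 R km kc μm μc n ≠ 0) →
      ∀ (ι : ℕ+ → Type) (Y : ∀ n : ℕ+, ι n → MaxwellBall.SphHarm n),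
        (∀ n : ℕ+, MaxwellBall.IsOrthonormalHarmonics n (Y n)) →
        LinearIndependent ℂ (fun j : (Σ n : ℕ+, ι n) × Fin 4 =>
          MaxwellBall.Xi R km kc μm μc (s₁ j.1.1) (s₂ j.1.1) j.1.1 (Y j.1.1 j.1.2) j.2) ∧
        (Submodule.span ℂ (Set.range fun j : (Σ n : ℕ+, ι n) × Fin 4 =>
          MaxwellBall.Xi R km kc μm μc (s₁ j.1.1) (s₂ j.1.1) j.1.1
            (Y j.1.1 j.1.2) j.2)).topologicalClosure = ⊤ ∧
        ∀ F : MaxwellBall.L2T R × MaxwellBall.L2T R,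
          ∃! c : (Σ n : ℕ+, ι n) → Fin 4 → ℂ,
            HasSum (fun j : Σ n : ℕ+, ι n => ∑ i : Fin 4, c j i •
              MaxwellBall.Xi R km kc μm μc (s₁ j.1) (s₂ j.1) j.1 (Y j.1 j.2) i) F) := by
  have hkm0 : km ≠ 0 := by
    rw [hkm]
    exact_mod_cast (mul_pos hω (Real.sqrt_pos.2 (mul_pos hεm hμm))).ne'
  have hm : (μm : ℂ) ≠ 0 := by exact_mod_cast hμm.ne'
  have hc : μc ≠ 0 := by
    rintro rfl
    rw [mul_zero, mul_zero] at hkc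
    exact hkc0 (pow_eq_zero_iff two_ne_zero |>.1 hkc)
  refine ⟨fun n Y hY => ⟨fun hδ i hi => ?_, fun hδ i hi => ?_⟩, fun hδ τ Φ h => ?_,
    fun hδ ι Y hY => ?_⟩
  · have h0 : (Y : MvPolynomial (Fin 3) ℂ) ≠ 0 := fun h => hY (Subtype.ext h)
    have h := MaxwellBall.alpha_tau_eq (s₂ := s₂ n) hm hc (hs₁ n) hδ hi
    have h1 := MaxwellBall.isEigenpair_curl_grad hR hkm0 hkc0 n.2 Y.2 h0 h.1 h.2
    rcases hi with rfl | rfl <;> exact h1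
  · have h0 : (Y : MvPolynomial (Fin 3) ℂ) ≠ 0 := fun h => hY (Subtype.ext h)
    have h := MaxwellBall.alpha_tau_eq' (s₁ := s₁ n) hm hc (hs₂ n) hδ hi
    have h1 := MaxwellBall.isEigenpair_grad_curl hR hkm0 hkc0 n.2 Y.2 h0 h.1 h.2
    rcases hi with rfl | rfl <;> exact h1
  · exact MaxwellBall.exists_eq_tau hR hkm0 hkc0 hm hc hs₁ hs₂ hδ h
  · have hexp := MaxwellBall.existsUnique_expansion hR (s₁ := s₁) (s₂ := s₂) hm hc
      (fun n h => (hδ n).2.2.1 (by rw [← hs₁ n, h, zero_pow two_ne_zero]))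
      (fun n h => (hδ n).2.2.2 (by rw [← hs₂ n, h, zero_pow two_ne_zero]))
      (fun n => ⟨(hδ n).1, (hδ n).2.1⟩) hY
    exact ⟨MaxwellBall.linearIndependent_of_existsUnique hexp,
      MaxwellBall.topologicalClosure_span_eq_top fun F => (hexp F).exists, hexp⟩
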